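/- For $0<\rho<1$ let $\mathbb A_\rho=\{z\in\mathbb C:\rho<|z|<1\}$. Let $0<\alpha\le 1$ and let $\Gamma,\Gamma_1\subset\mathbb C$ be closed Jordan curves of class $\mathscr C^{1,\alpha}$ (the periodically extended arc-length parameterization is $C^1$ with $\alpha$-Hölder continuous derivative), with $\Gamma_1$ contained in the Jordan domain bounded by $\Gamma$. Let $\Omega$ be the doubly connected domain between $\Gamma$ and $\Gamma_1$. A closed rectifiable Jordan curve satisfies the $B$-chord-arc condition if $d(z_1,z_2)\le B|z_1-z_2|$ for all points $z_1,z_2$ of it, where $d$ is the length of the shorter of the two arcs of the curve between $z_1$ and $z_2$. For $K\ge 1$ and $K'\ge 0$, a $(K,K')$-quasiconformal mapping of $\mathbb A_\rho$ onto $\Omega$ is a sense-preserving homeomorphism $f$ of $\mathbb A_\rho$ onto $\Omega$ which is of class ACL (absolutely continuous on lines) and satisfies $$|f_x|^2+|f_y|^2\le 2K\,J(z,f)+K'\quad\text{for almost every } z\in\mathbb A_\rho,$$ where $J(z,f)$ is the Jacobian of $f$. Then there is a constant $B>1$ such that $\Gamma$ and $\Gamma_1$ both satisfy the $B$-chord-arc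 condition. Moreover, for every $B>1$ such that $\Gamma$ and $\Gamma_1$ both satisfy the $B$-chord-arc condition, for all $\rho\in(0,1)$, $K\ge1$, $K'\ge0$ and every $(K,K')$-quasiconformal mapping $f$ of $\mathbb A_\rho$ onto $\Omega$, the mapping $f$ extends continuously to $\overline{\mathbb A_\rho}$, and there is a constant $L>0$ (depending on $K,K',B,\rho$ and $f$) such that the extension, again denoted by $f$, satisfies $$|f(z_1)-f(z_2)|\le L|z_1-z_2|^{\beta},\qquad \beta=\frac1{K(1+2B)^2},$$ whenever $|z_1|=|z_2|=1$ and whenever $|z_1|=|z_2|=\rho$. -/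

import Mathlib

open Set MeasureTheory

namespace KKQC

noncomputable section

/-- The map `g : ℝ → ℂ` is the arc-length parameterization, extended periodically with period
equal to the length `ℓ`, of a closed Jordan curve of class `C^{1,α}`. The curve itself is
`Set.range g`. -/
structure IsC1AlphaJordan (α ℓ : ℝ) (g : ℝ → ℂ) : Prop where
  length_pos : 0 < ℓ
  periodic : Function.Periodic g ℓ
  injOn : InjOn g (Ico 0 ℓ)
  contDiff : ContDiff ℝ 1 g
  unit_speed : ∀ s, ‖deriv g s‖ = 1
  holder_deriv : ∃ C : ℝ, ∀ s t, ‖deriv g s - deriv g t‖ ≤ C * |s - t| ^ α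

/-- The `b`-chord-arc condition for the closed curve of length `ℓ` with arc-length
parameterization `g`: the distance along the curve, `min |s - t| (ℓ - |s - t|)`, is at most `b`
times the length of the chord. -/
def ChordArc (b ℓ : ℝ) (g : ℝ → ℂ) : Prop :=
  ∀ s ∈ Icc 0 ℓ, ∀ t ∈ Icc 0 ℓ, min |s - t| (ℓ - |s - t|) ≤ b * ‖g s - g t‖

/-- The interior of a Jordan curve `Γ`: the points off `Γ` whose connected component in the
complement of `Γ` is bounded. -/
def jordanInterior (Γ : Set ℂ) : Set ℂ :=
  {z | z ∈ Γᶜ ∧ Bornology.IsBounded (connectedComponentIn Γᶜ z)}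

/-- The doubly connected domain between the Jordan curves `Γ` (outer) and `Γ₁` (inner). -/
def domainBetween (Γ Γ₁ : Set ℂ) : Set ℂ :=
  jordanInterior Γ \ (Γ₁ ∪ jordanInterior Γ₁)

/-- The open annulus `ρ < |z| < 1`. -/
def annulus (ρ : ℝ) : Set ℂ := {z | ρ < ‖z‖ ∧ ‖z‖ < 1}

/-- The closed annulus `ρ ≤ |z| ≤ 1`. -/
def closedAnnulus (ρ : ℝ) : Set ℂ := {z | ρ ≤ ‖z‖ ∧ ‖z‖ ≤ 1}

/-- The function `w` maps `U` homeomorphically onto `V`. -/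
def IsHomeoOnto (w : ℂ → ℂ) (U V : Set ℂ) : Prop :=
  ContinuousOn w U ∧ ∃ v : ℂ → ℂ, ContinuousOn v V ∧ MapsTo w U V ∧ MapsTo v V U ∧ InvOn v w U V

/-- A (continuous injective) map `w` is sense preserving on the open set `U`: whenever a closed
disk of centre `z` is contained in `U`, the image of its positively oriented boundary circle
winds once, in the positive direction, around `w z` (`θ` is a continuous choice of the argument
along the image). -/
def SensePreservingOn (w : ℂ → ℂ) (U : Set ℂ) : Prop :=
  ∀ z : ℂ, ∀ r : ℝ, 0 < r → Metric.closedBall z r ⊆ U →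
    ∃ θ : ℝ → ℝ, Continuous θ ∧
      (∀ t : ℝ, w (circleMap z r t) - w z =
        (‖w (circleMap z r t) - w z‖ : ℂ) * Complex.exp ((θ t : ℂ) * Complex.I)) ∧
      θ (2 * Real.pi) = θ 0 + 2 * Real.pi

/-- The class ACL on the open set `U`: continuous, and for each closed rectangle contained in `U`
with sides parallel to the axes, absolutely continuous on almost every horizontal and almost every
vertical segment joining opposite sides of the rectangle. -/
def ACLOn (w : ℂ → ℂ) (U : Set ℂ) : Prop :=
  ContinuousOn w U ∧
  ∀ a b c d : ℝ, a < b → c < d → (Icc a b ×ℂ Icc c d) ⊆ U →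
    (∀ᵐ y : ℝ, y ∈ Icc c d → AbsolutelyContinuousOnInterval (fun x : ℝ => w ⟨x, y⟩) a b) ∧
    (∀ᵐ x : ℝ, x ∈ Icc a b → AbsolutelyContinuousOnInterval (fun y : ℝ => w ⟨x, y⟩) c d)

/-- The partial derivative `w_x`. -/
def partialX (w : ℂ → ℂ) (z : ℂ) : ℂ := deriv (fun t : ℝ => w (z + t)) 0

/-- The partial derivative `w_y`. -/
def partialY (w : ℂ → ℂ) (z : ℂ) : ℂ := deriv (fun t : ℝ => w (z + t * Complex.I)) 0

/-- `‖Dw‖² = |w_x|² + |w_y|²`. -/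
def normSqD (w : ℂ → ℂ) (z : ℂ) : ℝ := ‖partialX w z‖ ^ 2 + ‖partialY w z‖ ^ 2

/-- The Jacobian of `w`. -/
def jacobian (w : ℂ → ℂ) (z : ℂ) : ℝ :=
  (partialX w z).re * (partialY w z).im - (partialX w z).im * (partialY w z).re

/-- `w` is a `(K, K')`-quasiconformal mapping of the open set `U` onto `V`. -/
structure IsQC (K K' : ℝ) (w : ℂ → ℂ) (U V : Set ℂ) : Prop where
  homeo : IsHomeoOnto w U V
  sense_preserving : SensePreservingOn w U
  acl : ACLOn w U
  distortion : ∀ᵐ z : ℂ, z ∈ U → normSqD w z ≤ 2 * K * jacobian w z + K'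

end

end KKQC

/-! Let `Ω` be the domain between the two curves and `E` the union of the curves. The proof is a
length–area argument carried out in rectangles with sides parallel to the axes, so that absolute
continuity on lines can be used directly.

**Crosscuts.** After a rotation by a multiple of a right angle, the annulus near a boundary point
`a` lies to the left of the graph of a nearly `1`-Lipschitz function (`IsLocalGraph`). For almost
every `r` the three sides of a rectangle of size `r` about `a` form a crosscut of the annulus. Its
image has finite length `l`, its two ends converge to points `p` and `q` of `E`, and the chord-arc
condition joins `p` and `q` within `E` by an arc of length at most `B l`. Together, the image of the
crosscut and this arc lie in a rectangle of perimeter at most `√2 (1 + B) l`. The image of the part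
of the annulus inside the crosscut cannot leave this rectangle (`subset_rect_of_crosscut`):
otherwise one of its points `w` and some point `w₀` of the image of the other side would both lie
outside the rectangle, and a continuous logarithm of `(z - w) / (z - w₀)` on `E`, where `w` and `w₀`
are joined by `Ω`, could be glued with one on the rectangle. The points `w` and `w₀` would then lie
in one component of the complement of `E` and the crosscut
(`mem_connectedComponentIn_of_hasContLog`, a form of the theorem of Janiszewski). Hence the image of
the inner part has diameter at most `(1 + B) l` and area at most `((1 + B) l)² / 8`.

**Analysis of the mapping.** A homeomorphism of class ACL is differentiable almost everywhere in the
plane (Gehring–Lehto), so that the integral of its Jacobian over a set is at most the area of the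
image, and the distortion inequality bounds the integral of `|f_x|² + |f_y|²` over a set by the
areas of the image and of the set. This, together with the fundamental theorem of calculus on lines,
is recorded in `GradData`.

**Length and area.** By the Cauchy–Schwarz inequality `l²` is at most a multiple of `r ψ(r)`, where
`ψ(r)` is the energy along the crosscut of size `r`. The integral of `ψ` up to `r` is the energy of
the rectangle, which is bounded by the area of its image, hence by a multiple of `r ψ(r)`, up to a
multiple of `r²`. This differential inequality makes the integral of `ψ` decay as a power of `r`,
and one good size between `δ` and `2δ` gives `exists_holder_of_isLocalGraph`: the oscillation of `f`
on a rectangle of size `δ` is at most a multiple of `δ ^ β`, uniformly in `a`. A continuous map with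
this property extends continuously to the closed annulus, with the exponent `β` on both boundary
circles (`exists_extension_of_oscillation`).

The chord-arc condition itself holds with some constant because `g` has a continuous unit
derivative: it is close to linear at small scales, and compactness settles the remaining pairs of
points. -/

namespace KKQC

/-! ### Continuous logarithms and separation of the plane -/

/-- The function `h` has a continuous logarithm on the set `X`. -/
def HasContLog (X : Set ℂ) (h : ℂ → ℂ) : Prop :=
  ∃ φ : ℂ → ℂ, ContinuousOn φ X ∧ ∀ z ∈ X, Complex.exp (φ z) = h z

lemma HasContLog.congr {X : Set ℂ} {h k : ℂ → ℂ} (H : HasContLog X h) (hk : ∀ z ∈ X, h z = k z) :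
    HasContLog X k := by
  obtain ⟨φ, hφ, e⟩ := H
  exact ⟨φ, hφ, fun z hz => (e z hz).trans (hk z hz)⟩

lemma HasContLog.mono {X Y : Set ℂ} {h : ℂ → ℂ} (H : HasContLog X h) (hY : Y ⊆ X) :
    HasContLog Y h := by
  obtain ⟨φ, hφ, e⟩ := H
  exact ⟨φ, hφ.mono hY, fun z hz => e z (hY hz)⟩

lemma HasContLog.mul {X : Set ℂ} {h k : ℂ → ℂ} (H : HasContLog X h) (H' : HasContLog X k) :
    HasContLog X (fun z => h z * k z) := by
  obtain ⟨φ, hφ, e⟩ := H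
  obtain ⟨ψ, hψ, e'⟩ := H'
  exact ⟨fun z => φ z + ψ z, hφ.add hψ, fun z hz => by rw [Complex.exp_add, e z hz, e' z hz]⟩

lemma HasContLog.inv {X : Set ℂ} {h : ℂ → ℂ} (H : HasContLog X h) :
    HasContLog X (fun z => (h z)⁻¹) := by
  obtain ⟨φ, hφ, e⟩ := H
  exact ⟨fun z => -φ z, hφ.neg, fun z hz => by rw [Complex.exp_neg, e z hz]⟩

lemma HasContLog.const_mul {X : Set ℂ} {h : ℂ → ℂ} (H : HasContLog X h) {c : ℂ} (hc : c ≠ 0) :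
    HasContLog X (fun z => c * h z) :=
  HasContLog.mul ⟨fun _ => Complex.log c, continuousOn_const, fun _ _ => Complex.exp_log hc⟩ H

lemma hasContLog_of_slitPlane {X : Set ℂ} {h : ℂ → ℂ} (hc : ContinuousOn h X)
    (hs : ∀ z ∈ X, h z ∈ Complex.slitPlane) : HasContLog X h :=
  ⟨fun z => Complex.log (h z), hc.clog hs,
    fun z hz => Complex.exp_log (Complex.slitPlane_ne_zero (hs z hz))⟩

/-- Two continuous functions with the same exponential on a connected set differ by a constant. -/
lemma eqOn_of_exp_eqOn {A : Type*} [TopologicalSpace A] {X : Set A} (hX : IsPreconnected X)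
    {φ ψ : A → ℂ} (hφ : ContinuousOn φ X)
    (hψ : ContinuousOn ψ X) (he : ∀ z ∈ X, Complex.exp (φ z) = Complex.exp (ψ z)) {a : A}
    (ha : a ∈ X) (hab : φ a = ψ a) : EqOn φ ψ X := by
  refine Complex.isCoveringMap_exp.eqOn_of_comp_eqOn hX hφ hψ (fun z hz => ?_) ha hab
  exact Subtype.ext (he z hz)

/-- Janiszewski's gluing step: logarithms on two closed sets with connected intersection can be
adjusted to agree on the intersection. -/
lemma HasContLog.union {A B : Set ℂ} {h : ℂ → ℂ} (hA : IsClosed A) (hB : IsClosed B)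
    (hAB : IsPreconnected (A ∩ B)) (HA : HasContLog A h) (HB : HasContLog B h) :
    HasContLog (A ∪ B) h := by
  classical
  obtain ⟨φ, hφ, eφ⟩ := HA
  obtain ⟨ψ, hψ, eψ⟩ := HB
  obtain ⟨c, hc, hc1⟩ : ∃ c : ℂ, Complex.exp c = 1 ∧ ∀ z ∈ A ∩ B, φ z = ψ z + c := by
    rcases (A ∩ B).eq_empty_or_nonempty with h0 | ⟨a, ha⟩
    · exact ⟨0, Complex.exp_zero, by simp [h0]⟩
    · have h1 : Complex.exp (φ a - ψ a) = 1 := by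
        rw [Complex.exp_sub, eφ a ha.1, ← eψ a ha.2, div_self (Complex.exp_ne_zero _)]
      refine ⟨φ a - ψ a, h1, ?_⟩
      refine eqOn_of_exp_eqOn hAB (hφ.mono inter_subset_left)
        ((hψ.mono inter_subset_right).add continuousOn_const) (fun z hz => ?_) ha (by ring)
      rw [Complex.exp_add, h1, mul_one, eφ z hz.1, eψ z hz.2]
  refine ⟨fun z => if z ∈ A then φ z else ψ z + c, ?_, ?_⟩
  · refine ContinuousOn.union_of_isClosed ?_ ?_ hA hB
    · exact hφ.congr fun z hz => by simp [hz]
    · refine (hψ.add (continuousOn_const (c := c))).congr fun z hz => ?_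
      by_cases hzA : z ∈ A
      · simp only [hzA, if_true]; exact hc1 z ⟨hzA, hz⟩
      · simp [hzA]
  · rintro z hz
    by_cases hzA : z ∈ A
    · simp [hzA, eφ z hzA]
    · simp [hzA, Complex.exp_add, hc, eψ z (hz.resolve_left hzA)]

/-- Points joined by a connected set missing the compact set `X` are not separated by `X` in the
sense of logarithms. -/
lemma hasContLog_of_isPreconnected {X T : Set ℂ} (hX : IsClosed X) (hT : IsPreconnected T)
    (hd : Disjoint T X) {p q : ℂ} (hp : p ∈ T) (hq : q ∈ T) :
    HasContLog X (fun z => (z - p) / (z - q)) := by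
  have hne : ∀ z ∈ X, ∀ w ∈ T, z - w ≠ 0 := fun z hz w hw h =>
    (Set.disjoint_left.1 hd hw) ((sub_eq_zero.1 h) ▸ hz)
  refine hT.induction₂ (fun p q => HasContLog X (fun z => (z - p) / (z - q)))
    ?_ ?_ ?_ hp hq
  · intro x hx
    have hxX : Xᶜ ∈ nhds x := hX.isOpen_compl.mem_nhds (Set.disjoint_left.1 hd hx)
    obtain ⟨ε, hε, hb⟩ := Metric.mem_nhds_iff.1 hxX
    filter_upwards [self_mem_nhdsWithin, mem_nhdsWithin_of_mem_nhds (Metric.ball_mem_nhds x hε)]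
      with y hyT hy
    have key : HasContLog X (fun z => (z - y) / (z - x)) := by
      refine hasContLog_of_slitPlane ?_ ?_
      · exact ContinuousOn.div (by fun_prop) (by fun_prop) (fun z hz => hne z hz x hx)
      · intro z hz
        have h1 : (z - y) / (z - x) = 1 + (x - y) / (z - x) := by
          have := hne z hz x hx
          field_simp; ring
        rw [h1]
        apply Complex.mem_slitPlane_of_norm_lt_one
        rw [norm_div, div_lt_one (norm_pos_iff.2 (hne z hz x hx))]
        have h2 : ε ≤ dist z x := by
          by_contra hlt
          exact hb (Metric.mem_ball.2 (not_le.1 hlt)) hz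
        rw [Metric.mem_ball, dist_comm, dist_eq_norm] at hy
        rw [dist_eq_norm] at h2
        linarith
    exact key.inv.congr fun z _ => by rw [inv_div]
  · intro x y z _ hy _ h1 h2
    refine (h1.mul h2).congr fun w hw => ?_
    have := hne w hw y hy
    field_simp
  · intro x y _ _ h1
    exact h1.inv.congr fun z _ => by rw [inv_div]

lemma isPreconnected_norm_gt {R : ℝ} (hR : 0 < R) : IsPreconnected {z : ℂ | R < ‖z‖} := by
  have h1 : {z : ℂ | R < ‖z‖} = Complex.exp '' {w : ℂ | Real.log R < w.re} := by
    ext z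
    constructor
    · intro hz
      have hz' : R < ‖z‖ := hz
      have h0 : z ≠ 0 := norm_pos_iff.1 (hR.trans hz')
      exact ⟨Complex.log z, by simpa [Complex.log_re] using Real.log_lt_log hR hz',
        Complex.exp_log h0⟩
    · rintro ⟨w, hw, rfl⟩
      have hw' : Real.log R < w.re := hw
      simp only [mem_ofPred_eq, Complex.norm_exp]
      rwa [← Real.log_lt_iff_lt_exp hR]
  rw [h1]
  exact ((convex_halfSpace_re_gt _).isPreconnected).image _ Complex.continuous_exp.continuousOn

lemma frontier_connectedComponentIn_compl {X : Set ℂ} (hX : IsClosed X) (p : ℂ) :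
    frontier (connectedComponentIn Xᶜ p) ⊆ X := by
  intro z hz
  by_contra hzX
  have hopen : IsOpen (connectedComponentIn Xᶜ p) := hX.isOpen_compl.connectedComponentIn
  obtain ⟨ε, hε, hb⟩ := Metric.isOpen_iff.1 hX.isOpen_compl z hzX
  obtain ⟨y, hyU, hyb⟩ := mem_closure_iff_nhds.1 (frontier_subset_closure hz) _
    (Metric.ball_mem_nhds z hε)
  have hsub : Metric.ball z ε ⊆ connectedComponentIn Xᶜ p := by
    rw [connectedComponentIn_eq hyb]
    exact (convex_ball z ε).isPreconnected.subset_connectedComponentIn hyU hb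
  rw [hopen.frontier_eq] at hz
  exact hz.2 (hsub (Metric.mem_ball_self hε))

/-- A branch of `log (z - p)` cannot exist on a circle about `p`. -/
lemma not_continuous_log_circle {p : ℂ} {R : ℝ} (hR : 0 < R) {φ : ℂ → ℂ} (hφ : Continuous φ)
    (h : ∀ t : ℝ, Complex.exp (φ (circleMap p R t)) = circleMap p R t - p) : False := by
  have hc : Complex.exp (Real.log R : ℂ) = R := by
    rw [← Complex.ofReal_exp, Real.exp_log hR]
  have h1 : EqOn (fun t : ℝ => φ (circleMap p R t))
      (fun t : ℝ => φ (circleMap p R 0) + (t : ℂ) * Complex.I) univ := by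
    refine eqOn_of_exp_eqOn isPreconnected_univ
      (hφ.comp (continuous_circleMap p R)).continuousOn (by fun_prop) (fun t _ => ?_)
      (mem_univ (0 : ℝ)) (by simp)
    rw [Complex.exp_add, h, h]
    simp [circleMap]
  have h2 := h1 (mem_univ (2 * Real.pi))
  have h3 : circleMap p R (2 * Real.pi) = circleMap p R 0 := by
    simpa using (periodic_circleMap p R) 0
  simp only [h3] at h2
  have : ((2 * Real.pi : ℝ) : ℂ) * Complex.I = 0 := by linear_combination -h2
  simp [Real.pi_ne_zero] at this

/-- **Borsuk**: if the component of `p` in the complement of the compact set `X` is bounded and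
omits `q`, then `(z - p) / (z - q)` has no continuous logarithm on `X`. -/
lemma not_hasContLog_of_isBounded {X : Set ℂ} (hX : IsCompact X) {p q : ℂ} (hp : p ∉ X)
    (hq : q ∉ X) (hqU : q ∉ connectedComponentIn Xᶜ p)
    (hbd : Bornology.IsBounded (connectedComponentIn Xᶜ p)) :
    ¬ HasContLog X (fun z => (z - p) / (z - q)) := by
  classical
  rintro ⟨φ, hφ, eφ⟩
  set U := connectedComponentIn Xᶜ p with hU
  have hUo : IsOpen U := hX.isClosed.isOpen_compl.connectedComponentIn
  have hpU : p ∈ U := mem_connectedComponentIn hp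
  obtain ⟨Φ, hΦ⟩ := ContinuousMap.exists_restrict_eq hX.isClosed
    (⟨X.domRestrict φ, continuousOn_iff_continuous_domRestrict.mp hφ⟩ : C(X, ℂ))
  have hΦ' : ∀ z ∈ X, Φ z = φ z := fun z hz => by
    simpa using congr($hΦ ⟨z, hz⟩)
  have hqc : q ∉ closure U := by
    rw [closure_eq_self_union_frontier]
    rintro (h | h)
    · exact hqU h
    · exact hq (frontier_connectedComponentIn_compl hX.isClosed p h)
  -- `F` agrees with `z - p` off `U` and is a nonvanishing extension of it inside.
  set F : ℂ → ℂ := fun z => if z ∈ closure U then (z - q) * Complex.exp (Φ z) else z - p with hF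
  have hFout : ∀ z ∈ Uᶜ, F z = z - p := by
    intro z hz
    by_cases hzc : z ∈ closure U
    · have hzX : z ∈ X := frontier_connectedComponentIn_compl hX.isClosed p
        (by rw [hUo.frontier_eq]; exact ⟨hzc, hz⟩)
      have : z - q ≠ 0 := fun h => hq ((sub_eq_zero.1 h) ▸ hzX)
      simp only [hF, hzc, if_true, hΦ' z hzX, eφ z hzX]
      field_simp
    · simp [hF, hzc]
  have hFc : Continuous F := by
    rw [← continuousOn_univ, show (univ : Set ℂ) = closure U ∪ Uᶜ from
      (eq_univ_of_forall fun z => (em (z ∈ U)).imp (fun h => subset_closure h) id).symm]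
    refine ContinuousOn.union_of_isClosed ?_ ?_ isClosed_closure hUo.isClosed_compl
    · exact (by fun_prop : ContinuousOn (fun z => (z - q) * Complex.exp (Φ z)) (closure U)).congr
        fun z hz => by simp [hF, hz]
    · exact (by fun_prop : ContinuousOn (fun z => z - p) Uᶜ).congr hFout
  have hF0 : ∀ z, F z ≠ 0 := by
    intro z
    by_cases hzc : z ∈ closure U
    · have : z - q ≠ 0 := fun h => hqc ((sub_eq_zero.1 h) ▸ hzc)
      simp [hF, hzc, this, Complex.exp_ne_zero]
    · have : z - p ≠ 0 := fun h => hzc (subset_closure ((sub_eq_zero.1 h) ▸ hpU))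
      simpa [hF, hzc] using this
  have hsc : IsSimplyConnected (univ : Set ℂ) := by
    have : ContractibleSpace (univ : Set ℂ) :=
      Convex.contractibleSpace (convex_univ (𝕜 := ℝ)) ⟨0, mem_univ _⟩
    exact SimplyConnectedSpace.ofContractible _
  obtain ⟨Λ, hΛ, eΛ⟩ := Complex.exists_continuousOn_eqOn_exp_comp hsc isOpen_univ
    hFc.continuousOn (by rintro ⟨z, -, hz⟩; exact hF0 z hz)
  rw [continuousOn_univ] at hΛ
  obtain ⟨R, hR0, hR⟩ := hbd.subset_ball_lt 0 p
  refine not_continuous_log_circle hR0 hΛ (p := p) (fun t => ?_)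
  have h1 := eΛ (mem_univ (circleMap p R t))
  simp only [Function.comp] at h1
  rw [h1]
  refine hFout _ (fun h => ?_)
  have := hR h
  simp [circleMap, abs_of_pos hR0] at this

/-- Of two different components of the complement of a bounded set, one is bounded. -/
lemma isBounded_connectedComponentIn_or {X : Set ℂ} (hX : Bornology.IsBounded X) {p q : ℂ}
    (hpq : q ∉ connectedComponentIn Xᶜ p) (hq : q ∉ X) :
    Bornology.IsBounded (connectedComponentIn Xᶜ p) ∨
      Bornology.IsBounded (connectedComponentIn Xᶜ q) := by
  obtain ⟨R, hR0, hR⟩ := hX.subset_closedBall_lt 0 0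
  have hext : {z : ℂ | R < ‖z‖} ⊆ Xᶜ := fun z hz hzX => by
    have := hR hzX
    simp only [Metric.mem_closedBall, dist_zero_right] at this
    exact absurd hz (not_lt.2 this)
  by_contra hcon
  push Not at hcon
  have meet : ∀ p, ¬ Bornology.IsBounded (connectedComponentIn Xᶜ p) →
      ∃ z ∈ connectedComponentIn Xᶜ p, R < ‖z‖ := by
    intro p hp
    by_contra hno
    push Not at hno
    exact hp ((Metric.isBounded_closedBall (x := (0 : ℂ)) (r := R)).subset fun z hz => by
      simpa using hno z hz)
  obtain ⟨z, hz, hzR⟩ := meet p hcon.1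
  obtain ⟨w, hw, hwR⟩ := meet q hcon.2
  have h1 : w ∈ connectedComponentIn Xᶜ p := by
    rw [connectedComponentIn_eq hz]
    exact (isPreconnected_norm_gt hR0).subset_connectedComponentIn hzR hext hwR
  rw [connectedComponentIn_eq h1, ← connectedComponentIn_eq hw] at hpq
  exact hpq (mem_connectedComponentIn hq)

/-- **Borsuk's separation criterion**. -/
lemma mem_connectedComponentIn_of_hasContLog {X : Set ℂ} (hX : IsCompact X) {p q : ℂ} (hp : p ∉ X)
    (hq : q ∉ X) (H : HasContLog X (fun z => (z - p) / (z - q))) :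
    q ∈ connectedComponentIn Xᶜ p := by
  by_contra hcon
  rcases isBounded_connectedComponentIn_or hX.isBounded hcon hq with hb | hb
  · exact not_hasContLog_of_isBounded hX hp hq hcon hb H
  · refine not_hasContLog_of_isBounded hX hq hp (fun h => hcon ?_) hb
      (H.inv.congr fun z _ => by rw [inv_div])
    rw [← connectedComponentIn_eq h]
    exact mem_connectedComponentIn hq

/-- `z - w` has a continuous logarithm on a closed rectangle omitting `w`. -/
lemma hasContLog_sub_rect {x₁ x₂ y₁ y₂ : ℝ} {w : ℂ} (hw : w ∉ Icc x₁ x₂ ×ℂ Icc y₁ y₂) :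
    HasContLog (Icc x₁ x₂ ×ℂ Icc y₁ y₂) (fun z => z - w) := by
  -- One of the four rotations of `z - w` has positive real part on the rectangle.
  have key : ∀ c : ℂ, c ≠ 0 → (∀ z ∈ Icc x₁ x₂ ×ℂ Icc y₁ y₂, 0 < (c * (z - w)).re) →
      HasContLog (Icc x₁ x₂ ×ℂ Icc y₁ y₂) (fun z => z - w) := by
    intro c hc h
    refine ((hasContLog_of_slitPlane (h := fun z => c * (z - w)) (by fun_prop)
      fun z hz => Or.inl (h z hz)).const_mul (inv_ne_zero hc)).congr fun z _ => ?_
    field_simp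
  rw [Complex.mem_reProdIm, mem_Icc, mem_Icc] at hw
  by_cases h1 : x₁ ≤ w.re
  · by_cases h2 : w.re ≤ x₂
    · by_cases h3 : y₁ ≤ w.im
      · have h4 : y₂ < w.im := by
          by_contra h4
          exact hw ⟨⟨h1, h2⟩, h3, not_lt.1 h4⟩
        refine key Complex.I Complex.I_ne_zero fun z hz => ?_
        rw [Complex.mem_reProdIm, mem_Icc, mem_Icc] at hz
        simp; linarith [hz.2.2]
      · refine key (-Complex.I) (neg_ne_zero.2 Complex.I_ne_zero) fun z hz => ?_
        rw [Complex.mem_reProdIm, mem_Icc, mem_Icc] at hz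
        simp; linarith [hz.2.1]
    · refine key (-1) (by norm_num) fun z hz => ?_
      rw [Complex.mem_reProdIm, mem_Icc, mem_Icc] at hz
      simp; linarith [hz.1.2]
  · refine key 1 one_ne_zero fun z hz => ?_
    rw [Complex.mem_reProdIm, mem_Icc, mem_Icc] at hz
    simp; linarith [hz.1.1]

/-- The crosscut lemma. The connected set `Ω` is bounded by the compact set `E`, in the sense that
a connected set which misses `E` and meets `Ω` lies in `Ω`. A crosscut `k` of `Ω` splits `Ω` into
the open sets `S` and `R`; together with the connected piece `σ` of `E` it forms a compact set
contained in the rectangle `W`. Then one of the two sides of the crosscut is contained in `W`. -/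
lemma subset_rect_of_crosscut {Ω E k σ S R : Set ℂ} {x₁ x₂ y₁ y₂ : ℝ}
    (hΩ : IsPreconnected Ω) (hE : IsCompact E) (hΩE : Disjoint Ω E)
    (hmax : ∀ T : Set ℂ, IsPreconnected T → Disjoint T E → (T ∩ Ω).Nonempty → T ⊆ Ω)
    (hσE : σ ⊆ E) (hσ : IsPreconnected σ) (hk : k ⊆ Ω) (hC : IsCompact (k ∪ σ))
    (hW : k ∪ σ ⊆ Icc x₁ x₂ ×ℂ Icc y₁ y₂)
    (hS : IsOpen S) (hR : IsOpen R) (hSR : Disjoint S R) (hSk : Disjoint S k) (hRk : Disjoint R k)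
    (hSΩ : S ⊆ Ω) (hRΩ : R ⊆ Ω) (hcover : Ω ⊆ S ∪ R ∪ k)
    {w₀ : ℂ} (hw₀ : w₀ ∈ R) (hw₀W : w₀ ∉ Icc x₁ x₂ ×ℂ Icc y₁ y₂) :
    S ⊆ Icc x₁ x₂ ×ℂ Icc y₁ y₂ := by
  intro w hw
  by_contra hwW
  have hX : IsCompact (E ∪ (k ∪ σ)) := hE.union hC
  have hinter : E ∩ (k ∪ σ) = σ := by
    ext z
    constructor
    · rintro ⟨hzE, hz | hz⟩
      · exact absurd hzE (Set.disjoint_left.1 hΩE (hk hz))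
      · exact hz
    · exact fun hz => ⟨hσE hz, Or.inr hz⟩
  have hlog : HasContLog (E ∪ (k ∪ σ)) (fun z => (z - w) / (z - w₀)) := by
    refine HasContLog.union hE.isClosed hC.isClosed (by rwa [hinter]) ?_ ?_
    · exact hasContLog_of_isPreconnected hE.isClosed hΩ hΩE (hSΩ hw) (hRΩ hw₀)
    · exact (((hasContLog_sub_rect hwW).mono hW).mul
        ((hasContLog_sub_rect hw₀W).mono hW).inv).congr fun z _ => (div_eq_mul_inv _ _).symm
  have notX : ∀ z ∈ Ω, z ∉ k → z ∉ Icc x₁ x₂ ×ℂ Icc y₁ y₂ → z ∉ E ∪ (k ∪ σ) := by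
    rintro z hz hzk hzW (h | h)
    · exact Set.disjoint_left.1 hΩE hz h
    · exact hzW (hW h)
  have hwX := notX w (hSΩ hw) (Set.disjoint_left.1 hSk hw) hwW
  have hw₀X := notX w₀ (hRΩ hw₀) (Set.disjoint_left.1 hRk hw₀) hw₀W
  have hmem := mem_connectedComponentIn_of_hasContLog hX hwX hw₀X hlog
  set T := connectedComponentIn (E ∪ (k ∪ σ))ᶜ w with hT
  have hTX : T ⊆ (E ∪ (k ∪ σ))ᶜ := connectedComponentIn_subset _ _
  have hTpre : IsPreconnected T := isPreconnected_connectedComponentIn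
  have hwT : w ∈ T := mem_connectedComponentIn hwX
  have hTΩ : T ⊆ Ω := hmax T hTpre
    (Set.disjoint_left.2 fun z hz h => hTX hz (Or.inl h)) ⟨w, hwT, hSΩ hw⟩
  have hTSR : T ⊆ S ∪ R := fun z hz => by
    rcases hcover (hTΩ hz) with h | h
    · exact h
    · exact absurd (Or.inr (Or.inl h)) (hTX hz)
  obtain ⟨z, -, hzS, hzR⟩ := hTpre S R hS hR hTSR ⟨w, hwT, hw⟩ ⟨w₀, hmem, hw₀⟩
  exact Set.disjoint_left.1 hSR hzS hzR

/-! ### Points of linear density -/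

lemma continuous_mk_re (y : ℝ) : Continuous fun x : ℝ => (⟨x, y⟩ : ℂ) :=
  Complex.equivRealProdCLM.symm.continuous.comp (continuous_id.prodMk continuous_const)

lemma continuous_mk_im (x : ℝ) : Continuous fun y : ℝ => (⟨x, y⟩ : ℂ) :=
  Complex.equivRealProdCLM.symm.continuous.comp (continuous_const.prodMk continuous_id)

lemma ae_complex_iff_ae_ae_re {P : ℂ → Prop} (hP : MeasurableSet {z | P z}) :
    (∀ᵐ z, P z) ↔ ∀ᵐ x : ℝ, ∀ᵐ y : ℝ, P ⟨x, y⟩ := by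
  have hmp := Complex.volume_preserving_equiv_real_prod.symm
  have h1 : (∀ᵐ z : ℂ, P z) ↔
      ∀ᵐ w : ℝ × ℝ, P (Complex.measurableEquivRealProd.symm w) := by
    rw [← hmp.map_eq]
    exact ae_map_iff hmp.measurable.aemeasurable hP
  rw [h1, Measure.volume_eq_prod, Measure.ae_prod_iff_ae_ae
    (p := fun w => P (Complex.measurableEquivRealProd.symm w)) (hmp.measurable hP)]
  rfl

lemma ae_complex_iff_ae_ae_im {P : ℂ → Prop} (hP : MeasurableSet {z | P z}) :
    (∀ᵐ z, P z) ↔ ∀ᵐ y : ℝ, ∀ᵐ x : ℝ, P ⟨x, y⟩ := by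
  rw [ae_complex_iff_ae_ae_re hP]
  have hmp := Complex.volume_preserving_equiv_real_prod.symm
  exact Measure.ae_ae_comm (μ := (volume : Measure ℝ)) (ν := (volume : Measure ℝ))
    (p := fun x y => P ⟨x, y⟩) (hmp.measurable hP)

lemma ae_ae_re_of_ae_complex {P : ℂ → Prop} (hP : ∀ᵐ z, P z) :
    ∀ᵐ x : ℝ, ∀ᵐ y : ℝ, P ⟨x, y⟩ := by
  obtain ⟨s, hs, hsm, h0⟩ := (exists_measurable_superset_of_null (μ := volume) hP)
  have h1 := (ae_complex_iff_ae_ae_re (P := fun z => z ∉ s) hsm.compl).1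
    (measure_eq_zero_iff_ae_notMem.1 h0)
  filter_upwards [h1] with x hx
  filter_upwards [hx] with y hy
  by_contra hcon
  exact hy (hs hcon)

lemma ae_ae_im_of_ae_complex {P : ℂ → Prop} (hP : ∀ᵐ z, P z) :
    ∀ᵐ y : ℝ, ∀ᵐ x : ℝ, P ⟨x, y⟩ := by
  obtain ⟨s, hs, hsm, h0⟩ := (exists_measurable_superset_of_null (μ := volume) hP)
  have h1 := (ae_complex_iff_ae_ae_im (P := fun z => z ∉ s) hsm.compl).1
    (measure_eq_zero_iff_ae_notMem.1 h0)
  filter_upwards [h1] with x hx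
  filter_upwards [hx] with y hy
  by_contra hcon
  exact hy (hs hcon)

/-- Almost every point `x` of a measurable set of reals is approximated by the set in the following
sense: all points `x + s` with `s` small are within `|s| / (k + 1)` of the set. -/
lemma ae_exists_near_of_mem {S : Set ℝ} (hS : MeasurableSet S) :
    ∀ᵐ x : ℝ, x ∈ S → ∀ k : ℕ, ∃ m : ℕ, ∀ s : ℝ, |s| < 1 / (m + 1) →
      ∃ s' : ℝ, |s' - s| ≤ |s| / (k + 1) ∧ x + s' ∈ S := by
  have h := ae_all_iff.2 fun k : ℕ =>
    IsUnifLocDoublingMeasure.ae_tendsto_measure_inter_div (volume : Measure ℝ) S ((k : ℝ) + 1)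
  rw [ae_restrict_iff' hS] at h
  filter_upwards [h] with x hx hxS k
  have hk : (0 : ℝ) < k + 1 := by positivity
  have h1 := hx hxS k (l := nhdsWithin (0 : ℝ) {0}ᶜ) (fun s => x + s) (fun s => |s| / (k + 1)) ?_ ?_
  · have h2 : ∀ᶠ s : ℝ in nhdsWithin (0 : ℝ) {0}ᶜ,
        volume (S ∩ Metric.closedBall (x + s) (|s| / (k + 1))) /
          volume (Metric.closedBall (x + s) (|s| / (k + 1))) ≠ 0 :=
      h1.eventually_ne one_ne_zero
    rw [eventually_nhdsWithin_iff, Metric.eventually_nhds_iff] at h2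
    obtain ⟨ε, hε, h2⟩ := h2
    obtain ⟨m, hm⟩ := exists_nat_one_div_lt hε
    refine ⟨m, fun s hs => ?_⟩
    by_cases h0 : s = 0
    · exact ⟨0, by simp [h0], by simpa using hxS⟩
    · have h3 := h2 (y := s) (by rw [Real.dist_eq, sub_zero]; exact hs.trans hm) h0
      have h4 : (S ∩ Metric.closedBall (x + s) (|s| / (k + 1))).Nonempty := by
        by_contra hne
        rw [not_nonempty_iff_eq_empty] at hne
        simp [hne] at h3
      obtain ⟨w, hwS, hw⟩ := h4
      refine ⟨w - x, ?_, by simpa using hwS⟩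
      rw [Metric.mem_closedBall, Real.dist_eq] at hw
      rwa [sub_sub]
  · rw [tendsto_nhdsWithin_iff]
    constructor
    · have : Filter.Tendsto (fun s : ℝ => |s| / (k + 1)) (nhds 0) (nhds (|0| / (k + 1))) := by
        apply Continuous.tendsto; fun_prop
      simp only [abs_zero, zero_div] at this
      exact this.mono_left nhdsWithin_le_nhds
    · filter_upwards [self_mem_nhdsWithin] with s hs
      have : 0 < |s| := abs_pos.2 hs
      exact mem_Ioi.2 (by positivity)
  · filter_upwards with s
    rw [Metric.mem_closedBall, Real.dist_eq]
    have : ((k : ℝ) + 1) * (|s| / (k + 1)) = |s| := by field_simp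
    rw [this]
    simp

/-- The points `z` which are approximated by `E` along the line `z + ℝ e`: all points `z + s e` of
this line with `s` small are within `|s| / (k + 1)` of a point of `E` on the line. -/
def linearDensity (e : ℂ) (E : Set ℂ) : Set ℂ :=
  {z | ∀ k : ℕ, ∃ m : ℕ, ∀ s : ℝ, |s| < 1 / (m + 1) →
      ∃ s' : ℝ, |s' - s| ≤ |s| / (k + 1) ∧ z + s' * e ∈ E}

lemma measurableSet_linearDensity (e : ℂ) {E : Set ℂ} (hE : IsCompact E) :
    MeasurableSet (linearDensity e E) := by
  have h0 : linearDensity e E = ⋂ k : ℕ, ⋃ m : ℕ, ⋂ s : ℝ, ⋂ _ : |s| < 1 / ((m : ℝ) + 1),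
      {z | ∃ s' : ℝ, |s' - s| ≤ |s| / (k + 1) ∧ z + s' * e ∈ E} := by
    ext z; simp [linearDensity]
  rw [h0]
  refine MeasurableSet.iInter fun k => MeasurableSet.iUnion fun m => IsClosed.measurableSet ?_
  refine isClosed_iInter fun s => isClosed_iInter fun _ => ?_
  have h1 : {z | ∃ s' : ℝ, |s' - s| ≤ |s| / (k + 1) ∧ z + s' * e ∈ E} =
      (fun w : ℂ × ℝ => w.1 - w.2 * e) '' (E ×ˢ Metric.closedBall s (|s| / (k + 1))) := by
    ext z
    constructor
    · rintro ⟨s', h, hE'⟩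
      exact ⟨(z + s' * e, s'), ⟨hE', by simpa [Real.dist_eq] using h⟩, by simp⟩
    · rintro ⟨⟨w, s'⟩, ⟨hw, hs⟩, rfl⟩
      exact ⟨s', by simpa [Real.dist_eq] using hs, by simpa using hw⟩
  rw [h1]
  exact ((hE.prod (isCompact_closedBall _ _)).image (by fun_prop)).isClosed

lemma ae_mem_linearDensity_one {E : Set ℂ} (hE : IsCompact E) :
    ∀ᵐ z, z ∈ E → z ∈ linearDensity 1 E := by
  rw [ae_complex_iff_ae_ae_im]
  · refine Filter.Eventually.of_forall fun y => ?_
    have hm : MeasurableSet {x : ℝ | (⟨x, y⟩ : ℂ) ∈ E} := by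
      apply IsClosed.measurableSet
      refine hE.isClosed.preimage ?_
      exact continuous_mk_re y
    filter_upwards [ae_exists_near_of_mem hm] with x hx hxE k
    obtain ⟨m, hm⟩ := hx hxE k
    refine ⟨m, fun s hs => ?_⟩
    obtain ⟨s', h1, h2⟩ := hm s hs
    refine ⟨s', h1, ?_⟩
    convert h2 using 1
    apply Complex.ext <;> simp
  · have : {z | z ∈ E → z ∈ linearDensity 1 E} = Eᶜ ∪ linearDensity 1 E := by
      ext z; simp [imp_iff_not_or]
    rw [this]
    exact hE.measurableSet.compl.union (measurableSet_linearDensity 1 hE)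

lemma ae_mem_linearDensity_I {E : Set ℂ} (hE : IsCompact E) :
    ∀ᵐ z, z ∈ E → z ∈ linearDensity Complex.I E := by
  rw [ae_complex_iff_ae_ae_re]
  · refine Filter.Eventually.of_forall fun x => ?_
    have hm : MeasurableSet {y : ℝ | (⟨x, y⟩ : ℂ) ∈ E} := by
      apply IsClosed.measurableSet
      refine hE.isClosed.preimage ?_
      exact continuous_mk_im x
    filter_upwards [ae_exists_near_of_mem hm] with y hy hyE k
    obtain ⟨m, hm⟩ := hy hyE k
    refine ⟨m, fun s hs => ?_⟩
    obtain ⟨s', h1, h2⟩ := hm s hs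
    refine ⟨s', h1, ?_⟩
    convert h2 using 1
    apply Complex.ext <;> simp
  · have : {z | z ∈ E → z ∈ linearDensity Complex.I E} = Eᶜ ∪ linearDensity Complex.I E := by
      ext z; simp [imp_iff_not_or]
    rw [this]
    exact hE.measurableSet.compl.union (measurableSet_linearDensity Complex.I hE)

/-! ### Almost everywhere differentiability of open mappings -/

/-- The maximum principle for `‖f - c‖` on a rectangle, `f` being an open mapping. -/
lemma norm_sub_le_of_rect {f : ℂ → ℂ} {U : Set ℂ} (hf : ContinuousOn f U)
    (hopen : ∀ O ⊆ U, IsOpen O → IsOpen (f '' O)) {x₁ x₂ y₁ y₂ : ℝ}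
    (hx : x₁ ≤ x₂) (hy : y₁ ≤ y₂)
    (hR : Icc x₁ x₂ ×ℂ Icc y₁ y₂ ⊆ U) {c : ℂ} {b : ℝ}
    (hb : ∀ ζ ∈ Icc x₁ x₂ ×ℂ Icc y₁ y₂,
      (ζ.re = x₁ ∨ ζ.re = x₂ ∨ ζ.im = y₁ ∨ ζ.im = y₂) → ‖f ζ - c‖ ≤ b)
    {z : ℂ} (hz : z ∈ Icc x₁ x₂ ×ℂ Icc y₁ y₂) : ‖f z - c‖ ≤ b := by
  have hcpt : IsCompact (Icc x₁ x₂ ×ℂ Icc y₁ y₂) := isCompact_Icc.reProdIm isCompact_Icc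
  obtain ⟨ζ, hζ, hmax⟩ := hcpt.exists_isMaxOn ⟨z, hz⟩
    (((hf.mono hR).sub continuousOn_const).norm : ContinuousOn (fun ζ => ‖f ζ - c‖) _)
  refine (hmax hz).trans ?_
  change ‖f ζ - c‖ ≤ b
  by_cases hbd : ζ.re = x₁ ∨ ζ.re = x₂ ∨ ζ.im = y₁ ∨ ζ.im = y₂
  · exact hb ζ hζ hbd
  · by_cases h0 : ‖f ζ - c‖ = 0
    · rw [h0]
      refine (norm_nonneg _).trans (hb ⟨x₁, y₁⟩ ?_ (Or.inl rfl))
      exact ⟨left_mem_Icc.2 hx, left_mem_Icc.2 hy⟩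
    · exfalso
      push Not at hbd
      have hO : IsOpen (Ioo x₁ x₂ ×ℂ Ioo y₁ y₂) := isOpen_Ioo.reProdIm isOpen_Ioo
      have hOR : Ioo x₁ x₂ ×ℂ Ioo y₁ y₂ ⊆ Icc x₁ x₂ ×ℂ Icc y₁ y₂ :=
        fun w hw => ⟨Ioo_subset_Icc_self hw.1, Ioo_subset_Icc_self hw.2⟩
      have hζO : ζ ∈ Ioo x₁ x₂ ×ℂ Ioo y₁ y₂ :=
        ⟨⟨lt_of_le_of_ne hζ.1.1 (Ne.symm hbd.1), lt_of_le_of_ne hζ.1.2 hbd.2.1⟩,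
          ⟨lt_of_le_of_ne hζ.2.1 (Ne.symm hbd.2.2.1), lt_of_le_of_ne hζ.2.2 hbd.2.2.2⟩⟩
      have hsub : f '' (Ioo x₁ x₂ ×ℂ Ioo y₁ y₂) ⊆ Metric.closedBall c ‖f ζ - c‖ := by
        rintro _ ⟨w, hw, rfl⟩
        rw [Metric.mem_closedBall, dist_eq_norm]
        exact hmax (hOR hw)
      have h1 := interior_mono hsub
      rw [(hopen _ (hOR.trans hR) hO).interior_eq, interior_closedBall _ h0] at h1
      have h2 := h1 ⟨ζ, hζO, rfl⟩
      rw [Metric.mem_ball, dist_eq_norm] at h2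
      exact lt_irrefl _ h2

/-- The points of `U`, at distance at least `2 / (n + 1)` from the complement and of modulus at
most `n`, at which the difference quotients of `f` along the axes with step at most `1 / (n + 1)`
are within `ε` of `p` and of `q`. -/
def quotientSet (f : ℂ → ℂ) (U : Set ℂ) (p q : ℂ) (ε : ℝ) (n : ℕ) : Set ℂ :=
  {z | ‖z‖ ≤ n ∧ (∀ w ∉ U, 2 / ((n : ℝ) + 1) ≤ dist z w) ∧ ∀ t : ℝ, |t| ≤ 1 / ((n : ℝ) + 1) →
    ‖f (z + t) - f z - p * t‖ ≤ ε * |t| ∧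
    ‖f (z + t * Complex.I) - f z - q * t‖ ≤ ε * |t|}

lemma isCompact_quotientSet {f : ℂ → ℂ} {U : Set ℂ} (hf : ContinuousOn f U) (p q : ℂ) (ε : ℝ)
    (n : ℕ) : IsCompact (quotientSet f U p q ε n) := by
  set K : Set ℂ := {z | ‖z‖ ≤ n ∧ ∀ w ∉ U, 2 / ((n : ℝ) + 1) ≤ dist z w} with hK
  have hKc : IsClosed K := by
    have : K = {z | ‖z‖ ≤ n} ∩ ⋂ w : ℂ, ⋂ _ : w ∉ U, {z | 2 / ((n : ℝ) + 1) ≤ dist z w} := by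
      ext z; simp [hK]
    rw [this]
    refine (isClosed_le continuous_norm continuous_const).inter ?_
    exact isClosed_iInter fun w => isClosed_iInter fun _ =>
      isClosed_le continuous_const (continuous_id.dist continuous_const)
  have hn : (0 : ℝ) < (n : ℝ) + 1 := by positivity
  have hKU : ∀ z ∈ K, ∀ v : ℂ, ‖v‖ ≤ 1 / ((n : ℝ) + 1) → z + v ∈ U := by
    intro z hz v hv
    by_contra hcon
    have h1 := hz.2 _ hcon
    rw [dist_eq_norm] at h1
    have h2 : ‖z - (z + v)‖ = ‖v‖ := by rw [← norm_neg]; congr 1; ring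
    have h3 : 1 / ((n : ℝ) + 1) < 2 / ((n : ℝ) + 1) := by gcongr; norm_num
    linarith
  have hclosed : IsClosed (quotientSet f U p q ε n) := by
    have : quotientSet f U p q ε n = K ∩ ⋂ t : ℝ, ⋂ _ : |t| ≤ 1 / ((n : ℝ) + 1),
        ({z ∈ K | ‖f (z + t) - f z - p * t‖ ≤ ε * |t|} ∩
        {z ∈ K | ‖f (z + t * Complex.I) - f z - q * t‖ ≤ ε * |t|}) := by
      ext z
      simp only [quotientSet, hK, mem_ofPred_eq, mem_inter_iff, mem_iInter]
      constructor
      · rintro ⟨a, b, c⟩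
        exact ⟨⟨a, b⟩, fun t ht => ⟨⟨⟨a, b⟩, (c t ht).1⟩, ⟨a, b⟩, (c t ht).2⟩⟩
      · rintro ⟨⟨a, b⟩, c⟩
        exact ⟨a, b, fun t ht => ⟨(c t ht).1.2, (c t ht).2.2⟩⟩
    rw [this]
    have hz0 : MapsTo (fun z : ℂ => z) K U := fun z hz => by
      simpa using hKU z hz 0 (by simp; positivity)
    have hfK : ContinuousOn f K := hf.mono hz0
    refine hKc.inter (isClosed_iInter fun t => isClosed_iInter fun ht => IsClosed.inter ?_ ?_)
    · refine hKc.isClosed_le ?_ continuousOn_const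
      have h1 : ContinuousOn (fun z : ℂ => f (z + t)) K :=
        hf.comp (by fun_prop) fun z hz => hKU z hz _ (by simpa using ht)
      exact ((h1.sub hfK).sub continuousOn_const).norm
    · refine hKc.isClosed_le ?_ continuousOn_const
      have h1 : ContinuousOn (fun z : ℂ => f (z + t * Complex.I)) K :=
        hf.comp (by fun_prop) fun z hz => hKU z hz _ (by simpa using ht)
      exact ((h1.sub hfK).sub continuousOn_const).norm
  refine Metric.isCompact_of_isClosed_isBounded hclosed ?_
  exact (Metric.isBounded_closedBall (x := (0 : ℂ)) (r := n)).subset fun z hz => by simpa using hz.1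

/-- At a point of linear density of `quotientSet` the increments of `f` are, up to a multiple of
`ε`, those of the linear map with partial derivatives `p` and `q`. -/
lemma increment_le_of_linearDensity {f : ℂ → ℂ} {U : Set ℂ} (hf : ContinuousOn f U)
    (hopen : ∀ O ⊆ U, IsOpen O → IsOpen (f '' O)) {p q : ℂ} {ε : ℝ} (hε : 0 < ε) {n : ℕ}
    {z₀ : ℂ} (hz : z₀ ∈ quotientSet f U p q ε n)
    (h1 : z₀ ∈ linearDensity 1 (quotientSet f U p q ε n))
    (hI : z₀ ∈ linearDensity Complex.I (quotientSet f U p q ε n)) :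
    ∀ᶠ h : ℂ in nhds 0, ‖f (z₀ + h) - f z₀ - (p * h.re + q * h.im)‖ ≤ 11 * ε * ‖h‖ := by
  set M := ‖p‖ + ‖q‖ with hM
  have hM0 : 0 ≤ M := by positivity
  obtain ⟨k, hk⟩ := exists_nat_one_div_lt (show (0 : ℝ) < min (1 / 3) (ε / (M + 1)) by positivity)
  set η : ℝ := 1 / ((k : ℝ) + 1) with hη
  have hη0 : 0 < η := by positivity
  have hη3 : η ≤ 1 / 3 := hk.le.trans (min_le_left _ _)
  have hηM : M * η ≤ ε := by
    have h2 : η ≤ ε / (M + 1) := hk.le.trans (min_le_right _ _)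
    rw [le_div_iff₀ (by positivity)] at h2
    nlinarith
  obtain ⟨m₁, hm₁⟩ := h1 k
  obtain ⟨m₂, hm₂⟩ := hI k
  set d : ℝ := 1 / ((n : ℝ) + 1) with hd
  have hd0 : 0 < d := by positivity
  have hδ : (0 : ℝ) < min (d / 8) (min (1 / ((m₁ : ℝ) + 1) / 3) (1 / ((m₂ : ℝ) + 1) / 3)) := by
    positivity
  have hUz : ∀ x y : ℝ, |x| ≤ d / 2 → |y| ≤ d / 2 → z₀ + ⟨x, y⟩ ∈ U := by
    intro x y hx hy
    by_contra hcon
    have h2 := hz.2.1 _ hcon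
    have h3 : dist z₀ (z₀ + ⟨x, y⟩) ≤ |x| + |y| := by
      rw [dist_eq_norm, show z₀ - (z₀ + ⟨x, y⟩) = -(⟨x, y⟩ : ℂ) by ring, norm_neg]
      exact Complex.norm_le_abs_re_add_abs_im _
    have h4 : 2 / ((n : ℝ) + 1) = 2 * d := by rw [hd]; ring
    rw [h4] at h2
    linarith
  -- The estimate on the lines through `E`, which contain the sides of suitable rectangles.
  have hline : ∀ x y : ℝ, |x| ≤ d → |y| ≤ d →
      (z₀ + x ∈ quotientSet f U p q ε n ∨ z₀ + y * Complex.I ∈ quotientSet f U p q ε n) →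
      ‖f (z₀ + ⟨x, y⟩) - f z₀ - (p * x + q * y)‖ ≤ ε * (|x| + |y|) := by
    rintro x y hx hy (hE | hE)
    · have a := (hz.2.2 x hx).1
      have b := (hE.2.2 y hy).2
      have e : (z₀ + ⟨x, y⟩ : ℂ) = z₀ + x + y * Complex.I := by
        rw [Complex.mk_eq_add_mul_I, add_assoc]
      calc ‖f (z₀ + ⟨x, y⟩) - f z₀ - (p * x + q * y)‖
          = ‖(f (z₀ + x) - f z₀ - p * x) +
              (f (z₀ + x + y * Complex.I) - f (z₀ + x) - q * y)‖ := by rw [e]; congr 1; ring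
        _ ≤ _ := (norm_add_le _ _).trans (by linarith)
    · have a := (hz.2.2 y hy).2
      have b := (hE.2.2 x hx).1
      have e : (z₀ + ⟨x, y⟩ : ℂ) = z₀ + y * Complex.I + x := by
        rw [Complex.mk_eq_add_mul_I]; ring
      calc ‖f (z₀ + ⟨x, y⟩) - f z₀ - (p * x + q * y)‖
          = ‖(f (z₀ + y * Complex.I) - f z₀ - q * y) +
              (f (z₀ + y * Complex.I + x) - f (z₀ + y * Complex.I) - p * x)‖ := by
            rw [e]; congr 1; ring
        _ ≤ _ := (norm_add_le _ _).trans (by linarith)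
  filter_upwards [Metric.ball_mem_nhds (0 : ℂ) hδ] with h hh
  rw [Metric.mem_ball, dist_zero_right] at hh
  by_cases hh0 : h = 0
  · simp [hh0]
  set H : ℝ := ‖h‖ with hH
  have hH0 : 0 < H := norm_pos_iff.2 hh0
  have hHd : H < d / 8 := hh.trans_le (min_le_left _ _)
  have hHm₁ : 3 * H < 1 / ((m₁ : ℝ) + 1) := by
    have := hh.trans_le ((min_le_right _ _).trans (min_le_left _ _)); linarith
  have hHm₂ : 3 * H < 1 / ((m₂ : ℝ) + 1) := by
    have := hh.trans_le ((min_le_right _ _).trans (min_le_right _ _)); linarith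
  have hxH : |h.re| ≤ H := Complex.abs_re_le_norm h
  have hyH : |h.im| ≤ H := Complex.abs_im_le_norm h
  have hηH : η * H ≤ H / 3 := by nlinarith
  have hηH0 : 0 < η * H := by positivity
  -- Points of the set on both sides, at distance comparable with `η H`.
  have near : ∀ (e : ℂ) (m : ℕ), 3 * H < 1 / ((m : ℝ) + 1) →
      (∀ s : ℝ, |s| < 1 / ((m : ℝ) + 1) →
        ∃ s' : ℝ, |s' - s| ≤ |s| / (k + 1) ∧ z₀ + s' * e ∈ quotientSet f U p q ε n) →
      ∀ x : ℝ, |x| ≤ H → ∃ x₁ x₂ : ℝ, x - 5 * (η * H) ≤ x₁ ∧ x₁ ≤ x ∧ x ≤ x₂ ∧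
        x₂ ≤ x + 5 * (η * H) ∧ z₀ + x₁ * e ∈ quotientSet f U p q ε n ∧
        z₀ + x₂ * e ∈ quotientSet f U p q ε n := by
    intro e m hm hs x hx
    have aux : ∀ s : ℝ, |s| ≤ 2 * H →
        ∃ s' : ℝ, |s' - s| ≤ 2 * (η * H) ∧ z₀ + s' * e ∈ quotientSet f U p q ε n := by
      intro s hsH
      obtain ⟨s', a, b⟩ := hs s (by linarith)
      refine ⟨s', a.trans ?_, b⟩
      rw [div_eq_mul_one_div, ← hη]
      nlinarith
    rw [abs_le] at hx
    obtain ⟨x₁, a₁, b₁⟩ := aux (x - 3 * (η * H)) (by rw [abs_le]; constructor <;> linarith)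
    obtain ⟨x₂, a₂, b₂⟩ := aux (x + 3 * (η * H)) (by rw [abs_le]; constructor <;> linarith)
    rw [abs_le] at a₁ a₂
    exact ⟨x₁, x₂, by linarith, by linarith, by linarith, by linarith, b₁, b₂⟩
  obtain ⟨x₁, x₂, hx₁, hx₁', hx₂', hx₂, hx₁E, hx₂E⟩ := near 1 m₁ hHm₁ hm₁ h.re hxH
  obtain ⟨y₁, y₂, hy₁, hy₁', hy₂', hy₂, hy₁E, hy₂E⟩ := near Complex.I m₂ hHm₂ hm₂ h.im hyH
  rw [mul_one] at hx₁E hx₂E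
  rw [abs_le] at hxH hyH
  have hbound : ∀ x y : ℝ, x ∈ Icc x₁ x₂ → y ∈ Icc y₁ y₂ →
      |x| ≤ 8 / 3 * H ∧ |y| ≤ 8 / 3 * H ∧ |x - h.re| ≤ 5 * (η * H) ∧ |y - h.im| ≤ 5 * (η * H) := by
    rintro x y ⟨a, b⟩ ⟨c, e⟩
    simp only [abs_le]
    refine ⟨⟨?_, ?_⟩, ⟨?_, ?_⟩, ⟨?_, ?_⟩, ?_, ?_⟩ <;> linarith
  have hgoal := norm_sub_le_of_rect (f := fun z => f (z₀ + z)) (U := {z | z₀ + z ∈ U})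
    (x₁ := x₁) (x₂ := x₂) (y₁ := y₁) (y₂ := y₂) (c := f z₀ + (p * h.re + q * h.im))
    (b := 11 * ε * H) (z := h) ?_ ?_ (by linarith) (by linarith) ?_ ?_
    ⟨⟨hx₁', hx₂'⟩, ⟨hy₁', hy₂'⟩⟩
  · rwa [← sub_sub] at hgoal
  · exact hf.comp (by fun_prop) fun z hz => hz
  · intro O hO hOo
    have : (fun z => f (z₀ + z)) '' O = f '' ((fun z => z₀ + z) '' O) := by rw [image_image]
    rw [this]
    refine hopen _ ?_ ((Homeomorph.addLeft z₀).isOpenMap _ hOo)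
    rintro _ ⟨z, hz, rfl⟩
    exact hO hz
  · intro ζ hζ
    obtain ⟨a, b, -, -⟩ := hbound ζ.re ζ.im hζ.1 hζ.2
    exact hUz ζ.re ζ.im (by linarith) (by linarith)
  · intro ζ hζ hside
    obtain ⟨a, b, c, e⟩ := hbound ζ.re ζ.im hζ.1 hζ.2
    have hE : z₀ + (ζ.re : ℂ) ∈ quotientSet f U p q ε n ∨
        z₀ + (ζ.im : ℂ) * Complex.I ∈ quotientSet f U p q ε n := by
      rcases hside with h | h | h | h <;> rw [h] <;> tauto
    have h2 := hline ζ.re ζ.im (by linarith) (by linarith) hE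
    have h3 : ‖p * ((ζ.re - h.re : ℝ) : ℂ) + q * ((ζ.im - h.im : ℝ) : ℂ)‖ ≤ 5 * ε * H := by
      refine (norm_add_le _ _).trans ?_
      rw [norm_mul, norm_mul, Complex.norm_real, Complex.norm_real, Real.norm_eq_abs,
        Real.norm_eq_abs]
      calc ‖p‖ * |ζ.re - h.re| + ‖q‖ * |ζ.im - h.im|
          ≤ ‖p‖ * (5 * (η * H)) + ‖q‖ * (5 * (η * H)) := by gcongr
        _ = 5 * (M * η) * H := by rw [hM]; ring
        _ ≤ 5 * ε * H := by gcongr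
    calc ‖f (z₀ + ζ) - (f z₀ + (p * h.re + q * h.im))‖
        = ‖(f (z₀ + ζ) - f z₀ - (p * ζ.re + q * ζ.im)) +
            (p * ((ζ.re - h.re : ℝ) : ℂ) + q * ((ζ.im - h.im : ℝ) : ℂ))‖ := by
          congr 1; push_cast; ring
      _ ≤ ε * (|ζ.re| + |ζ.im|) + 5 * ε * H := (norm_add_le _ _).trans (add_le_add h2 h3)
      _ ≤ ε * (8 / 3 * H + 8 / 3 * H) + 5 * ε * H := by gcongr
      _ ≤ 11 * ε * H := by nlinarith [mul_pos hε hH0]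

/-- The real linear map with partial derivatives `a` and `b`. -/
noncomputable def linearOfPartials (a b : ℂ) : ℂ →L[ℝ] ℂ :=
  Complex.reCLM.smulRight a + Complex.imCLM.smulRight b

lemma linearOfPartials_apply (a b h : ℂ) : linearOfPartials a b h = a * h.re + b * h.im := by
  simp [linearOfPartials, mul_comm]

/-- **Gehring–Lehto**: a continuous open mapping whose partial derivatives exist almost everywhere
is differentiable almost everywhere. -/
lemma ae_hasFDerivAt_of_partials {f : ℂ → ℂ} {U : Set ℂ} (hU : IsOpen U) (hf : ContinuousOn f U)
    (hopen : ∀ O ⊆ U, IsOpen O → IsOpen (f '' O))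
    (hx : ∀ᵐ z : ℂ, z ∈ U → DifferentiableAt ℝ (fun t : ℝ => f (z + t)) 0)
    (hy : ∀ᵐ z : ℂ, z ∈ U → DifferentiableAt ℝ (fun t : ℝ => f (z + t * Complex.I)) 0) :
    ∀ᵐ z : ℂ, z ∈ U → HasFDerivAt f (linearOfPartials (partialX f z) (partialY f z)) z := by
  have hdens : ∀ᵐ z : ℂ, ∀ i j m n : ℕ,
      z ∈ quotientSet f U (TopologicalSpace.denseSeq ℂ i) (TopologicalSpace.denseSeq ℂ j)
        (1 / ((m : ℝ) + 1)) n →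
      z ∈ linearDensity 1 (quotientSet f U (TopologicalSpace.denseSeq ℂ i)
        (TopologicalSpace.denseSeq ℂ j) (1 / ((m : ℝ) + 1)) n) ∧
      z ∈ linearDensity Complex.I (quotientSet f U (TopologicalSpace.denseSeq ℂ i)
        (TopologicalSpace.denseSeq ℂ j) (1 / ((m : ℝ) + 1)) n) := by
    simp only [ae_all_iff]
    intro i j m n
    filter_upwards [ae_mem_linearDensity_one (isCompact_quotientSet hf _ _ _ n),
      ae_mem_linearDensity_I (isCompact_quotientSet hf _ _ _ n)] with z h1 h2 hz
    exact ⟨h1 hz, h2 hz⟩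
  filter_upwards [hdens, hx, hy] with z hz hxz hyz hzU
  have hX : HasDerivAt (fun t : ℝ => f (z + t)) (partialX f z) 0 := (hxz hzU).hasDerivAt
  have hY : HasDerivAt (fun t : ℝ => f (z + t * Complex.I)) (partialY f z) 0 :=
    (hyz hzU).hasDerivAt
  set a := partialX f z
  set b := partialY f z
  rw [hasFDerivAt_iff_isLittleO_nhds_zero, Asymptotics.isLittleO_iff]
  intro c hc
  obtain ⟨m, hm⟩ := exists_nat_one_div_lt (show (0 : ℝ) < c / 13 by positivity)
  set ε : ℝ := 1 / ((m : ℝ) + 1) with hε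
  have hε0 : 0 < ε := by positivity
  obtain ⟨i, hi⟩ := (TopologicalSpace.denseRange_denseSeq ℂ).exists_dist_lt a (half_pos hε0)
  obtain ⟨j, hj⟩ := (TopologicalSpace.denseRange_denseSeq ℂ).exists_dist_lt b (half_pos hε0)
  set p := TopologicalSpace.denseSeq ℂ i
  set q := TopologicalSpace.denseSeq ℂ j
  rw [dist_eq_norm] at hi hj
  have quot : ∀ (φ : ℝ → ℂ) (a p : ℂ), HasDerivAt φ a 0 → ‖a - p‖ < ε / 2 →
      ∃ δ > 0, ∀ t : ℝ, |t| < δ → ‖φ t - φ 0 - p * t‖ ≤ ε * |t| := by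
    intro φ a p hφ hap
    rw [hasDerivAt_iff_isLittleO_nhds_zero, Asymptotics.isLittleO_iff] at hφ
    obtain ⟨δ, hδ, h⟩ := Metric.eventually_nhds_iff.1 (hφ (half_pos hε0))
    refine ⟨δ, hδ, fun t ht => ?_⟩
    have h1 := h (y := t) (by simpa [Real.dist_eq] using ht)
    simp only [zero_add, Real.norm_eq_abs, Complex.real_smul] at h1
    calc ‖φ t - φ 0 - p * t‖ = ‖(φ t - φ 0 - t * a) + (a - p) * t‖ := by congr 1; ring
      _ ≤ ε / 2 * |t| + ε / 2 * |t| := by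
        refine (norm_add_le _ _).trans (add_le_add h1 ?_)
        rw [norm_mul, Complex.norm_real, Real.norm_eq_abs]
        gcongr
      _ = ε * |t| := by ring
  obtain ⟨δ₁, hδ₁, h₁⟩ := quot _ a p hX hi
  obtain ⟨δ₂, hδ₂, h₂⟩ := quot _ b q hY hj
  obtain ⟨δ₃, hδ₃, h₃⟩ := Metric.isOpen_iff.1 hU z hzU
  obtain ⟨n₁, hn₁⟩ := exists_nat_one_div_lt (show (0 : ℝ) < min δ₁ (min δ₂ (δ₃ / 2)) by positivity)
  obtain ⟨n₂, hn₂⟩ := exists_nat_ge ‖z‖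
  set n := max n₁ n₂
  have hn : 1 / ((n : ℝ) + 1) < min δ₁ (min δ₂ (δ₃ / 2)) := by
    refine lt_of_le_of_lt ?_ hn₁
    gcongr
    exact le_max_left _ _
  have hzq : z ∈ quotientSet f U p q ε n := by
    refine ⟨hn₂.trans (by exact_mod_cast le_max_right _ _), fun w hw => ?_, fun t ht => ⟨?_, ?_⟩⟩
    · by_contra hlt
      refine hw (h₃ ?_)
      rw [Metric.mem_ball, dist_comm]
      have h4 : 2 / ((n : ℝ) + 1) = 2 * (1 / ((n : ℝ) + 1)) := by ring
      have h5 := hn.trans_le ((min_le_right _ _).trans (min_le_right _ _))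
      linarith
    · simpa using h₁ t (ht.trans_lt (hn.trans_le (min_le_left _ _)))
    · simpa using h₂ t (ht.trans_lt (hn.trans_le ((min_le_right _ _).trans (min_le_left _ _))))
  obtain ⟨hd1, hdI⟩ := hz i j m n hzq
  filter_upwards [increment_le_of_linearDensity hf hopen hε0 hzq hd1 hdI] with h hh
  rw [linearOfPartials_apply]
  have e1 : ‖(p - a) * h.re + (q - b) * h.im‖ ≤ ε * ‖h‖ := by
    refine (norm_add_le _ _).trans ?_
    rw [norm_mul, norm_mul, Complex.norm_real, Complex.norm_real, norm_sub_rev p, norm_sub_rev q]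
    have := Complex.abs_re_le_norm h
    have := Complex.abs_im_le_norm h
    calc ‖a - p‖ * ‖h.re‖ + ‖b - q‖ * ‖h.im‖ ≤ ε / 2 * ‖h‖ + ε / 2 * ‖h‖ := by
          gcongr <;> assumption
      _ = ε * ‖h‖ := by ring
  calc ‖f (z + h) - f z - (a * h.re + b * h.im)‖
      = ‖(f (z + h) - f z - (p * h.re + q * h.im)) + ((p - a) * h.re + (q - b) * h.im)‖ := by
        congr 1; ring
    _ ≤ 11 * ε * ‖h‖ + ε * ‖h‖ := (norm_add_le _ _).trans (add_le_add hh e1)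
    _ ≤ c * ‖h‖ := by nlinarith [norm_nonneg h]

/-! ### Derivatives of quasiconformal mappings: integration along lines and area -/

lemma _root_.AbsolutelyContinuousOnInterval.lipschitz_comp {X Y : Type*} [PseudoMetricSpace X]
    [PseudoMetricSpace Y] {f : ℝ → X} {a b : ℝ} (hf : AbsolutelyContinuousOnInterval f a b)
    {φ : X → Y} (hφ : LipschitzWith 1 φ) :
    AbsolutelyContinuousOnInterval (fun t => φ (f t)) a b := by
  unfold AbsolutelyContinuousOnInterval at hf ⊢
  refine squeeze_zero (fun _ => Finset.sum_nonneg fun _ _ => dist_nonneg)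
    (fun E => Finset.sum_le_sum fun i _ => ?_) hf
  simpa using hφ.dist_le_mul (f (E.2 i).1) (f (E.2 i).2)

lemma lipschitzWith_re : LipschitzWith 1 Complex.re :=
  LipschitzWith.of_dist_le_mul fun x y => by
    simpa [Real.dist_eq, dist_eq_norm] using Complex.abs_re_le_norm (x - y)

lemma lipschitzWith_im : LipschitzWith 1 Complex.im :=
  LipschitzWith.of_dist_le_mul fun x y => by
    simpa [Real.dist_eq, dist_eq_norm] using Complex.abs_im_le_norm (x - y)

lemma ae_differentiableAt_of_absolutelyContinuous {F : ℝ → ℂ} {a b : ℝ}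
    (hF : AbsolutelyContinuousOnInterval F a b) :
    ∀ᵐ t : ℝ, t ∈ uIcc a b → DifferentiableAt ℝ F t := by
  filter_upwards [(hF.lipschitz_comp lipschitzWith_re).ae_differentiableAt,
    (hF.lipschitz_comp lipschitzWith_im).ae_differentiableAt] with t h1 h2 ht
  have h3 := ((h1 ht).hasDerivAt.ofReal_comp).add
    (((h2 ht).hasDerivAt.ofReal_comp).mul_const Complex.I)
  convert! h3.differentiableAt using 1
  funext s
  simp [Complex.re_add_im]

lemma integral_eq_sub_of_absolutelyContinuous {F D : ℝ → ℂ} {a b : ℝ}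
    (hF : AbsolutelyContinuousOnInterval F a b)
    (hD : ∀ᵐ t : ℝ, t ∈ uIcc a b → HasDerivAt F (D t) t) :
    IntervalIntegrable D volume a b ∧ ∫ t in a..b, D t = F b - F a := by
  have hre := hF.lipschitz_comp lipschitzWith_re
  have him := hF.lipschitz_comp lipschitzWith_im
  have er : ∀ᵐ t : ℝ, t ∈ uIoc a b → deriv (fun t => (F t).re) t = (D t).re := by
    filter_upwards [hD] with t ht hm
    exact (Complex.reCLM.hasFDerivAt.comp_hasDerivAt t (ht (uIoc_subset_uIcc hm))).deriv
  have ei : ∀ᵐ t : ℝ, t ∈ uIoc a b → deriv (fun t => (F t).im) t = (D t).im := by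
    filter_upwards [hD] with t ht hm
    exact (Complex.imCLM.hasFDerivAt.comp_hasDerivAt t (ht (uIoc_subset_uIcc hm))).deriv
  have ir : IntervalIntegrable (fun t => (D t).re) volume a b :=
    hre.intervalIntegrable_deriv.congr_ae ((ae_restrict_iff' measurableSet_uIoc).2 er)
  have ii : IntervalIntegrable (fun t => (D t).im) volume a b :=
    him.intervalIntegrable_deriv.congr_ae ((ae_restrict_iff' measurableSet_uIoc).2 ei)
  have eD : D = fun t => ((D t).re : ℂ) + ((D t).im : ℂ) * Complex.I := by
    funext t; simp [Complex.re_add_im]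
  have ir' : IntervalIntegrable (fun t => ((D t).re : ℂ)) volume a b :=
    ⟨ir.1.ofReal, ir.2.ofReal⟩
  have ii' : IntervalIntegrable (fun t => ((D t).im : ℂ) * Complex.I) volume a b :=
    IntervalIntegrable.mul_const ⟨ii.1.ofReal, ii.2.ofReal⟩ _
  constructor
  · rw [eD]; exact ir'.add ii'
  · rw [eD, intervalIntegral.integral_add ir' ii', intervalIntegral.integral_mul_const,
      intervalIntegral.integral_ofReal, intervalIntegral.integral_ofReal,
      ← intervalIntegral.integral_congr_ae er, ← intervalIntegral.integral_congr_ae ei,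
      hre.integral_deriv_eq_sub, him.integral_deriv_eq_sub]
    apply Complex.ext <;> simp

/-- A foliation of the plane by the parallel lines `t ↦ ι s t` of direction `e`, for which Fubini's
theorem holds. It serves to treat the horizontal and the vertical lines together. -/
structure IsLineFamily (ι : ℝ → ℝ → ℂ) (e : ℂ) : Prop where
  add : ∀ s t u, ι s (t + u) = ι s t + u * e
  cont : ∀ s, Continuous (ι s)
  ae_iff : ∀ {P : ℂ → Prop}, MeasurableSet {z | P z} →
    ((∀ᵐ z, P z) ↔ ∀ᵐ s : ℝ, ∀ᵐ t : ℝ, P (ι s t))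
  ae_ae : ∀ {P : ℂ → Prop}, (∀ᵐ z, P z) → ∀ᵐ s : ℝ, ∀ᵐ t : ℝ, P (ι s t)

lemma isLineFamily_horizontal : IsLineFamily (fun y x => ⟨x, y⟩) 1 where
  add s t u := by apply Complex.ext <;> simp
  cont := continuous_mk_re
  ae_iff := ae_complex_iff_ae_ae_im
  ae_ae := ae_ae_im_of_ae_complex

lemma isLineFamily_vertical : IsLineFamily (fun x y => ⟨x, y⟩) Complex.I where
  add s t u := by apply Complex.ext <;> simp
  cont := continuous_mk_im
  ae_iff := ae_complex_iff_ae_ae_re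
  ae_ae := ae_ae_re_of_ae_complex

/-- Absolute continuity of `f` on all segments in `U` of almost every line of a family. -/
def ACOnLines (f : ℂ → ℂ) (U : Set ℂ) (ι : ℝ → ℝ → ℂ) : Prop :=
  ∀ᵐ s : ℝ, ∀ a b : ℝ, a ≤ b → (∀ t ∈ Icc a b, ι s t ∈ U) →
    AbsolutelyContinuousOnInterval (fun t => f (ι s t)) a b

/-- A compact axis-parallel segment in an open set has a neighbourhood rectangle with rational
corners in the set. -/
lemma exists_rat_rect {V : Set (ℝ × ℝ)} (hV : IsOpen V) {a b s : ℝ} (hab : a ≤ b)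
    (h : ∀ t ∈ Icc a b, (t, s) ∈ V) :
    ∃ a' b' c d : ℚ, (a' : ℝ) < b' ∧ (c : ℝ) < d ∧ Icc a b ⊆ Icc (a' : ℝ) b' ∧
      s ∈ Icc (c : ℝ) d ∧ Icc (a' : ℝ) b' ×ˢ Icc (c : ℝ) d ⊆ V := by
  obtain ⟨u, v, hu, hv, hau, hsv, huv⟩ := generalized_tube_lemma (isCompact_Icc (a := a) (b := b))
    (isCompact_singleton (x := s)) hV (by rintro ⟨t, s'⟩ ⟨ht, rfl⟩; exact h t ht)
  obtain ⟨δ, hδ, hδu⟩ := (isCompact_Icc (a := a) (b := b)).exists_cthickening_subset_open hu hau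
  obtain ⟨ε, hε, hεv⟩ := Metric.isOpen_iff.1 hv s (hsv rfl)
  obtain ⟨a', ha1, ha2⟩ := exists_rat_btwn (show a - δ < a by linarith)
  obtain ⟨b', hb1, hb2⟩ := exists_rat_btwn (show b < b + δ by linarith)
  obtain ⟨c, hc1, hc2⟩ := exists_rat_btwn (show s - ε < s by linarith)
  obtain ⟨d, hd1, hd2⟩ := exists_rat_btwn (show s < s + ε by linarith)
  refine ⟨a', b', c, d, by linarith, by linarith, Icc_subset_Icc ha2.le hb1.le,
    ⟨hc2.le, hd1.le⟩, ?_⟩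
  rintro ⟨t, r⟩ ⟨ht, hr⟩
  refine huv ⟨hδu ?_, hεv ?_⟩
  · by_cases h1 : t < a
    · refine Metric.mem_cthickening_of_dist_le t a δ _ (left_mem_Icc.2 hab) ?_
      rw [Real.dist_eq, abs_le]; constructor <;> linarith [ht.1]
    · by_cases h2 : b < t
      · refine Metric.mem_cthickening_of_dist_le t b δ _ (right_mem_Icc.2 hab) ?_
        rw [Real.dist_eq, abs_le]; constructor <;> linarith [ht.2]
      · exact Metric.self_subset_cthickening _ ⟨not_lt.1 h1, not_lt.1 h2⟩
  · rw [Metric.mem_ball, Real.dist_eq, abs_lt]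
    constructor <;> linarith [hr.1, hr.2]

lemma ACLOn.horizontal {f : ℂ → ℂ} {U : Set ℂ} (hU : IsOpen U) (h : ACLOn f U) :
    ACOnLines f U (fun y x => ⟨x, y⟩) := by
  have h1 : ∀ᵐ y : ℝ, ∀ a b c d : ℚ, (a : ℝ) < b → (c : ℝ) < d →
      (Icc (a : ℝ) b ×ℂ Icc (c : ℝ) d) ⊆ U → y ∈ Icc (c : ℝ) d →
      AbsolutelyContinuousOnInterval (fun x : ℝ => f ⟨x, y⟩) a b := by
    simp only [ae_all_iff]
    intro a b c d hab hcd hsub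
    exact (h.2 a b c d hab hcd hsub).1
  filter_upwards [h1] with y hy a b hab hseg
  have hV : IsOpen {w : ℝ × ℝ | (⟨w.1, w.2⟩ : ℂ) ∈ U} :=
    hU.preimage Complex.equivRealProdCLM.symm.continuous
  obtain ⟨a', b', c, d, h1, h2, h3, h4, h5⟩ := exists_rat_rect hV hab hseg
  refine (hy a' b' c d h1 h2 (fun z hz => ?_) h4).mono ?_
  · have := h5 (a := (z.re, z.im)) ⟨hz.1, hz.2⟩
    simpa using this
  · rwa [uIcc_of_le hab, uIcc_of_le h1.le]

lemma ACLOn.vertical {f : ℂ → ℂ} {U : Set ℂ} (hU : IsOpen U) (h : ACLOn f U) :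
    ACOnLines f U (fun x y => ⟨x, y⟩) := by
  have h1 : ∀ᵐ x : ℝ, ∀ a b c d : ℚ, (a : ℝ) < b → (c : ℝ) < d →
      (Icc (a : ℝ) b ×ℂ Icc (c : ℝ) d) ⊆ U → x ∈ Icc (a : ℝ) b →
      AbsolutelyContinuousOnInterval (fun y : ℝ => f ⟨x, y⟩) c d := by
    simp only [ae_all_iff]
    intro a b c d hab hcd hsub
    exact (h.2 a b c d hab hcd hsub).2
  filter_upwards [h1] with x hx a b hab hseg
  have hV : IsOpen {w : ℝ × ℝ | (⟨w.2, w.1⟩ : ℂ) ∈ U} :=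
    hU.preimage (Complex.equivRealProdCLM.symm.continuous.comp continuous_swap)
  obtain ⟨a', b', c, d, h1, h2, h3, h4, h5⟩ := exists_rat_rect hV hab hseg
  refine (hx c d a' b' h2 h1 (fun z hz => ?_) h4).mono ?_
  · have := h5 (a := (z.im, z.re)) ⟨hz.2, hz.1⟩
    simpa using this
  · rwa [uIcc_of_le hab, uIcc_of_le h1.le]

lemma ACOnLines.ae_differentiableAt {f : ℂ → ℂ} {U : Set ℂ} (hU : IsOpen U)
    (hf : ContinuousOn f U) {ι : ℝ → ℝ → ℂ} {e : ℂ} (hι : IsLineFamily ι e)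
    (h : ACOnLines f U ι) :
    ∀ᵐ z : ℂ, z ∈ U → DifferentiableAt ℝ (fun t : ℝ => f (z + t * e)) 0 := by
  -- Locally `f` has a continuous extension to the plane; this gives measurability.
  have hloc : ∀ (c : ℂ) (r : ℝ), Metric.closedBall c r ⊆ U →
      ∀ᵐ z : ℂ, z ∈ Metric.ball c r → DifferentiableAt ℝ (fun t : ℝ => f (z + t * e)) 0 := by
    intro c r hcr
    obtain ⟨g, hg⟩ := ContinuousMap.exists_restrict_eq Metric.isClosed_closedBall
      (⟨(Metric.closedBall c r).domRestrict f,
        continuousOn_iff_continuous_domRestrict.mp (hf.mono hcr)⟩ : C(Metric.closedBall c r, ℂ))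
    have hg' : ∀ z ∈ Metric.closedBall c r, g z = f z := fun z hz => by
      simpa using congr($hg ⟨z, hz⟩)
    have hgf : ∀ z ∈ Metric.ball c r,
        (fun t : ℝ => g (z + t * e)) =ᶠ[nhds 0] (fun t : ℝ => f (z + t * e)) := by
      intro z hz
      have hc : Continuous fun t : ℝ => z + t * e := by fun_prop
      have : ∀ᶠ t : ℝ in nhds 0, z + t * e ∈ Metric.ball c r :=
        hc.continuousAt.eventually (Metric.isOpen_ball.mem_nhds (by simpa using hz))
      filter_upwards [this] with t ht
      exact hg' _ (Metric.ball_subset_closedBall ht)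
    have hmeas : MeasurableSet {z : ℂ | z ∈ Metric.ball c r →
        DifferentiableAt ℝ (fun t : ℝ => g (z + t * e)) 0} := by
      have h1 : MeasurableSet {p : ℂ × ℝ |
          DifferentiableAt ℝ ((fun (z : ℂ) (t : ℝ) => g (z + t * e)) p.1) p.2} :=
        measurableSet_of_differentiableAt_with_param ℝ
          (f := fun (z : ℂ) (t : ℝ) => g (z + t * e))
          (g.continuous.comp (by fun_prop : Continuous fun p : ℂ × ℝ => p.1 + p.2 * e))
      have h2 : MeasurableSet {z : ℂ | DifferentiableAt ℝ (fun t : ℝ => g (z + t * e)) 0} :=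
        (measurable_id.prodMk measurable_const : Measurable fun z : ℂ => (z, (0 : ℝ))) h1
      have h3 : {z : ℂ | z ∈ Metric.ball c r →
          DifferentiableAt ℝ (fun t : ℝ => g (z + t * e)) 0} = (Metric.ball c r)ᶜ ∪
          {z : ℂ | DifferentiableAt ℝ (fun t : ℝ => g (z + t * e)) 0} := by
        ext z; simp only [mem_ofPred_eq, mem_union, mem_compl_iff, imp_iff_not_or]
      rw [h3]
      exact measurableSet_ball.compl.union h2
    have key : ∀ᵐ z : ℂ, z ∈ Metric.ball c r →
        DifferentiableAt ℝ (fun t : ℝ => g (z + t * e)) 0 := by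
      rw [hι.ae_iff hmeas]
      filter_upwards [h] with s hs
      have h4 : ∀ᵐ t : ℝ, ∀ a b : ℚ, (a : ℝ) ≤ b → (∀ t ∈ Icc (a : ℝ) b, ι s t ∈ U) →
          t ∈ uIcc (a : ℝ) b → DifferentiableAt ℝ (fun t => f (ι s t)) t := by
        simp only [ae_all_iff]
        intro a b hab hseg
        exact ae_differentiableAt_of_absolutelyContinuous (hs a b hab hseg)
      filter_upwards [h4] with t ht htb
      refine DifferentiableAt.congr_of_eventuallyEq ?_ (hgf _ htb)
      have hO : IsOpen (ι s ⁻¹' U) := hU.preimage (hι.cont s)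
      obtain ⟨δ, hδ, hsub⟩ := Metric.isOpen_iff.1 hO t (hcr (Metric.ball_subset_closedBall htb))
      obtain ⟨a, ha1, ha2⟩ := exists_rat_btwn (show t - δ < t by linarith)
      obtain ⟨b, hb1, hb2⟩ := exists_rat_btwn (show t < t + δ by linarith)
      have h5 := ht a b (by linarith) (fun u hu => hsub (by
        rw [Metric.mem_ball, Real.dist_eq, abs_lt]
        constructor <;> linarith [hu.1, hu.2])) (by
        rw [uIcc_of_le (by linarith)]; exact ⟨ha2.le, hb1.le⟩)
      have h6 : (fun u : ℝ => f (ι s t + u * e)) = fun u : ℝ => (fun t => f (ι s t)) (t + u) := by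
        funext u; simp only [hι.add]
      rw [h6]
      refine (HasDerivAt.comp_const_add (f := fun t => f (ι s t)) t 0
        (f' := deriv (fun t => f (ι s t)) t) ?_).differentiableAt
      simpa using h5.hasDerivAt
    filter_upwards [key] with z hz hzb
    exact (hz hzb).congr_of_eventuallyEq (hgf z hzb).symm
  obtain ⟨T, hTc, hTU⟩ := TopologicalSpace.isOpen_iUnion_countable
    (fun p : {p : ℂ × ℝ // Metric.closedBall p.1 p.2 ⊆ U} => Metric.ball p.1.1 p.1.2)
    (fun _ => Metric.isOpen_ball)
  have hall : ∀ᵐ z : ℂ, ∀ p ∈ T, z ∈ Metric.ball p.1.1 p.1.2 →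
      DifferentiableAt ℝ (fun t : ℝ => f (z + t * e)) 0 :=
    (ae_ball_iff hTc).2 fun p _ => hloc p.1.1 p.1.2 p.2
  filter_upwards [hall] with z hz hzU
  obtain ⟨r, hr, hrU⟩ := Metric.nhds_basis_closedBall.mem_iff.1 (hU.mem_nhds hzU)
  have h7 : z ∈ ⋃ p : {p : ℂ × ℝ // Metric.closedBall p.1 p.2 ⊆ U}, Metric.ball p.1.1 p.1.2 :=
    mem_iUnion.2 ⟨⟨(z, r), hrU⟩, Metric.mem_ball_self hr⟩
  rw [← hTU] at h7
  simp only [mem_iUnion] at h7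
  obtain ⟨p, hp, hzp⟩ := h7
  exact hz p hp hzp

/-- The fundamental theorem of calculus along almost all lines of a family. -/
lemma ACOnLines.ae_integral_eq_sub {f D : ℂ → ℂ} {U : Set ℂ} {ι : ℝ → ℝ → ℂ} {e : ℂ}
    (hι : IsLineFamily ι e) (h : ACOnLines f U ι)
    (hD : ∀ᵐ z : ℂ, z ∈ U → HasDerivAt (fun t : ℝ => f (z + t * e)) (D z) 0) :
    ∀ᵐ s : ℝ, ∀ a b : ℝ, a ≤ b → (∀ t ∈ Icc a b, ι s t ∈ U) →
      IntervalIntegrable (fun t => D (ι s t)) volume a b ∧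
        ∫ t in a..b, D (ι s t) = f (ι s b) - f (ι s a) := by
  filter_upwards [h, hι.ae_ae hD] with s hs hDs a b hab hseg
  refine integral_eq_sub_of_absolutelyContinuous (hs a b hab hseg) ?_
  filter_upwards [hDs] with t ht htab
  rw [uIcc_of_le hab] at htab
  have h1 := ht (hseg t htab)
  have h6 : (fun u : ℝ => f (ι s t + u * e)) = fun u : ℝ => (fun t => f (ι s t)) (t + u) := by
    funext u; simp only [hι.add]
  rw [h6] at h1
  have h2 := HasDerivAt.comp_sub_const (f' := D (ι s t)) t t (by rwa [sub_self])
  simpa using h2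

/-- What the length–area method needs to know about a mapping `f` of `U`: its partial derivatives
`D₁` and `D₂` can be integrated along almost all horizontal and vertical segments, and their
squares are controlled by the area of the image. -/
structure GradData (f D₁ D₂ : ℂ → ℂ) (U : Set ℂ) (K K' : ℝ) : Prop where
  measurable₁ : Measurable D₁
  measurable₂ : Measurable D₂
  area : ∀ E ⊆ U, MeasurableSet E → ∫⁻ z in E, (‖D₁ z‖ₑ ^ 2 + ‖D₂ z‖ₑ ^ 2) ≤
    ENNReal.ofReal (2 * K) * volume (f '' E) + ENNReal.ofReal K' * volume E
  horizontal : ∀ᵐ y : ℝ, ∀ a b : ℝ, a ≤ b → (∀ x ∈ Icc a b, (⟨x, y⟩ : ℂ) ∈ U) →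
    IntervalIntegrable (fun x => D₁ ⟨x, y⟩) volume a b ∧
      ∫ x in a..b, D₁ ⟨x, y⟩ = f ⟨b, y⟩ - f ⟨a, y⟩
  vertical : ∀ᵐ x : ℝ, ∀ a b : ℝ, a ≤ b → (∀ y ∈ Icc a b, (⟨x, y⟩ : ℂ) ∈ U) →
    IntervalIntegrable (fun y => D₂ ⟨x, y⟩) volume a b ∧
      ∫ y in a..b, D₂ ⟨x, y⟩ = f ⟨x, b⟩ - f ⟨x, a⟩

lemma det_linearOfPartials (a b : ℂ) :
    (linearOfPartials a b).det = a.re * b.im - a.im * b.re := by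
  rw [ContinuousLinearMap.det, ← LinearMap.det_toMatrix Complex.basisOneI, Matrix.det_fin_two]
  simp [LinearMap.toMatrix_apply, linearOfPartials_apply, Complex.coe_basisOneI,
    Complex.coe_basisOneI_repr]
  ring

lemma hasDerivAt_partial {f : ℂ → ℂ} {z a b : ℂ} (h : HasFDerivAt f (linearOfPartials a b) z)
    (e : ℂ) : HasDerivAt (fun t : ℝ => f (z + t * e)) (linearOfPartials a b e) 0 := by
  have h1 : HasDerivAt (fun t : ℝ => z + (t : ℂ) * e) e 0 := by
    simpa using ((Complex.ofRealCLM.hasDerivAt (x := (0 : ℝ))).mul_const e).const_add z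
  exact HasFDerivAt.comp_hasDerivAt (0 : ℝ) (by simpa using h) h1

lemma IsHomeoOnto.isOpen_image {f : ℂ → ℂ} {U V : Set ℂ} (h : IsHomeoOnto f U V) (hV : IsOpen V)
    {O : Set ℂ} (hO : O ⊆ U) (hOo : IsOpen O) : IsOpen (f '' O) := by
  obtain ⟨hfc, v, hv, hmf, hmv, hinv⟩ := h
  have : f '' O = V ∩ v ⁻¹' O := by
    ext w
    constructor
    · rintro ⟨z, hz, rfl⟩
      exact ⟨hmf (hO hz), by simpa [hinv.1 (hO hz)] using hz⟩
    · rintro ⟨hw, hwO⟩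
      exact ⟨v w, hwO, hinv.2 hw⟩
  rw [this]
  exact hv.isOpen_inter_preimage hV hOo

lemma IsHomeoOnto.injOn {f : ℂ → ℂ} {U V : Set ℂ} (h : IsHomeoOnto f U V) : InjOn f U := by
  obtain ⟨-, v, -, -, -, hinv⟩ := h
  exact hinv.1.injOn

lemma IsHomeoOnto.image_eq {f : ℂ → ℂ} {U V : Set ℂ} (h : IsHomeoOnto f U V) : f '' U = V := by
  obtain ⟨-, v, -, hmf, hmv, hinv⟩ := h
  exact Subset.antisymm hmf.image_subset fun w hw => ⟨v w, hmv hw, hinv.2 hw⟩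

lemma IsQC.gradData {K K' : ℝ} (hK : 1 ≤ K) (hK' : 0 ≤ K') {f : ℂ → ℂ} {U V : Set ℂ}
    (hU : IsOpen U) (hV : IsOpen V) (hf : IsQC K K' f U V) :
    GradData f (fun z => fderiv ℝ f z 1) (fun z => fderiv ℝ f z Complex.I) U K K' := by
  have hfc := hf.homeo.1
  have hinj := hf.homeo.injOn
  have hopen : ∀ O ⊆ U, IsOpen O → IsOpen (f '' O) := fun O => hf.homeo.isOpen_image hV
  have hH := ACLOn.horizontal hU hf.acl
  have hVl := ACLOn.vertical hU hf.acl
  have hdiff : ∀ᵐ z : ℂ, z ∈ U →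
      HasFDerivAt f (linearOfPartials (partialX f z) (partialY f z)) z := by
    refine ae_hasFDerivAt_of_partials hU hfc hopen ?_ ?_
    · simpa using hH.ae_differentiableAt hU hfc isLineFamily_horizontal
    · exact hVl.ae_differentiableAt hU hfc isLineFamily_vertical
  have hval : ∀ᵐ z : ℂ, z ∈ U → DifferentiableAt ℝ f z ∧ fderiv ℝ f z 1 = partialX f z ∧
      fderiv ℝ f z Complex.I = partialY f z ∧ (fderiv ℝ f z).det = jacobian f z := by
    filter_upwards [hdiff] with z hz hzU
    refine ⟨(hz hzU).differentiableAt, ?_, ?_, ?_⟩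
    · rw [(hz hzU).fderiv]; simp [linearOfPartials_apply]
    · rw [(hz hzU).fderiv]; simp [linearOfPartials_apply]
    · rw [(hz hzU).fderiv, det_linearOfPartials]; rfl
  refine ⟨measurable_fderiv_apply_const ℝ f 1, measurable_fderiv_apply_const ℝ f Complex.I,
    ?_, ?_, ?_⟩
  · intro E hE hEm
    set G : Set ℂ := {z | DifferentiableAt ℝ f z} with hG
    have hGm : MeasurableSet G := measurableSet_of_differentiableAt ℝ f
    have hEG : (E ∩ G : Set ℂ) =ᵐ[volume] E := by
      filter_upwards [hval] with z hz
      refine propext ⟨fun h => h.1, fun h => ⟨h, (hz (hE h)).1⟩⟩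
    rw [← setLIntegral_congr hEG]
    calc ∫⁻ z in E ∩ G, (‖fderiv ℝ f z 1‖ₑ ^ 2 + ‖fderiv ℝ f z Complex.I‖ₑ ^ 2)
        ≤ ∫⁻ z in E ∩ G, (ENNReal.ofReal (2 * K) * ENNReal.ofReal |(fderiv ℝ f z).det| +
            ENNReal.ofReal K') := by
          refine setLIntegral_mono_ae' (hEm.inter hGm) ?_
          filter_upwards [hval, hf.distortion] with z hz hd hzE
          obtain ⟨-, h1, h2, h3⟩ := hz (hE hzE.1)
          rw [h1, h2, h3]
          have h4 : ‖partialX f z‖ₑ ^ 2 + ‖partialY f z‖ₑ ^ 2 = ENNReal.ofReal (normSqD f z) := by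
            rw [normSqD, ENNReal.ofReal_add (by positivity) (by positivity),
              ENNReal.ofReal_pow (norm_nonneg _), ENNReal.ofReal_pow (norm_nonneg _),
              ofReal_norm, ofReal_norm]
          rw [h4, ← ENNReal.ofReal_mul (by positivity), ← ENNReal.ofReal_add (by positivity) hK']
          refine ENNReal.ofReal_le_ofReal ((hd (hE hzE.1)).trans ?_)
          gcongr
          exact le_abs_self _
      _ = ENNReal.ofReal (2 * K) * volume (f '' (E ∩ G)) +
            ENNReal.ofReal K' * volume (E ∩ G) := by
          rw [lintegral_add_right _ measurable_const,
            lintegral_const_mul' _ _ ENNReal.ofReal_ne_top,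
            lintegral_abs_det_fderiv_eq_addHaar_image volume (hEm.inter hGm)
              (fun z hz => hz.2.hasFDerivAt.hasFDerivWithinAt)
              (hinj.mono (inter_subset_left.trans hE))]
          simp
      _ ≤ _ := by
          gcongr <;> exact inter_subset_left
  · refine hH.ae_integral_eq_sub (D := fun z => fderiv ℝ f z 1) isLineFamily_horizontal ?_
    filter_upwards [hdiff] with z hz hzU
    rw [(hz hzU).fderiv]
    exact hasDerivAt_partial (hz hzU) 1
  · refine hVl.ae_integral_eq_sub (D := fun z => fderiv ℝ f z Complex.I) isLineFamily_vertical ?_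
    filter_upwards [hdiff] with z hz hzU
    rw [(hz hzU).fderiv]
    exact hasDerivAt_partial (hz hzU) Complex.I

/-! ### Arcs and bounding boxes -/

/-- The real set `S` is traversed by a motion from `p` to `q` of total variation at most `X`: any
two of its points are visited in one of the two orders. -/
def Chain (S : Set ℝ) (p q X : ℝ) : Prop :=
  |p - q| ≤ X ∧ ∀ u ∈ S, ∀ v ∈ S, |p - u| + |u - v| + |v - q| ≤ X ∨ |p - v| + |v - u| + |u - q| ≤ X

lemma Chain.symm {S : Set ℝ} {p q X : ℝ} (h : Chain S p q X) : Chain S q p X := by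
  refine ⟨by rw [abs_sub_comm]; exact h.1, fun u hu v hv => ?_⟩
  simp only [abs_sub_comm q, abs_sub_comm _ p]
  rw [abs_sub_comm v u]
  have := h.2 u hu v hv
  rw [abs_sub_comm v u] at this
  rcases this with h | h
  · right; linarith
  · left; linarith

lemma Chain.append {S T : Set ℝ} {p q r X Y : ℝ} (h : Chain S p q X) (h' : Chain T q r Y) :
    Chain (S ∪ T) p r (X + Y) := by
  have hmid : ∀ u ∈ S, ∀ v ∈ T, |p - u| + |u - v| + |v - r| ≤ X + Y := by
    intro u hu v hv
    have a := h.2 u hu u hu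
    have b := h'.2 v hv v hv
    simp only [sub_self, abs_zero, add_zero, or_self] at a b
    have := abs_sub_le u q v
    linarith
  refine ⟨(abs_sub_le p q r).trans (add_le_add h.1 h'.1), ?_⟩
  rintro u (hu | hu) v (hv | hv)
  · refine (h.2 u hu v hv).imp (fun H => ?_) (fun H => ?_)
    · linarith [abs_sub_le v q r, h'.1]
    · linarith [abs_sub_le u q r, h'.1]
  · exact Or.inl (hmid u hu v hv)
  · exact Or.inr (hmid v hv u hu)
  · refine (h'.2 u hu v hv).imp (fun H => ?_) (fun H => ?_)
    · linarith [abs_sub_le p q u, h.1]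
    · linarith [abs_sub_le p q v, h.1]

/-- Two points on a closed motion are at distance at most half its total variation. -/
lemma Chain.two_mul_abs_sub_le {S T : Set ℝ} {p q X Y : ℝ} (h : Chain S p q X)
    (h' : Chain T p q Y) {u v : ℝ} (hu : u ∈ S ∪ T) (hv : v ∈ S ∪ T) : 2 * |u - v| ≤ X + Y := by
  have same : ∀ {S T : Set ℝ} {X Y : ℝ}, Chain S p q X → Chain T p q Y → ∀ u ∈ S, ∀ v ∈ S,
      2 * |u - v| ≤ X + Y := by
    intro S T X Y h h' u hu v hv
    have a := abs_sub_le u p v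
    have b := abs_sub_le p q v
    have c := abs_sub_le u q v
    have d := abs_sub_le p q u
    have e := abs_sub_comm u p
    have f := abs_sub_comm u q
    have g := abs_sub_comm v q
    have i := abs_sub_comm v u
    have j := h'.1
    have k := abs_sub_comm p q
    have l := abs_sub_le q p v
    rcases h.2 u hu v hv with H | H <;> linarith
  have mixed : ∀ u ∈ S, ∀ v ∈ T, 2 * |u - v| ≤ X + Y := by
    intro u hu v hv
    have a := h.2 u hu u hu
    have b := h'.2 v hv v hv
    simp only [sub_self, abs_zero, add_zero, or_self] at a b
    have c := abs_sub_le u p v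
    have d := abs_sub_le u q v
    rw [abs_sub_comm u p] at c
    rw [abs_sub_comm q v] at d
    linarith
  rcases hu with hu | hu <;> rcases hv with hv | hv
  · exact same h h' u hu v hv
  · exact mixed u hu v hv
  · rw [abs_sub_comm]; exact mixed v hv u hu
  · rw [add_comm]; exact same h' h u hu v hv

lemma chain_of_abs_sub_le_integral {F w : ℝ → ℝ} {a b : ℝ} (hab : a ≤ b)
    (hw : IntervalIntegrable w volume a b)
    (hF : ∀ s t, a ≤ s → s ≤ t → t ≤ b → |F t - F s| ≤ ∫ x in s..t, w x) :
    Chain (F '' Icc a b) (F a) (F b) (∫ x in a..b, w x) := by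
  have hsub : ∀ s t, a ≤ s → s ≤ t → t ≤ b → IntervalIntegrable w volume s t := by
    intro s t h1 h2 h3
    refine hw.mono_set ?_
    rw [uIcc_of_le hab, uIcc_of_le h2]
    exact Icc_subset_Icc h1 h3
  have key : ∀ s t, a ≤ s → s ≤ t → t ≤ b →
      |F a - F s| + |F s - F t| + |F t - F b| ≤ ∫ x in a..b, w x := by
    intro s t h1 h2 h3
    have e1 := intervalIntegral.integral_add_adjacent_intervals (hsub a s le_rfl h1 (h2.trans h3))
      (hsub s t h1 h2 h3)
    have e2 := intervalIntegral.integral_add_adjacent_intervals (hsub a t le_rfl (h1.trans h2) h3)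
      (hsub t b (h1.trans h2) h3 le_rfl)
    have i1 := hF a s le_rfl h1 (h2.trans h3)
    have i2 := hF s t h1 h2 h3
    have i3 := hF t b (h1.trans h2) h3 le_rfl
    rw [abs_sub_comm] at i1 i2 i3
    linarith
  constructor
  · have := hF a b le_rfl hab le_rfl
    rwa [abs_sub_comm] at this
  · rintro _ ⟨s, hs, rfl⟩ _ ⟨t, ht, rfl⟩
    rcases le_total s t with h | h
    · exact Or.inl (key s t hs.1 h ht.2)
    · exact Or.inr (key t s ht.1 h hs.2)

/-- `k` is a compact connected set containing `p` and `q`, traversed from `p` to `q` by a curve of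
length at most `l`; the length enters through the variations of the two coordinates. -/
def IsArcOfLength (k : Set ℂ) (p q : ℂ) (l : ℝ) : Prop :=
  IsCompact k ∧ IsPreconnected k ∧ p ∈ k ∧ q ∈ k ∧ ‖p - q‖ ≤ l ∧
    ∃ X Y : ℝ, Chain (Complex.re '' k) p.re q.re X ∧ Chain (Complex.im '' k) p.im q.im Y ∧
      X + Y ≤ √2 * l

lemma IsArcOfLength.symm {k : Set ℂ} {p q : ℂ} {l : ℝ} (h : IsArcOfLength k p q l) :
    IsArcOfLength k q p l := by
  obtain ⟨h1, h2, h3, h4, h5, X, Y, h6, h7, h8⟩ := h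
  exact ⟨h1, h2, h4, h3, by rwa [norm_sub_rev], X, Y, h6.symm, h7.symm, h8⟩

lemma IsArcOfLength.append {k k' : Set ℂ} {p q r : ℂ} {l l' : ℝ} (h : IsArcOfLength k p q l)
    (h' : IsArcOfLength k' q r l') : IsArcOfLength (k ∪ k') p r (l + l') := by
  obtain ⟨h1, h2, h3, h4, h5, X, Y, h6, h7, h8⟩ := h
  obtain ⟨h1', h2', h3', h4', h5', X', Y', h6', h7', h8'⟩ := h'
  refine ⟨h1.union h1', h2.union q h4 h3' h2', Or.inl h3, Or.inr h4', ?_, X + X', Y + Y', ?_, ?_, ?_⟩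
  · exact (norm_sub_le_norm_sub_add_norm_sub p q r).trans (add_le_add h5 h5')
  · rw [image_union]; exact h6.append h6'
  · rw [image_union]; exact h7.append h7'
  · rw [mul_add]; linarith

lemma abs_re_add_abs_im_le (z : ℂ) : |z.re| + |z.im| ≤ √2 * ‖z‖ := by
  have h0 : 0 ≤ √2 * ‖z‖ := by positivity
  refine abs_le_of_sq_le_sq' ?_ h0 |>.2
  rw [mul_pow, Real.sq_sqrt (by norm_num), ← Complex.normSq_eq_norm_sq, Complex.normSq_apply]
  nlinarith [sq_nonneg (|z.re| - |z.im|), sq_abs z.re, sq_abs z.im]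

lemma isArcOfLength_of_integral {F D : ℝ → ℂ} {a b : ℝ} (hab : a ≤ b)
    (hD : IntervalIntegrable D volume a b)
    (hF : ∀ t ∈ Icc a b, F t = F a + ∫ x in a..t, D x) :
    IsArcOfLength (F '' Icc a b) (F a) (F b) (∫ x in a..b, ‖D x‖) := by
  have hsub : ∀ s t, a ≤ s → s ≤ t → t ≤ b → IntervalIntegrable D volume s t := by
    intro s t h1 h2 h3
    refine hD.mono_set ?_
    rw [uIcc_of_le hab, uIcc_of_le h2]
    exact Icc_subset_Icc h1 h3
  have hFd : ∀ s t, a ≤ s → s ≤ t → t ≤ b → F t - F s = ∫ x in s..t, D x := by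
    intro s t h1 h2 h3
    rw [hF t ⟨h1.trans h2, h3⟩, hF s ⟨h1, h2.trans h3⟩,
      ← intervalIntegral.integral_add_adjacent_intervals (hsub a s le_rfl h1 (h2.trans h3))
      (hsub s t h1 h2 h3)]
    ring
  have hcont : ContinuousOn F (Icc a b) := by
    have h1 : ContinuousOn (fun t => F a + ∫ x in a..t, D x) (Icc a b) := by
      refine continuousOn_const.add ?_
      have := intervalIntegral.continuousOn_primitive_interval (μ := volume) (a := a) (b := b)
        (f := D) (by rw [uIcc_of_le hab]; exact (intervalIntegrable_iff_integrableOn_Icc_of_le hab).1 hD)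
      rwa [uIcc_of_le hab] at this
    exact h1.congr hF
  have hre : IntervalIntegrable (fun x => (D x).re) volume a b := ⟨hD.1.re, hD.2.re⟩
  have him : IntervalIntegrable (fun x => (D x).im) volume a b := ⟨hD.1.im, hD.2.im⟩
  refine ⟨isCompact_Icc.image_of_continuousOn hcont, isPreconnected_Icc.image _ hcont,
    ⟨a, left_mem_Icc.2 hab, rfl⟩, ⟨b, right_mem_Icc.2 hab, rfl⟩, ?_,
    ∫ x in a..b, |(D x).re|, ∫ x in a..b, |(D x).im|, ?_, ?_, ?_⟩
  · rw [norm_sub_rev, hFd a b le_rfl hab le_rfl]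
    exact intervalIntegral.norm_integral_le_integral_norm hab
  · rw [image_image]
    refine chain_of_abs_sub_le_integral hab hre.abs fun s t h1 h2 h3 => ?_
    have e : (F t).re - (F s).re = ∫ x in s..t, (D x).re := by
      rw [← Complex.sub_re, hFd s t h1 h2 h3]
      exact (Complex.reCLM.intervalIntegral_comp_comm (hsub s t h1 h2 h3)).symm
    rw [e]
    exact intervalIntegral.abs_integral_le_integral_abs h2
  · rw [image_image]
    refine chain_of_abs_sub_le_integral hab him.abs fun s t h1 h2 h3 => ?_
    have e : (F t).im - (F s).im = ∫ x in s..t, (D x).im := by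
      rw [← Complex.sub_im, hFd s t h1 h2 h3]
      exact (Complex.imCLM.intervalIntegral_comp_comm (hsub s t h1 h2 h3)).symm
    rw [e]
    exact intervalIntegral.abs_integral_le_integral_abs h2
  · rw [← intervalIntegral.integral_add hre.abs him.abs, ← intervalIntegral.integral_const_mul]
    exact intervalIntegral.integral_mono_on hab (hre.abs.add him.abs) (hD.norm.const_mul _)
      fun x _ => abs_re_add_abs_im_le (D x)

/-- A closed curve of length `l + l'` lies in a rectangle of perimeter at most `√2 (l + l')`. -/
lemma IsArcOfLength.exists_rect {k σ : Set ℂ} {p q : ℂ} {l l' : ℝ} (h : IsArcOfLength k p q l)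
    (h' : IsArcOfLength σ p q l') :
    ∃ x₁ x₂ y₁ y₂ : ℝ, x₁ ≤ x₂ ∧ y₁ ≤ y₂ ∧ k ∪ σ ⊆ Icc x₁ x₂ ×ℂ Icc y₁ y₂ ∧
      2 * ((x₂ - x₁) + (y₂ - y₁)) ≤ √2 * (l + l') := by
  obtain ⟨h1, h2, h3, h4, h5, X, Y, h6, h7, h8⟩ := h
  obtain ⟨h1', h2', h3', h4', h5', X', Y', h6', h7', h8'⟩ := h'
  have hc : IsCompact (k ∪ σ) := h1.union h1'
  have hne : (k ∪ σ).Nonempty := ⟨p, Or.inl h3⟩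
  obtain ⟨a, ha, hamin⟩ := hc.exists_isMinOn hne Complex.continuous_re.continuousOn
  obtain ⟨b, hb, hbmax⟩ := hc.exists_isMaxOn hne Complex.continuous_re.continuousOn
  obtain ⟨c, hc', hcmin⟩ := hc.exists_isMinOn hne Complex.continuous_im.continuousOn
  obtain ⟨d, hd, hdmax⟩ := hc.exists_isMaxOn hne Complex.continuous_im.continuousOn
  refine ⟨a.re, b.re, c.im, d.im, hamin hb, hcmin hd,
    fun z hz => ⟨⟨hamin hz, hbmax hz⟩, ⟨hcmin hz, hdmax hz⟩⟩, ?_⟩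
  have e1 := h6.two_mul_abs_sub_le h6' (u := b.re) (v := a.re)
    (by rw [← image_union]; exact ⟨b, hb, rfl⟩) (by rw [← image_union]; exact ⟨a, ha, rfl⟩)
  have e2 := h7.two_mul_abs_sub_le h7' (u := d.im) (v := c.im)
    (by rw [← image_union]; exact ⟨d, hd, rfl⟩) (by rw [← image_union]; exact ⟨c, hc', rfl⟩)
  have e3 := le_abs_self (b.re - a.re)
  have e4 := le_abs_self (d.im - c.im)
  rw [mul_add]
  linarith

/-! ### Rotation by a right angle -/

lemma ae_neg {P : ℝ → Prop} (h : ∀ᵐ y : ℝ, P y) : ∀ᵐ y : ℝ, P (-y) :=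
  (Measure.measurePreserving_neg (volume : Measure ℝ)).quasiMeasurePreserving.ae h

lemma GradData.rotate {f D₁ D₂ : ℂ → ℂ} {U : Set ℂ} {K K' : ℝ}
    (h : GradData f D₁ D₂ U K K') :
    GradData (fun z => f (Complex.I * z)) (fun z => D₂ (Complex.I * z))
      (fun z => -D₁ (Complex.I * z)) {z | Complex.I * z ∈ U} K K' := by
  have hI : ∀ x y : ℝ, Complex.I * ⟨x, y⟩ = ⟨-y, x⟩ := fun x y => by
    apply Complex.ext <;> simp
  have hmeas : Measurable fun z : ℂ => Complex.I * z := by fun_prop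
  refine ⟨h.measurable₂.comp hmeas, (h.measurable₁.comp hmeas).neg, ?_, ?_, ?_⟩
  · intro E hE hEm
    have hmp : MeasurePreserving (fun z : ℂ => Complex.I * z) volume volume := by
      have := (rotation (⟨Complex.I, by simp [Submonoid.unitSphere]⟩ : Circle)).measurePreserving
      exact this
    have hemb : MeasurableEmbedding fun z : ℂ => Complex.I * z :=
      (Homeomorph.mulLeft₀ Complex.I Complex.I_ne_zero).measurableEmbedding
    have hA := h.area ((fun z => Complex.I * z) '' E) (by rintro _ ⟨z, hz, rfl⟩; exact hE hz)
      (hemb.measurableSet_image.2 hEm)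
    rw [image_image] at hA
    have e1 : volume ((fun z => Complex.I * z) '' E) = volume E := by
      rw [← hmp.measure_preimage_emb hemb, preimage_image_eq _ hemb.injective]
    have e2 : ∫⁻ z in (fun z => Complex.I * z) '' E, (‖D₁ z‖ₑ ^ 2 + ‖D₂ z‖ₑ ^ 2) =
        ∫⁻ z in E, (‖D₁ (Complex.I * z)‖ₑ ^ 2 + ‖D₂ (Complex.I * z)‖ₑ ^ 2) := by
      rw [← hmp.setLIntegral_comp_preimage_emb hemb, preimage_image_eq _ hemb.injective]
    rw [e1, e2] at hA
    simpa only [enorm_neg, add_comm] using hA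
  · filter_upwards [ae_neg h.vertical] with y hy a b hab hseg
    simpa only [hI] using hy a b hab fun x hx => by simpa only [hI, mem_ofPred_eq] using hseg x hx
  · filter_upwards [h.horizontal] with x hx a b hab hseg
    have := hx (-b) (-a) (by linarith) fun u hu => by
      have := hseg (-u) ⟨by linarith [hu.2], by linarith [hu.1]⟩
      simpa only [hI, mem_ofPred_eq, neg_neg] using this
    simp only [hI]
    constructor
    · have h1 := this.1.comp_sub_left 0
      simp only [zero_sub] at h1
      have h2 : IntervalIntegrable (fun y => D₁ ⟨-y, x⟩) volume a b := by simpa using h1.symm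
      exact h2.neg
    · rw [intervalIntegral.integral_neg, intervalIntegral.integral_comp_neg (fun u => D₁ ⟨u, x⟩),
        this.2]
      ring

/-! ### Images of rectangular crosscuts -/

/-- The bounded open set `Ω` has boundary in the compact set `E`, and points of `E` at distance less
than `η` are joined in `E` by an arc of length at most `B` times their distance. The relation
between `Ω` and `E` is expressed by `maximal`. -/
structure IsCurveDomain (Ω E : Set ℂ) (B η : ℝ) : Prop where
  isOpen : IsOpen Ω
  isBounded : Bornology.IsBounded Ω
  isCompact : IsCompact E
  disjoint : Disjoint Ω E
  maximal : ∀ T : Set ℂ, IsPreconnected T → Disjoint T E → (T ∩ Ω).Nonempty → T ⊆ Ω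
  arcs : ∀ p ∈ E, ∀ q ∈ E, ‖p - q‖ < η →
    ∃ (σ : Set ℂ) (l : ℝ), σ ⊆ E ∧ IsArcOfLength σ p q l ∧ l ≤ B * ‖p - q‖

/-- A homeomorphism onto `Ω` takes boundary points to points of `E`. -/
lemma IsCurveDomain.limit_mem {Ω E U : Set ℂ} {B η : ℝ} (hΩ : IsCurveDomain Ω E B η) {f : ℂ → ℂ}
    (hf : IsHomeoOnto f U Ω) {ι : Type*} {l : Filter ι} [l.NeBot] {u : ι → ℂ} {ζ p : ℂ}
    (hu : ∀ᶠ i in l, u i ∈ U) (hζ : Filter.Tendsto u l (nhds ζ)) (hζU : ζ ∉ U)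
    (hp : Filter.Tendsto (fun i => f (u i)) l (nhds p)) : p ∈ E := by
  obtain ⟨hfc, v, hv, hmf, hmv, hinv⟩ := hf
  by_contra hpE
  obtain ⟨ε, hε, hb⟩ := Metric.isOpen_iff.1 hΩ.isCompact.isClosed.isOpen_compl p hpE
  have h1 : ∀ᶠ i in l, f (u i) ∈ Metric.ball p ε := hp.eventually (Metric.ball_mem_nhds p hε)
  obtain ⟨i, hi, hiU⟩ := (h1.and hu).exists
  have hpΩ : p ∈ Ω := hΩ.maximal (Metric.ball p ε) (convex_ball p ε).isPreconnected
    (Set.disjoint_left.2 fun z hz => hb hz) ⟨_, hi, hmf hiU⟩ (Metric.mem_ball_self hε)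
  have h2 : Filter.Tendsto (fun i => v (f (u i))) l (nhds (v p)) :=
    ((hv p hpΩ).continuousAt (hΩ.isOpen.mem_nhds hpΩ)).tendsto.comp hp
  have h3 : Filter.Tendsto u l (nhds (v p)) := by
    refine h2.congr' ?_
    filter_upwards [hu] with i hi using hinv.1 hi
  exact hζU ((tendsto_nhds_unique hζ h3) ▸ hmv hpΩ)

lemma sq_lintegral_le {α : Type*} [MeasurableSpace α] {μ : Measure α} {g : α → ENNReal}
    (hg : AEMeasurable g μ) : (∫⁻ x, g x ∂μ) ^ 2 ≤ μ univ * ∫⁻ x, g x ^ 2 ∂μ := by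
  have h := ENNReal.lintegral_mul_le_Lp_mul_Lq μ Real.HolderConjugate.two_two hg
    (aemeasurable_const (b := (1 : ENNReal)))
  simp only [Pi.mul_apply, mul_one, lintegral_const, ENNReal.rpow_ofNat, one_pow,
    one_mul] at h
  calc (∫⁻ x, g x ∂μ) ^ 2
      ≤ ((∫⁻ x, g x ^ 2 ∂μ) ^ (1 / 2 : ℝ) * (μ univ) ^ (1 / 2 : ℝ)) ^ 2 := by gcongr
    _ = μ univ * ∫⁻ x, g x ^ 2 ∂μ := by
      rw [mul_pow, ← ENNReal.rpow_natCast, ← ENNReal.rpow_natCast, ← ENNReal.rpow_mul,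
        ← ENNReal.rpow_mul]
      norm_num
      rw [mul_comm]

/-- Length and energy of a function with square integrable derivative on an interval. -/
lemma length_sq_le {D : ℝ → ℂ} (hD : Measurable D) {a b : ℝ} (hab : a ≤ b)
    (hfin : ∫⁻ x in Ioo a b, ‖D x‖ₑ ^ 2 ≠ ⊤) :
    IntervalIntegrable D volume a b ∧ 0 ≤ ∫ x in a..b, ‖D x‖ ∧
      ENNReal.ofReal ((∫ x in a..b, ‖D x‖) ^ 2) ≤
        ENNReal.ofReal (b - a) * ∫⁻ x in Ioo a b, ‖D x‖ₑ ^ 2 := by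
  have h1 := sq_lintegral_le (μ := volume.restrict (Ioo a b)) (g := fun x => ‖D x‖ₑ)
    hD.enorm.aemeasurable
  rw [Measure.restrict_apply_univ, Real.volume_Ioo] at h1
  have h2 : ∫⁻ x in Ioo a b, ‖D x‖ₑ ≠ ⊤ := by
    intro htop
    rw [htop] at h1
    have : ENNReal.ofReal (b - a) * ∫⁻ x in Ioo a b, ‖D x‖ₑ ^ 2 ≠ ⊤ :=
      ENNReal.mul_ne_top ENNReal.ofReal_ne_top hfin
    exact this (top_le_iff.1 (by simpa using h1))
  have h3 : IntegrableOn D (Ioo a b) := ⟨hD.aestronglyMeasurable, lt_top_iff_ne_top.2 h2⟩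
  refine ⟨(intervalIntegrable_iff_integrableOn_Ioo_of_le hab).2 h3,
    intervalIntegral.integral_nonneg hab fun _ _ => norm_nonneg _, ?_⟩
  have h4 : ∫ x in a..b, ‖D x‖ = (∫⁻ x in Ioo a b, ‖D x‖ₑ).toReal := by
    rw [intervalIntegral.integral_of_le hab, integral_Ioc_eq_integral_Ioo,
      integral_norm_eq_lintegral_enorm hD.aestronglyMeasurable]
  rw [h4, ENNReal.ofReal_pow ENNReal.toReal_nonneg, ENNReal.ofReal_toReal h2]
  exact h1

lemma ENNReal_add_sq_le {x y : ℝ} {A B : ℝ} {p q : ENNReal} (hA : 0 ≤ A)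
    (hB : 0 ≤ B) (hp : p ≠ ⊤) (hq : q ≠ ⊤)
    (h1 : ENNReal.ofReal (x ^ 2) ≤ ENNReal.ofReal A * p)
    (h2 : ENNReal.ofReal (y ^ 2) ≤ ENNReal.ofReal B * q) :
    ENNReal.ofReal ((x + y) ^ 2) ≤ ENNReal.ofReal (A + B) * (p + q) := by
  lift p to NNReal using hp
  lift q to NNReal using hq
  have e1 : x ^ 2 ≤ A * p := by
    rw [← ENNReal.ofReal_coe_nnreal, ← ENNReal.ofReal_mul hA] at h1
    exact (ENNReal.ofReal_le_ofReal_iff (by positivity)).1 h1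
  have e2 : y ^ 2 ≤ B * q := by
    rw [← ENNReal.ofReal_coe_nnreal, ← ENNReal.ofReal_mul hB] at h2
    exact (ENNReal.ofReal_le_ofReal_iff (by positivity)).1 h2
  rw [← ENNReal.coe_add, ← ENNReal.ofReal_coe_nnreal, ← ENNReal.ofReal_mul (by positivity)]
  refine ENNReal.ofReal_le_ofReal ?_
  push_cast
  have hp0 : (0 : ℝ) ≤ p := p.2
  have hq0 : (0 : ℝ) ≤ q := q.2
  have h3 : 2 * (x * y) ≤ A * q + B * p := by
    refine abs_le_of_sq_le_sq' ?_ (by positivity) |>.2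
    have h4 : x ^ 2 * y ^ 2 ≤ (A * p) * (B * q) :=
      mul_le_mul e1 e2 (sq_nonneg y) (by positivity)
    nlinarith [sq_nonneg (A * q - B * p)]
  nlinarith

/-- The image of a half-open segment ending on the boundary of `U`: the end has a limit in `E`, and
the image together with the limit is an arc whose length is controlled by the energy. -/
lemma exists_arc_of_halfOpen {Ω E U : Set ℂ} {B η : ℝ} (hΩ : IsCurveDomain Ω E B η) {f : ℂ → ℂ}
    (hf : IsHomeoOnto f U Ω) {γ : ℝ → ℂ} (hγ : Continuous γ) {D : ℝ → ℂ} (hD : Measurable D)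
    {x₀ x₁ : ℝ} (hx : x₀ < x₁) (hU : ∀ x ∈ Ico x₀ x₁, γ x ∈ U) (hx₁ : γ x₁ ∉ U)
    (hftc : ∀ b ∈ Ico x₀ x₁, ∫ x in x₀..b, D x = f (γ b) - f (γ x₀))
    (hfin : ∫⁻ x in Ioo x₀ x₁, ‖D x‖ₑ ^ 2 ≠ ⊤) :
    ∃ p ∈ E, ∃ l : ℝ, 0 ≤ l ∧
      IsArcOfLength (f '' (γ '' Ico x₀ x₁) ∪ {p}) (f (γ x₀)) p l ∧
      ENNReal.ofReal (l ^ 2) ≤ ENNReal.ofReal (x₁ - x₀) * ∫⁻ x in Ioo x₀ x₁, ‖D x‖ₑ ^ 2 := by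
  obtain ⟨hint, hl0, hl⟩ := length_sq_le hD hx.le hfin
  set F : ℝ → ℂ := fun t => f (γ x₀) + ∫ x in x₀..t, D x with hF
  have hFx₀ : F x₀ = f (γ x₀) := by simp [hF]
  have hFeq : ∀ b ∈ Ico x₀ x₁, F b = f (γ b) := fun b hb => by simp [hF, hftc b hb]
  have harc := isArcOfLength_of_integral (F := F) hx.le hint fun t _ => by rw [hFx₀]
  have hcont : ContinuousWithinAt F (Icc x₀ x₁) x₁ := by
    have h1 := intervalIntegral.continuousOn_primitive_interval (μ := volume) (a := x₀) (b := x₁)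
      (f := D) (by
        rw [uIcc_of_le hx.le]; exact (intervalIntegrable_iff_integrableOn_Icc_of_le hx.le).1 hint)
    rw [uIcc_of_le hx.le] at h1
    exact (continuousOn_const.add h1) x₁ (right_mem_Icc.2 hx.le)
  have hne : (nhdsWithin x₁ (Ico x₀ x₁)).NeBot := by
    rw [← mem_closure_iff_nhdsWithin_neBot, closure_Ico hx.ne]
    exact right_mem_Icc.2 hx.le
  have hp : F x₁ ∈ E := by
    refine hΩ.limit_mem hf (l := nhdsWithin x₁ (Ico x₀ x₁)) (u := γ) ?_
      (hγ.continuousAt.tendsto.mono_left nhdsWithin_le_nhds) hx₁ ?_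
    · filter_upwards [self_mem_nhdsWithin] with x hx using hU x hx
    · have h2 := hcont.tendsto.mono_left (nhdsWithin_mono x₁ Ico_subset_Icc_self)
      refine h2.congr' ?_
      filter_upwards [self_mem_nhdsWithin] with x hx using hFeq x hx
  refine ⟨F x₁, hp, _, hl0, ?_, hl⟩
  have himg : F '' Icc x₀ x₁ = f '' (γ '' Ico x₀ x₁) ∪ {F x₁} := by
    rw [← Ico_union_right hx.le, image_union, image_singleton, image_image]
    congr 1
    exact image_congr hFeq
  rwa [himg, hFx₀] at harc

/-- Near the boundary point `a`, the set `U` consists of the points to the left of the graph of `φ`,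
which is nearly `1`-Lipschitz and nearly midpoint concave at `a`. -/
structure IsLocalGraph (U : Set ℂ) (a : ℂ) (φ : ℝ → ℝ) (r₀ : ℝ) : Prop where
  mem_iff : ∀ x y : ℝ, |y - a.im| ≤ r₀ → a.re - 11 / 10 * r₀ ≤ x → x ≤ a.re + 2 * r₀ →
    ((⟨x, y⟩ : ℂ) ∈ U ↔ x < φ y)
  abs_sub_le : ∀ r : ℝ, |r| ≤ r₀ → |φ (a.im + r) - a.re| ≤ 21 / 20 * |r|
  add_le : ∀ r : ℝ, 0 ≤ r → r ≤ r₀ → φ (a.im + r) + φ (a.im - r) ≤ 2 * a.re + r / 10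

/-- The open rectangle about `a` of size `r`. -/
def openRect (a : ℂ) (r : ℝ) : Set ℂ :=
  Ioo (a.re - 11 / 10 * r) (a.re + 2 * r) ×ℂ Ioo (a.im - r) (a.im + r)

/-- The closed rectangle about `a` of size `r`. -/
def closedRect (a : ℂ) (r : ℝ) : Set ℂ :=
  Icc (a.re - 11 / 10 * r) (a.re + 2 * r) ×ℂ Icc (a.im - r) (a.im + r)

lemma isOpen_openRect (a : ℂ) (r : ℝ) : IsOpen (openRect a r) := isOpen_Ioo.reProdIm isOpen_Ioo

lemma isClosed_closedRect (a : ℂ) (r : ℝ) : IsClosed (closedRect a r) :=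
  isClosed_Icc.reProdIm isClosed_Icc

lemma openRect_subset_closedRect (a : ℂ) (r : ℝ) : openRect a r ⊆ closedRect a r :=
  fun _ hz => ⟨Ioo_subset_Icc_self hz.1, Ioo_subset_Icc_self hz.2⟩

/-- The energy of a mapping with partial derivatives `D₁` and `D₂` on the part of the boundary of
`openRect a r` in `U`. -/
noncomputable def crosscutEnergy (D₁ D₂ : ℂ → ℂ) (U : Set ℂ) (a : ℂ) (r : ℝ) : ENNReal :=
  (∫⁻ x in Ioo (a.re - 11 / 10 * r) (a.re + 2 * r),
    U.indicator (fun z => ‖D₁ z‖ₑ ^ 2) ⟨x, a.im - r⟩) +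
  (∫⁻ y in Ioo (a.im - r) (a.im + r),
    U.indicator (fun z => ‖D₂ z‖ₑ ^ 2) ⟨a.re - 11 / 10 * r, y⟩) +
  ∫⁻ x in Ioo (a.re - 11 / 10 * r) (a.re + 2 * r),
    U.indicator (fun z => ‖D₁ z‖ₑ ^ 2) ⟨x, a.im + r⟩

/-- The part of the boundary of `openRect a r` in `U`, as a union of three segments. -/
lemma IsLocalGraph.crosscut_eq {U : Set ℂ} {a : ℂ} {φ : ℝ → ℝ} {r₀ r : ℝ}
    (h : IsLocalGraph U a φ r₀) (hr : 0 < r) (hrr : r ≤ r₀) :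
    U ∩ (closedRect a r \ openRect a r) =
      (fun x : ℝ => (⟨x, a.im - r⟩ : ℂ)) '' Ico (a.re - 11 / 10 * r) (φ (a.im - r)) ∪
      (fun y : ℝ => (⟨a.re - 11 / 10 * r, y⟩ : ℂ)) '' Icc (a.im - r) (a.im + r) ∪
      (fun x : ℝ => (⟨x, a.im + r⟩ : ℂ)) '' Ico (a.re - 11 / 10 * r) (φ (a.im + r)) := by
  have hφ : ∀ s : ℝ, |s| ≤ r → |φ (a.im + s) - a.re| ≤ 21 / 20 * r := fun s hs =>
    (h.abs_sub_le s (hs.trans hrr)).trans (by linarith)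
  have hm := hφ (-r) (by rw [abs_neg, abs_of_pos hr])
  have hp := hφ r (by rw [abs_of_pos hr])
  rw [← sub_eq_add_neg] at hm
  rw [abs_le] at hm hp
  have hmem : ∀ x y : ℝ, a.im - r ≤ y → y ≤ a.im + r → a.re - 11 / 10 * r ≤ x →
      x ≤ a.re + 2 * r → ((⟨x, y⟩ : ℂ) ∈ U ↔ x < φ y) := by
    intro x y h1 h2 h3 h4
    exact h.mem_iff x y (by rw [abs_le]; constructor <;> linarith) (by linarith) (by linarith)
  ext ⟨x, y⟩
  simp only [closedRect, openRect, mem_inter_iff, mem_sdiff, Complex.mem_reProdIm, mem_union,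
    mem_image, mem_Icc, mem_Ioo, mem_Ico, Complex.mk.injEq]
  constructor
  · rintro ⟨hU, ⟨⟨h1, h2⟩, h3, h4⟩, h5⟩
    have hlt := (hmem x y h3 h4 h1 h2).1 hU
    by_cases hx : x = a.re - 11 / 10 * r
    · exact Or.inl (Or.inr ⟨y, ⟨h3, h4⟩, hx.symm, rfl⟩)
    · by_cases hy : y = a.im - r
      · exact Or.inl (Or.inl ⟨x, ⟨h1, hy ▸ hlt⟩, rfl, hy.symm⟩)
      · by_cases hy' : y = a.im + r
        · exact Or.inr ⟨x, ⟨h1, hy' ▸ hlt⟩, rfl, hy'.symm⟩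
        · exfalso
          have hφy := hφ (y - a.im) (by rw [abs_le]; constructor <;> linarith)
          rw [add_sub_cancel, abs_le] at hφy
          exact h5 ⟨⟨lt_of_le_of_ne h1 (Ne.symm hx), by linarith⟩,
            lt_of_le_of_ne h3 (Ne.symm hy), lt_of_le_of_ne h4 hy'⟩
  · rintro ((⟨x', ⟨h1, h2⟩, rfl, rfl⟩ | ⟨y', ⟨h1, h2⟩, rfl, rfl⟩) | ⟨x', ⟨h1, h2⟩, rfl, rfl⟩)
    · refine ⟨(hmem _ _ le_rfl (by linarith) h1 (by linarith)).2 h2, ⟨⟨h1, by linarith⟩, by simp,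
        by linarith⟩, fun h => lt_irrefl _ h.2.1⟩
    · have hφy := hφ (y' - a.im) (by rw [abs_le]; constructor <;> linarith)
      rw [add_sub_cancel, abs_le] at hφy
      refine ⟨(hmem _ _ h1 h2 le_rfl (by linarith)).2 (by linarith),
        ⟨⟨le_rfl, by linarith⟩, h1, h2⟩, fun h => lt_irrefl _ h.1.1⟩
    · refine ⟨(hmem _ _ (by linarith) le_rfl h1 (by linarith)).2 h2, ⟨⟨h1, by linarith⟩,
        by linarith, le_rfl⟩, fun h => lt_irrefl _ h.2.2⟩

/-- The image of a rectangular crosscut of finite energy at which `f` is the integral of its partial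
derivatives: with two points of `E` it forms an arc, whose length is controlled by the energy.
The constant `43 / 10` bounds the length of the crosscut divided by `r`. -/
lemma exists_arc_of_crosscut {Ω E U : Set ℂ} {B η : ℝ} (hΩ : IsCurveDomain Ω E B η)
    {f D₁ D₂ : ℂ → ℂ} (hf : IsHomeoOnto f U Ω) (hD₁ : Measurable D₁) (hD₂ : Measurable D₂)
    {a : ℂ} {φ : ℝ → ℝ} {r₀ r : ℝ} (h : IsLocalGraph U a φ r₀) (hr : 0 < r) (hrr : r ≤ r₀)
    (hh : ∀ s : ℝ, s = r ∨ s = -r → ∀ b c : ℝ, b ≤ c →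
      (∀ x ∈ Icc b c, (⟨x, a.im + s⟩ : ℂ) ∈ U) →
      ∫ x in b..c, D₁ ⟨x, a.im + s⟩ = f ⟨c, a.im + s⟩ - f ⟨b, a.im + s⟩)
    (hv : ∀ b c : ℝ, b ≤ c → (∀ y ∈ Icc b c, (⟨a.re - 11 / 10 * r, y⟩ : ℂ) ∈ U) →
      ∫ y in b..c, D₂ ⟨a.re - 11 / 10 * r, y⟩ =
        f ⟨a.re - 11 / 10 * r, c⟩ - f ⟨a.re - 11 / 10 * r, b⟩)
    (hfin : crosscutEnergy D₁ D₂ U a r ≠ ⊤) :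
    ∃ p ∈ E, ∃ q ∈ E, ∃ l : ℝ, 0 ≤ l ∧
      IsArcOfLength (f '' (U ∩ (closedRect a r \ openRect a r)) ∪ {p, q}) p q l ∧
      ENNReal.ofReal (l ^ 2) ≤ ENNReal.ofReal (43 / 10 * r) * crosscutEnergy D₁ D₂ U a r := by
  set x₀ := a.re - 11 / 10 * r with hx₀
  have hφ : ∀ s : ℝ, |s| ≤ r → |φ (a.im + s) - a.re| ≤ 21 / 20 * r := fun s hs =>
    (h.abs_sub_le s (hs.trans hrr)).trans (by linarith)
  have hmem : ∀ s x : ℝ, |s| ≤ r → x₀ ≤ x →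
      x ≤ a.re + 2 * r → ((⟨x, a.im + s⟩ : ℂ) ∈ U ↔ x < φ (a.im + s)) := by
    intro s x h1 h2 h3
    exact h.mem_iff x _ (by rw [add_sub_cancel_left]; linarith) (by linarith) (by linarith)
  -- The horizontal sides.
  have side : ∀ s : ℝ, s = r ∨ s = -r →
      ∫⁻ x in Ioo x₀ (a.re + 2 * r), U.indicator (fun z => ‖D₁ z‖ₑ ^ 2) ⟨x, a.im + s⟩ ≠ ⊤ →
      ∃ p ∈ E, ∃ l : ℝ, 0 ≤ l ∧
        IsArcOfLength (f '' ((fun x : ℝ => (⟨x, a.im + s⟩ : ℂ)) '' Ico x₀ (φ (a.im + s))) ∪ {p})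
          (f ⟨x₀, a.im + s⟩) p l ∧
        ENNReal.ofReal (l ^ 2) ≤ ENNReal.ofReal (φ (a.im + s) - x₀) *
          ∫⁻ x in Ioo x₀ (a.re + 2 * r), U.indicator (fun z => ‖D₁ z‖ₑ ^ 2) ⟨x, a.im + s⟩ := by
    intro s hs hsfin
    have hsr : |s| ≤ r := by
      rcases hs with rfl | rfl
      · rw [abs_of_pos hr]
      · rw [abs_neg, abs_of_pos hr]
    have h1 := abs_le.1 (hφ s hsr)
    have hlt : x₀ < φ (a.im + s) := by linarith
    have hUs : ∀ x ∈ Ico x₀ (φ (a.im + s)), (⟨x, a.im + s⟩ : ℂ) ∈ U := fun x hx =>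
      (hmem s x hsr hx.1 (by linarith [hx.2])).2 hx.2
    have hle : ∫⁻ x in Ioo x₀ (φ (a.im + s)), ‖D₁ ⟨x, a.im + s⟩‖ₑ ^ 2 ≤
        ∫⁻ x in Ioo x₀ (a.re + 2 * r), U.indicator (fun z => ‖D₁ z‖ₑ ^ 2) ⟨x, a.im + s⟩ := by
      calc ∫⁻ x in Ioo x₀ (φ (a.im + s)), ‖D₁ ⟨x, a.im + s⟩‖ₑ ^ 2
          = ∫⁻ x in Ioo x₀ (φ (a.im + s)), U.indicator (fun z => ‖D₁ z‖ₑ ^ 2) ⟨x, a.im + s⟩ := by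
            refine setLIntegral_congr_fun measurableSet_Ioo fun x hx => ?_
            rw [indicator_of_mem (hUs x ⟨hx.1.le, hx.2⟩)]
        _ ≤ _ := lintegral_mono_set (Ioo_subset_Ioo_right (by linarith))
    obtain ⟨p, hp, l, hl0, harc, hl⟩ := exists_arc_of_halfOpen hΩ hf
      (γ := fun x => ⟨x, a.im + s⟩) (continuous_mk_re _)
      (D := fun x => D₁ ⟨x, a.im + s⟩) (hD₁.comp (continuous_mk_re _).measurable) hlt hUs
      (fun hcon => lt_irrefl _ ((hmem s _ hsr hlt.le (by linarith)).1 hcon))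
      (fun b hb => hh s hs x₀ b hb.1 fun x hx => hUs x ⟨hx.1, hx.2.trans_lt hb.2⟩)
      (ne_top_of_le_ne_top hsfin hle)
    exact ⟨p, hp, l, hl0, harc, hl.trans (by gcongr)⟩
  rw [crosscutEnergy, ← hx₀] at hfin ⊢
  rw [sub_eq_add_neg a.im r] at hfin ⊢
  have hfin' := ENNReal.add_ne_top.1 hfin
  have hfin'' := ENNReal.add_ne_top.1 hfin'.1
  obtain ⟨p, hp, l₁, hl₁, harc₁, hE₁⟩ := side (-r) (Or.inr rfl) hfin''.1
  obtain ⟨q, hq, l₃, hl₃, harc₃, hE₃⟩ := side r (Or.inl rfl) hfin'.2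
  -- The vertical side.
  have hUv : ∀ y ∈ Icc (a.im + -r) (a.im + r), (⟨x₀, y⟩ : ℂ) ∈ U := by
    intro y hy
    have hy' : |y - a.im| ≤ r := by rw [abs_le]; constructor <;> linarith [hy.1, hy.2]
    have h1 := hmem (y - a.im) x₀ hy' le_rfl (by linarith)
    have h2 := abs_le.1 (hφ (y - a.im) hy')
    rw [add_sub_cancel] at h1 h2
    exact h1.2 (by linarith)
  have hle : ∫⁻ y in Ioo (a.im + -r) (a.im + r), ‖D₂ ⟨x₀, y⟩‖ₑ ^ 2 =
      ∫⁻ y in Ioo (a.im + -r) (a.im + r), U.indicator (fun z => ‖D₂ z‖ₑ ^ 2) ⟨x₀, y⟩ := by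
    refine setLIntegral_congr_fun measurableSet_Ioo fun y hy => ?_
    rw [indicator_of_mem (hUv y ⟨hy.1.le, hy.2.le⟩)]
  obtain ⟨hint, hl₂, hE₂⟩ := length_sq_le (D := fun y => D₂ ⟨x₀, y⟩)
    (hD₂.comp (continuous_mk_im _).measurable) (show a.im + -r ≤ a.im + r by linarith)
    (by rw [hle]; exact hfin''.2)
  have harc₂ := isArcOfLength_of_integral (F := fun y => f ⟨x₀, y⟩)
    (show a.im + -r ≤ a.im + r by linarith) hint fun t ht => by
      rw [hv _ _ ht.1 fun y hy => hUv y ⟨hy.1, hy.2.trans ht.2⟩]; ring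
  rw [hle] at hE₂
  set l₂ := ∫ y in (a.im + -r)..(a.im + r), ‖D₂ ⟨x₀, y⟩‖
  refine ⟨p, hp, q, hq, l₁ + l₂ + l₃, by positivity, ?_, ?_⟩
  · have harc := (harc₁.symm.append harc₂).append harc₃
    convert harc using 1
    rw [h.crosscut_eq hr hrr, image_union, image_union, ← hx₀, ← sub_eq_add_neg,
      image_image f (fun y : ℝ => (⟨x₀, y⟩ : ℂ))]
    ext z
    simp only [mem_union, mem_insert_iff, mem_singleton_iff]
    tauto
  · have hm := abs_le.1 (hφ (-r) (by rw [abs_neg, abs_of_pos hr]))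
    have hp := abs_le.1 (hφ r (by rw [abs_of_pos hr]))
    have hsum := h.add_le r hr.le hrr
    rw [sub_eq_add_neg] at hsum
    have h12 := ENNReal_add_sq_le (by linarith) (by linarith) hfin''.1 hfin''.2 hE₁ hE₂
    have h123 := ENNReal_add_sq_le (by linarith) (by linarith) hfin'.1 hfin'.2 h12 hE₃
    refine h123.trans ?_
    gcongr
    linarith

/-- The side of a short crosscut which does not contain two distant points has small image. -/
lemma image_subset_rect {Ω E U : Set ℂ} {B η : ℝ} (hB : 0 ≤ B) (hΩ : IsCurveDomain Ω E B η)
    {f : ℂ → ℂ} (hf : IsHomeoOnto f U Ω) (hU : IsOpen U) (hUc : IsPreconnected U)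
    {a : ℂ} {r : ℝ} {p q : ℂ} (hp : p ∈ E) (hq : q ∈ E) {l : ℝ} (hl : l < η)
    (harc : IsArcOfLength (f '' (U ∩ (closedRect a r \ openRect a r)) ∪ {p, q}) p q l)
    {z₁ z₂ : ℂ} (hz₁ : z₁ ∈ U) (hz₂ : z₂ ∈ U) (hz₁r : z₁ ∉ closedRect a r)
    (hz₂r : z₂ ∉ closedRect a r) (hfar : (1 + B) * l < ‖f z₁ - f z₂‖) :
    ∃ x₁ x₂ y₁ y₂ : ℝ, x₁ ≤ x₂ ∧ y₁ ≤ y₂ ∧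
      f '' (U ∩ openRect a r) ⊆ Icc x₁ x₂ ×ℂ Icc y₁ y₂ ∧
      2 * ((x₂ - x₁) + (y₂ - y₁)) ≤ √2 * ((1 + B) * l) := by
  have hpq : ‖p - q‖ ≤ l := harc.2.2.2.2.1
  obtain ⟨σ, l', hσE, hσ, hl'⟩ := hΩ.arcs p hp q hq (hpq.trans_lt hl)
  obtain ⟨x₁, x₂, y₁, y₂, hx, hy, hsub, hper⟩ := harc.exists_rect hσ
  have hl'' : l + l' ≤ (1 + B) * l := by nlinarith
  have hper' : 2 * ((x₂ - x₁) + (y₂ - y₁)) ≤ √2 * ((1 + B) * l) :=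
    hper.trans (by gcongr)
  refine ⟨x₁, x₂, y₁, y₂, hx, hy, ?_, hper'⟩
  set k := f '' (U ∩ (closedRect a r \ openRect a r)) with hk
  have hC : k ∪ {p, q} ∪ σ = k ∪ σ := by
    have : ({p, q} : Set ℂ) ⊆ σ := by
      rintro z (rfl | rfl)
      · exact hσ.2.2.1
      · exact hσ.2.2.2.1
    rw [union_assoc, union_eq_self_of_subset_left this]
  rw [hC] at hsub
  have hinj := hf.injOn
  have himg := hf.image_eq
  have hdisj : ∀ S T : Set ℂ, S ⊆ U → T ⊆ U → Disjoint S T → Disjoint (f '' S) (f '' T) :=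
    fun S T hS hT h => by
      rw [disjoint_iff_inter_eq_empty, ← hinj.image_inter hS hT, disjoint_iff_inter_eq_empty.1 h,
        image_empty]
  have hsq : √2 ≤ 2 := by
    rw [Real.sqrt_le_left (by norm_num)]; norm_num
  -- One of the two distant points has its image outside the rectangle.
  have hout : ∃ w₀ ∈ f '' (U \ closedRect a r), w₀ ∉ Icc x₁ x₂ ×ℂ Icc y₁ y₂ := by
    by_contra hcon
    push Not at hcon
    have h1 := hcon (f z₁) ⟨z₁, ⟨hz₁, hz₁r⟩, rfl⟩
    have h2 := hcon (f z₂) ⟨z₂, ⟨hz₂, hz₂r⟩, rfl⟩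
    rw [Complex.mem_reProdIm, mem_Icc, mem_Icc] at h1 h2
    have h3 := Complex.norm_le_abs_re_add_abs_im (f z₁ - f z₂)
    rw [Complex.sub_re, Complex.sub_im] at h3
    have h4 : |(f z₁).re - (f z₂).re| ≤ x₂ - x₁ := by rw [abs_le]; constructor <;> linarith
    have h5 : |(f z₁).im - (f z₂).im| ≤ y₂ - y₁ := by rw [abs_le]; constructor <;> linarith
    have h6 : 0 ≤ (1 + B) * l := by
      have : 0 ≤ l := (norm_nonneg _).trans hpq
      positivity
    nlinarith
  obtain ⟨w₀, hw₀, hw₀W⟩ := hout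
  have hΩc : IsPreconnected Ω := himg ▸ hUc.image f hf.1
  refine subset_rect_of_crosscut hΩc hΩ.isCompact hΩ.disjoint hΩ.maximal hσE hσ.2.1
    (k := k) (R := f '' (U \ closedRect a r)) ?_ ?_ hsub ?_ ?_ ?_ ?_ ?_ ?_ ?_ ?_ hw₀ hw₀W
  · rw [← himg]; exact image_mono inter_subset_left
  · rw [← hC]; exact harc.1.union hσ.1
  · exact hf.isOpen_image hΩ.isOpen inter_subset_left (hU.inter (isOpen_openRect a r))
  · exact hf.isOpen_image hΩ.isOpen sdiff_subset (hU.sdiff (isClosed_closedRect a r))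
  · refine hdisj _ _ inter_subset_left sdiff_subset (Set.disjoint_left.2 fun z hz hz' => ?_)
    exact hz'.2 (openRect_subset_closedRect a r hz.2)
  · refine hdisj _ _ inter_subset_left inter_subset_left (Set.disjoint_left.2 fun z hz hz' => ?_)
    exact hz'.2.2 hz.2
  · refine hdisj _ _ sdiff_subset inter_subset_left (Set.disjoint_left.2 fun z hz hz' => ?_)
    exact hz.2 hz'.2.1
  · rw [← himg]; exact image_mono inter_subset_left
  · rw [← himg]; exact image_mono sdiff_subset
  · rw [← himg]
    rintro _ ⟨z, hz, rfl⟩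
    by_cases h1 : z ∈ openRect a r
    · exact Or.inl (Or.inl ⟨z, ⟨hz, h1⟩, rfl⟩)
    · by_cases h2 : z ∈ closedRect a r
      · exact Or.inr ⟨z, ⟨hz, h2, h1⟩, rfl⟩
      · exact Or.inl (Or.inr ⟨z, ⟨hz, h2⟩, rfl⟩)

/-! ### The energy of crosscuts -/

lemma map_affine_volume (c : ℝ) {κ : ℝ} (hκ : κ ≠ 0) :
    Measure.map (fun r : ℝ => c + κ * r) volume = ENNReal.ofReal |κ⁻¹| • volume := by
  have h1 : (fun r : ℝ => c + κ * r) = (fun s => c + s) ∘ fun r => κ * r := rfl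
  rw [h1, ← Measure.map_map (by fun_prop) (by fun_prop), Real.map_volume_mul_left hκ,
    Measure.map_smul, (measurePreserving_add_left volume c).map_eq]

lemma ae_affine {P : ℝ → Prop} (h : ∀ᵐ y : ℝ, P y) (c : ℝ) {κ : ℝ} (hκ : κ ≠ 0) :
    ∀ᵐ r : ℝ, P (c + κ * r) := by
  have h1 : Measure.QuasiMeasurePreserving (fun r : ℝ => c + κ * r) volume volume :=
    ⟨by fun_prop, by rw [map_affine_volume c hκ]; exact Measure.smul_absolutelyContinuous⟩
  exact h1.ae h

lemma lintegral_affine {g : ℝ → ENNReal} (hg : Measurable g) (c : ℝ) {κ : ℝ} (hκ : κ ≠ 0) :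
    ∫⁻ r, g (c + κ * r) = ENNReal.ofReal |κ⁻¹| * ∫⁻ y, g y := by
  rw [← lintegral_map hg (by fun_prop : Measurable fun r : ℝ => c + κ * r),
    map_affine_volume c hκ, lintegral_smul_measure, smul_eq_mul]

lemma lintegral_complex_im {F : ℂ → ENNReal} (hF : Measurable F) :
    ∫⁻ z, F z = ∫⁻ y : ℝ, ∫⁻ x : ℝ, F ⟨x, y⟩ := by
  rw [← Complex.volume_preserving_equiv_real_prod.symm.lintegral_comp hF, Measure.volume_eq_prod,
    lintegral_prod_symm' (fun w => F (Complex.measurableEquivRealProd.symm w))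
      (hF.comp Complex.measurableEquivRealProd.symm.measurable)]
  rfl

lemma lintegral_complex_re {F : ℂ → ENNReal} (hF : Measurable F) :
    ∫⁻ z, F z = ∫⁻ x : ℝ, ∫⁻ y : ℝ, F ⟨x, y⟩ := by
  rw [← Complex.volume_preserving_equiv_real_prod.symm.lintegral_comp hF, Measure.volume_eq_prod,
    lintegral_prod (fun w => F (Complex.measurableEquivRealProd.symm w))
      (hF.comp Complex.measurableEquivRealProd.symm.measurable).aemeasurable]
  rfl

lemma measurable_mk_complex : Measurable fun w : ℝ × ℝ => (⟨w.1, w.2⟩ : ℂ) :=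
  Complex.measurableEquivRealProd.symm.measurable

lemma measurable_lintegral_Ioo {G : ℝ → ℝ → ENNReal} (hG : Measurable (Function.uncurry G))
    {b c : ℝ → ℝ} (hb : Continuous b) (hc : Continuous c) :
    Measurable fun r => ∫⁻ x in Ioo (b r) (c r), G r x := by
  have h1 : MeasurableSet {w : ℝ × ℝ | w.2 ∈ Ioo (b w.1) (c w.1)} := by
    refine IsOpen.measurableSet ?_
    exact (isOpen_lt (hb.comp continuous_fst) continuous_snd).inter
      (isOpen_lt continuous_snd (hc.comp continuous_fst))
  have h2 := (hG.indicator h1).lintegral_prod_right' (ν := volume)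
  convert! h2 using 2 with r
  rw [← lintegral_indicator measurableSet_Ioo]
  refine lintegral_congr fun x => ?_
  simp only [indicator, mem_ofPred_eq, Function.uncurry]

lemma measurable_crosscutEnergy {D₁ D₂ : ℂ → ℂ} (hD₁ : Measurable D₁) (hD₂ : Measurable D₂)
    {U : Set ℂ} (hU : MeasurableSet U) (a : ℂ) : Measurable (crosscutEnergy D₁ D₂ U a) := by
  have h1 : Measurable (U.indicator fun z => ‖D₁ z‖ₑ ^ 2) := (hD₁.enorm.pow_const 2).indicator hU
  have h2 : Measurable (U.indicator fun z => ‖D₂ z‖ₑ ^ 2) := (hD₂.enorm.pow_const 2).indicator hU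
  refine ((measurable_lintegral_Ioo (G := fun r x => U.indicator (fun z => ‖D₁ z‖ₑ ^ 2)
      ⟨x, a.im - r⟩) (h1.comp (measurable_mk_complex.comp
        (by fun_prop : Measurable fun w : ℝ × ℝ => (w.2, a.im - w.1)))) ?_ ?_).add
    (measurable_lintegral_Ioo (G := fun r y => U.indicator (fun z => ‖D₂ z‖ₑ ^ 2)
      ⟨a.re - 11 / 10 * r, y⟩) (h2.comp (measurable_mk_complex.comp
        (by fun_prop : Measurable fun w : ℝ × ℝ => (a.re - 11 / 10 * w.1, w.2)))) ?_ ?_)).add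
    (measurable_lintegral_Ioo (G := fun r x => U.indicator (fun z => ‖D₁ z‖ₑ ^ 2)
      ⟨x, a.im + r⟩) (h1.comp (measurable_mk_complex.comp
        (by fun_prop : Measurable fun w : ℝ × ℝ => (w.2, a.im + w.1)))) ?_ ?_)
  all_goals fun_prop

/-- The crosscuts of size less than `t` sweep out disjoint sets in `openRect a t`. -/
lemma lintegral_crosscutEnergy_le {D₁ D₂ : ℂ → ℂ} (hD₁ : Measurable D₁) (hD₂ : Measurable D₂)
    {U : Set ℂ} (hU : MeasurableSet U) (a : ℂ) (t : ℝ) :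
    ∫⁻ r in Ioo 0 t, crosscutEnergy D₁ D₂ U a r ≤
      ∫⁻ z in U ∩ openRect a t, (‖D₁ z‖ₑ ^ 2 + ‖D₂ z‖ₑ ^ 2) := by
  have hR : MeasurableSet (openRect a t) := (isOpen_openRect a t).measurableSet
  set h₁ : ℂ → ENNReal := (U ∩ openRect a t).indicator fun z => ‖D₁ z‖ₑ ^ 2 with hh₁
  set h₂ : ℂ → ENNReal := (U ∩ openRect a t).indicator fun z => ‖D₂ z‖ₑ ^ 2 with hh₂
  have m₁ : Measurable h₁ := (hD₁.enorm.pow_const 2).indicator (hU.inter hR)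
  have m₂ : Measurable h₂ := (hD₂.enorm.pow_const 2).indicator (hU.inter hR)
  set H₁ : ℝ → ENNReal := fun y => ∫⁻ x, h₁ ⟨x, y⟩ with hH₁
  set H₂ : ℝ → ENNReal := fun x => ∫⁻ y, h₂ ⟨x, y⟩ with hH₂
  have M₁ : Measurable H₁ := Measurable.lintegral_prod_right'
    (f := fun w : ℝ × ℝ => h₁ ⟨w.2, w.1⟩) (m₁.comp (measurable_mk_complex.comp measurable_swap))
  have M₂ : Measurable H₂ := Measurable.lintegral_prod_right'
    (f := fun w : ℝ × ℝ => h₂ ⟨w.1, w.2⟩) (m₂.comp measurable_mk_complex)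
  have ind : ∀ (D : ℂ → ℂ) (z : ℂ), z ∈ openRect a t →
      U.indicator (fun z => ‖D z‖ₑ ^ 2) z =
        (U ∩ openRect a t).indicator (fun z => ‖D z‖ₑ ^ 2) z := by
    intro D z hz
    by_cases hzU : z ∈ U <;> simp [indicator, hz, hzU]
  have hpt : ∀ r ∈ Ioo 0 t, crosscutEnergy D₁ D₂ U a r ≤
      H₁ (a.im - r) + H₂ (a.re - 11 / 10 * r) + H₁ (a.im + r) := by
    rintro r ⟨hr0, hrt⟩
    refine add_le_add (add_le_add ?_ ?_) ?_
    · refine (setLIntegral_mono' measurableSet_Ioo fun x hx => ?_).trans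
        (setLIntegral_le_lintegral _ _)
      rw [ind]
      exact ⟨⟨by simp; linarith [hx.1], by simp; linarith [hx.2]⟩, ⟨by simp; linarith,
        by simp; linarith⟩⟩
    · refine (setLIntegral_mono' measurableSet_Ioo fun x hx => ?_).trans
        (setLIntegral_le_lintegral _ _)
      rw [ind]
      exact ⟨⟨by simp; linarith, by simp; linarith⟩, ⟨by simp; linarith [hx.1],
        by simp; linarith [hx.2]⟩⟩
    · refine (setLIntegral_mono' measurableSet_Ioo fun x hx => ?_).trans
        (setLIntegral_le_lintegral _ _)
      rw [ind]
      exact ⟨⟨by simp; linarith [hx.1], by simp; linarith [hx.2]⟩, ⟨by simp; linarith,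
        by simp; linarith⟩⟩
  have e1 : ∫⁻ r in Ioo 0 t, H₁ (a.im - r) ≤ ∫⁻ s in Iio 0, H₁ (a.im + s) := by
    refine (lintegral_mono_set Ioo_subset_Ioi_self).trans (le_of_eq ?_)
    have := (Measure.measurePreserving_neg (volume : Measure ℝ)).setLIntegral_comp_preimage_emb
      (MeasurableEquiv.neg ℝ).measurableEmbedding (fun s => H₁ (a.im + s)) (Iio 0)
    rw [← this]
    simp [sub_eq_add_neg]
  have e2 : ∫⁻ r in Ioo 0 t, H₁ (a.im + r) ≤ ∫⁻ s in Ioi 0, H₁ (a.im + s) :=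
    lintegral_mono_set Ioo_subset_Ioi_self
  have e3 : (∫⁻ s in Iio 0, H₁ (a.im + s)) + (∫⁻ s in Ioi 0, H₁ (a.im + s)) ≤ ∫⁻ y, H₁ y := by
    rw [← lintegral_union measurableSet_Ioi
      (Set.disjoint_left.2 fun x hx hx' => lt_asymm (mem_Iio.1 hx) (mem_Ioi.1 hx'))]
    refine (setLIntegral_le_lintegral _ _).trans (le_of_eq ?_)
    exact lintegral_add_left_eq_self H₁ a.im
  have e4 : ∫⁻ r in Ioo 0 t, H₂ (a.re - 11 / 10 * r) ≤ ∫⁻ x, H₂ x := by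
    refine (setLIntegral_le_lintegral _ _).trans ?_
    have := lintegral_affine M₂ a.re (show (-(11 / 10) : ℝ) ≠ 0 by norm_num)
    simp only [neg_mul, ← sub_eq_add_neg] at this
    rw [this]
    refine mul_le_of_le_one_left' ?_
    rw [ENNReal.ofReal_le_one, abs_le]
    norm_num
  calc ∫⁻ r in Ioo 0 t, crosscutEnergy D₁ D₂ U a r
      ≤ ∫⁻ r in Ioo 0 t, (H₁ (a.im - r) + H₂ (a.re - 11 / 10 * r) + H₁ (a.im + r)) :=
        setLIntegral_mono' measurableSet_Ioo hpt
    _ = (∫⁻ r in Ioo 0 t, H₁ (a.im - r)) + (∫⁻ r in Ioo 0 t, H₂ (a.re - 11 / 10 * r)) +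
          (∫⁻ r in Ioo 0 t, H₁ (a.im + r)) := by
        have n1 : Measurable fun r : ℝ => H₁ (a.im - r) := M₁.comp (by fun_prop)
        have n2 : Measurable fun r : ℝ => H₁ (a.im + r) := M₁.comp (by fun_prop)
        rw [lintegral_add_right _ n2, lintegral_add_left n1]
    _ ≤ (∫⁻ y, H₁ y) + (∫⁻ x, H₂ x) := by
        rw [add_right_comm]
        exact add_le_add ((add_le_add e1 e2).trans e3) e4
    _ = ∫⁻ z in U ∩ openRect a t, (‖D₁ z‖ₑ ^ 2 + ‖D₂ z‖ₑ ^ 2) := by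
        rw [← lintegral_complex_im m₁, ← lintegral_complex_re m₂, ← lintegral_add_left m₁,
          ← lintegral_indicator (hU.inter hR)]
        refine lintegral_congr fun z => ?_
        by_cases hz : z ∈ U ∩ openRect a t <;> simp [hh₁, hh₂, indicator, hz]

/-! ### A differential inequality -/

/-- If `Φ t = ∫₀ᵗ φ` satisfies `Φ ≤ μ⁻¹ t Φ' + C t²`, then `Φ` is at most a multiple
of `t ^ μ`. -/
lemma integral_le_rpow_of_le {φ : ℝ → ℝ} {T μ C : ℝ} (hT0 : 0 < T) (hT1 : T ≤ 1) (hμ0 : 0 < μ)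
    (hμ1 : μ ≤ 1) (hC : 0 ≤ C) (hφ : IntervalIntegrable φ volume 0 T)
    (h : ∀ᵐ t : ℝ, t ∈ Ioo 0 T → ∫ x in (0 : ℝ)..t, φ x ≤ μ⁻¹ * t * φ t + C * t ^ 2)
    {s : ℝ} (hs0 : 0 < s) (hsT : s ≤ T) :
    ∫ x in (0 : ℝ)..s, φ x ≤ (T ^ (-μ) * (∫ x in (0 : ℝ)..T, φ x) + C) * s ^ μ := by
  set Φ : ℝ → ℝ := fun t => ∫ x in (0 : ℝ)..t, φ x with hΦ
  have hΦac : AbsolutelyContinuousOnInterval Φ s T :=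
    (hφ.absolutelyContinuousOnInterval_intervalIntegral (c := 0) left_mem_uIcc).mono (by
      rw [uIcc_of_le hsT, uIcc_of_le hT0.le]; exact Icc_subset_Icc_left hs0.le)
  have hpac : AbsolutelyContinuousOnInterval (fun t : ℝ => t ^ (-μ)) s T := by
    refine ContDiffOn.absolutelyContinuousOnInterval ?_
    refine contDiffOn_id.rpow_const_of_ne fun x hx => ?_
    rw [uIcc_of_le hsT] at hx
    exact (hs0.trans_le hx.1).ne'
  have hG := hpac.fun_mul hΦac
  have hder : ∀ᵐ t : ℝ, t ∈ Ioo s T → -C ≤ deriv (fun t : ℝ => t ^ (-μ) * Φ t) t := by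
    filter_upwards [hφ.ae_hasDerivAt_integral, h] with t ht1 ht2 ht
    have ht0 : 0 < t := hs0.trans ht.1
    have h1 : HasDerivAt Φ (φ t) t :=
      ht1 (by rw [uIcc_of_le hT0.le]; exact ⟨ht0.le, ht.2.le⟩) 0 left_mem_uIcc
    have h2 : HasDerivAt (fun t : ℝ => t ^ (-μ)) (-μ * t ^ (-μ - 1)) t :=
      Real.hasDerivAt_rpow_const (Or.inl ht0.ne')
    rw [show deriv (fun t : ℝ => t ^ (-μ) * Φ t) t = -μ * t ^ (-μ - 1) * Φ t + t ^ (-μ) * φ t from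
      (h2.mul h1).deriv]
    have h3 := ht2 ⟨ht0, ht.2⟩
    change Φ t ≤ _ at h3
    have h4 : t ^ (-μ - 1) = t ^ (-μ) / t := by rw [Real.rpow_sub ht0, Real.rpow_one]
    rw [h4]
    have h5 : μ * Φ t ≤ t * φ t + μ * C * t ^ 2 := by
      calc μ * Φ t ≤ μ * (μ⁻¹ * t * φ t + C * t ^ 2) := by gcongr
        _ = _ := by field_simp
    have h6 : t ^ (-μ) * t ≤ 1 := by
      rw [← Real.rpow_add_one ht0.ne']
      exact Real.rpow_le_one ht0.le (ht.2.le.trans hT1) (by linarith)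
    have h7 : 0 < t ^ (-μ) := Real.rpow_pos_of_pos ht0 _
    have h8 : -μ * (t ^ (-μ) / t) * Φ t + t ^ (-μ) * φ t =
        t ^ (-μ) / t * (t * φ t - μ * Φ t) := by field_simp; ring
    rw [h8]
    calc -C ≤ -(μ * C * (t ^ (-μ) * t)) := by
          have : μ * C * (t ^ (-μ) * t) ≤ 1 * C * 1 := by gcongr
          linarith
      _ = t ^ (-μ) / t * (-(μ * C * t ^ 2)) := by field_simp
      _ ≤ _ := by gcongr; linarith
  have hint : -C * (T - s) ≤ T ^ (-μ) * Φ T - s ^ (-μ) * Φ s := by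
    rw [← hG.integral_deriv_eq_sub]
    calc -C * (T - s) = ∫ _ in s..T, -C := by
          rw [intervalIntegral.integral_const, smul_eq_mul]; ring
      _ ≤ _ := by
          refine intervalIntegral.integral_mono_ae_restrict hsT intervalIntegrable_const
            hG.intervalIntegrable_deriv ?_
          rw [Filter.EventuallyLE, ← restrict_Ioo_eq_restrict_Icc,
            ae_restrict_iff' measurableSet_Ioo]
          exact hder
  have hsμ : 0 < s ^ μ := Real.rpow_pos_of_pos hs0 _
  have h9 : s ^ (-μ) * Φ s ≤ T ^ (-μ) * Φ T + C := by nlinarith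
  calc Φ s = s ^ (-μ) * Φ s * s ^ μ := by
        rw [Real.rpow_neg hs0.le]; field_simp
    _ ≤ (T ^ (-μ) * Φ T + C) * s ^ μ := by gcongr

/-! ### The length–area estimate -/

lemma volume_reProdIm {s t : Set ℝ} (hs : MeasurableSet s) (ht : MeasurableSet t) :
    volume (s ×ℂ t) = volume s * volume t := by
  rw [← Measure.prod_prod, ← Measure.volume_eq_prod,
    ← Complex.volume_preserving_equiv_real_prod.measure_preimage (hs.prod ht).nullMeasurableSet]
  rfl

lemma volume_rect {x₁ x₂ y₁ y₂ : ℝ} (hx : x₁ ≤ x₂) :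
    volume (Icc x₁ x₂ ×ℂ Icc y₁ y₂) = ENNReal.ofReal ((x₂ - x₁) * (y₂ - y₁)) := by
  rw [volume_reProdIm measurableSet_Icc measurableSet_Icc, Real.volume_Icc, Real.volume_Icc,
    ENNReal.ofReal_mul (by linarith)]

lemma volume_openRect_le (a : ℂ) {r : ℝ} (hr : 0 < r) :
    volume (openRect a r) ≤ ENNReal.ofReal (7 * r ^ 2) := by
  refine (measure_mono (openRect_subset_closedRect a r)).trans ?_
  rw [closedRect, volume_rect (by linarith)]
  exact ENNReal.ofReal_le_ofReal (by nlinarith)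

lemma norm_sub_le_of_mem_closedRect {a z : ℂ} {r : ℝ} (hr : 0 ≤ r) (hz : z ∈ closedRect a r) :
    ‖z - a‖ ≤ 3 * r := by
  have h := Complex.norm_le_abs_re_add_abs_im (z - a)
  rw [Complex.sub_re, Complex.sub_im] at h
  obtain ⟨⟨h1, h2⟩, h3, h4⟩ := hz
  have h5 : |z.re - a.re| ≤ 2 * r := by rw [abs_le]; constructor <;> linarith
  have h6 : |z.im - a.im| ≤ r := by rw [abs_le]; constructor <;> linarith
  linarith

lemma IsLocalGraph.notMem {U : Set ℂ} {a : ℂ} {φ : ℝ → ℝ} {r₀ : ℝ} (h : IsLocalGraph U a φ r₀)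
    (hr₀ : 0 ≤ r₀) : a ∉ U := by
  have h1 := h.abs_sub_le 0 (by simpa using hr₀)
  simp only [add_zero, abs_zero, mul_zero] at h1
  have h2 : φ a.im = a.re := sub_eq_zero.1 (abs_nonpos_iff.1 h1)
  have h3 := h.mem_iff a.re a.im (by simpa using hr₀) (by linarith) (by linarith)
  exact fun hU => by
    have := h3.1 hU
    linarith

/-- The image of the part of `U` near a boundary point has small area, uniformly in the point. -/
lemma exists_volume_image_le {Ω U : Set ℂ} {f : ℂ → ℂ} (hf : IsHomeoOnto f U Ω) (hU : IsOpen U)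
    (hΩ : IsOpen Ω) (hfin : volume Ω ≠ ⊤) {ε : ENNReal} (hε : 0 < ε) :
    ∃ r₁ : ℝ, 0 < r₁ ∧ ∀ a ∉ U, ∀ r : ℝ, 0 < r → r ≤ r₁ →
      volume (f '' (U ∩ openRect a r)) ≤ ε := by
  set N : ℕ → Set ℂ := fun n => U ∩ Metric.thickening (1 / ((n : ℝ) + 1)) Uᶜ with hN
  have hanti : Antitone fun n => f '' N n := by
    intro m n hmn
    refine image_mono (inter_subset_inter_right _ (Metric.thickening_mono ?_ _))
    gcongr
  have hopen : ∀ n, IsOpen (f '' N n) := fun n =>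
    hf.isOpen_image hΩ inter_subset_left (hU.inter Metric.isOpen_thickening)
  have hempty : ⋂ n, f '' N n = ∅ := by
    rw [eq_empty_iff_forall_notMem]
    intro w hw
    rw [mem_iInter] at hw
    obtain ⟨z, hz, rfl⟩ := hw 0
    obtain ⟨ρ, hρ, hb⟩ := Metric.isOpen_iff.1 hU z hz.1
    obtain ⟨n, hn⟩ := exists_nat_one_div_lt hρ
    obtain ⟨z', hz', e⟩ := hw n
    have : z' = z := hf.injOn hz'.1 hz.1 e
    rw [this] at hz'
    obtain ⟨u, hu, hd⟩ := Metric.mem_thickening_iff.1 hz'.2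
    refine hu (hb ?_)
    rw [Metric.mem_ball, dist_comm]
    exact hd.trans hn
  have hlim := tendsto_measure_iInter_atTop (μ := volume)
    (fun n => (hopen n).measurableSet.nullMeasurableSet) hanti
    ⟨0, ne_top_of_le_ne_top hfin (measure_mono (by
      rw [← hf.image_eq]; exact image_mono inter_subset_left))⟩
  rw [hempty, measure_empty] at hlim
  obtain ⟨n, hn⟩ := (hlim.eventually (gt_mem_nhds hε)).exists
  refine ⟨1 / ((n : ℝ) + 1) / 4, by positivity, fun a ha r hr hrr => ?_⟩
  refine (measure_mono (image_mono ?_)).trans hn.le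
  rintro z ⟨hzU, hz⟩
  refine ⟨hzU, Metric.mem_thickening_iff.2 ⟨a, ha, ?_⟩⟩
  rw [dist_eq_norm]
  have := norm_sub_le_of_mem_closedRect hr.le (openRect_subset_closedRect a r hz)
  have h4 : (0 : ℝ) < 1 / ((n : ℝ) + 1) := by positivity
  linarith

/-- At a good radius of finite energy, the energy controls a length `l`, the square of this length
controls the area of the image of the small side of the crosscut (isoperimetric inequality with
constant `1 / 8`, the boundary having length at most `(1 + B) l`), and if `l` is small then
it also controls the diameter of that image. -/
lemma exists_length_of_goodRadius {Ω E U : Set ℂ} {B η : ℝ} (hB : 0 ≤ B)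
    (hΩ : IsCurveDomain Ω E B η) {f D₁ D₂ : ℂ → ℂ} (hf : IsHomeoOnto f U Ω) (hU : IsOpen U)
    (hUc : IsPreconnected U) (hD₁ : Measurable D₁) (hD₂ : Measurable D₂)
    {a : ℂ} {φ : ℝ → ℝ} {r₀ r : ℝ} (h : IsLocalGraph U a φ r₀) (hr : 0 < r) (hrr : r ≤ r₀)
    (hh : ∀ s : ℝ, s = r ∨ s = -r → ∀ b c : ℝ, b ≤ c →
      (∀ x ∈ Icc b c, (⟨x, a.im + s⟩ : ℂ) ∈ U) →
      ∫ x in b..c, D₁ ⟨x, a.im + s⟩ = f ⟨c, a.im + s⟩ - f ⟨b, a.im + s⟩)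
    (hv : ∀ b c : ℝ, b ≤ c → (∀ y ∈ Icc b c, (⟨a.re - 11 / 10 * r, y⟩ : ℂ) ∈ U) →
      ∫ y in b..c, D₂ ⟨a.re - 11 / 10 * r, y⟩ =
        f ⟨a.re - 11 / 10 * r, c⟩ - f ⟨a.re - 11 / 10 * r, b⟩)
    (hfin : crosscutEnergy D₁ D₂ U a r ≠ ⊤) {η' : ℝ} (hη' : 0 < η') (hη : η' ≤ η) {z₁ z₂ : ℂ}
    (hz₁ : z₁ ∈ U) (hz₂ : z₂ ∈ U) (hz₁r : z₁ ∉ closedRect a r) (hz₂r : z₂ ∉ closedRect a r)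
    (hfar : (1 + B) * η' ≤ ‖f z₁ - f z₂‖)
    (hsmall : volume (f '' (U ∩ openRect a r)) ≤ ENNReal.ofReal ((1 + B) ^ 2 / 8 * η' ^ 2)) :
    ∃ l : ℝ, 0 ≤ l ∧
      ENNReal.ofReal (l ^ 2) ≤ ENNReal.ofReal (43 / 10 * r) * crosscutEnergy D₁ D₂ U a r ∧
      volume (f '' (U ∩ openRect a r)) ≤ ENNReal.ofReal ((1 + B) ^ 2 / 8 * l ^ 2) ∧
      (l < η' → ∀ z ∈ U ∩ openRect a r, ∀ w ∈ U ∩ openRect a r, ‖f z - f w‖ ≤ (1 + B) * l) := by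
  obtain ⟨p, hp, q, hq, l, hl0, harc, hl⟩ :=
    exists_arc_of_crosscut hΩ hf hD₁ hD₂ h hr hrr hh hv hfin
  refine ⟨l, hl0, hl, ?_⟩
  by_cases hlη : l < η'
  · obtain ⟨x₁, x₂, y₁, y₂, hx, hy, hsub, hper⟩ := image_subset_rect hB hΩ hf hU hUc hp hq
      (hlη.trans_le hη) harc hz₁ hz₂ hz₁r hz₂r
      (lt_of_lt_of_le (by gcongr) hfar)
    have hs2 : √2 * √2 = 2 := Real.mul_self_sqrt (by norm_num)
    have hs0 : 0 ≤ √2 := Real.sqrt_nonneg 2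
    have hs2' : √2 ≤ 2 := by nlinarith
    have hP : 0 ≤ (1 + B) * l := by positivity
    constructor
    · refine (measure_mono hsub).trans ?_
      rw [volume_rect hx]
      refine ENNReal.ofReal_le_ofReal ?_
      have h1 : (2 * ((x₂ - x₁) + (y₂ - y₁))) ^ 2 ≤ (√2 * ((1 + B) * l)) ^ 2 :=
        pow_le_pow_left₀ (by linarith) hper 2
      have h2 : (√2 * ((1 + B) * l)) ^ 2 = 2 * ((1 + B) ^ 2 * l ^ 2) := by
        rw [mul_pow, sq √2, hs2]; ring
      nlinarith [sq_nonneg ((x₂ - x₁) - (y₂ - y₁))]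
    · rintro - z hz w hw
      have h1 := hsub ⟨z, hz, rfl⟩
      have h2 := hsub ⟨w, hw, rfl⟩
      rw [Complex.mem_reProdIm, mem_Icc, mem_Icc] at h1 h2
      have h3 := Complex.norm_le_abs_re_add_abs_im (f z - f w)
      rw [Complex.sub_re, Complex.sub_im] at h3
      have h4 : |(f z).re - (f w).re| ≤ x₂ - x₁ := by rw [abs_le]; constructor <;> linarith
      have h5 : |(f z).im - (f w).im| ≤ y₂ - y₁ := by rw [abs_le]; constructor <;> linarith
      nlinarith
  · refine ⟨hsmall.trans (ENNReal.ofReal_le_ofReal ?_), fun h => absurd h hlη⟩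
    have := not_lt.1 hlη
    gcongr

/-- The numerical inequality which makes the exponent `1 / (K (1 + 2 B) ^ 2)` admissible. The three
sides of a crosscut of size `r` have total length at most `2 * (11 / 10) * r + r / 10 + 2 * r`, which
is `43 / 10 * r`. -/
lemma numeric_bound {B : ℝ} (hB : 1 ≤ B) :
    43 / 10 * (1 + B) ^ 2 ≤ 2 * (1 + 2 * B) ^ 2 := by nlinarith

/-- Hölder estimate for the oscillation of `f` near boundary points at which `U` is a local
graph. -/
theorem exists_holder_of_isLocalGraph {Ω E U : Set ℂ} {B η K K' : ℝ} (hB : 1 ≤ B) (hη : 0 < η)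
    (hK : 1 ≤ K) (hK' : 0 ≤ K') (hΩ : IsCurveDomain Ω E B η) {f D₁ D₂ : ℂ → ℂ}
    (hf : IsHomeoOnto f U Ω) (hU : IsOpen U) (hUc : IsPreconnected U) (hUfin : volume U ≠ ⊤)
    (hG : GradData f D₁ D₂ U K K') {z₁ z₂ : ℂ} (hz₁ : z₁ ∈ U) (hz₂ : z₂ ∈ U) (hz : z₁ ≠ z₂)
    {r₀ : ℝ} (hr₀ : 0 < r₀) :
    ∃ A δ₀ : ℝ, 0 < A ∧ 0 < δ₀ ∧ ∀ (a : ℂ) (φ : ℝ → ℝ), IsLocalGraph U a φ r₀ →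
      ∀ δ : ℝ, 0 < δ → δ < δ₀ → ∀ z ∈ U ∩ openRect a δ, ∀ w ∈ U ∩ openRect a δ,
        ‖f z - f w‖ ≤ A * δ ^ (1 / (K * (1 + 2 * B) ^ 2)) := by
  set β : ℝ := 1 / (K * (1 + 2 * B) ^ 2) with hβ
  have hden : 9 ≤ K * (1 + 2 * B) ^ 2 := by
    have : 9 ≤ (1 + 2 * B) ^ 2 := by nlinarith
    nlinarith
  have hβ0 : 0 < β := by positivity
  have hβ1 : β ≤ 1 / 9 := by
    rw [hβ]; exact one_div_le_one_div_of_le (by norm_num) hden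
  set μ : ℝ := 2 * β with hμ
  have hμinv : μ⁻¹ = K * (1 + 2 * B) ^ 2 / 2 := by rw [hμ, hβ]; field_simp
  have hΩfin : volume Ω ≠ ⊤ := hΩ.isBounded.measure_lt_top.ne
  have hQ : ∫⁻ z in U, (‖D₁ z‖ₑ ^ 2 + ‖D₂ z‖ₑ ^ 2) ≠ ⊤ := by
    refine ne_top_of_le_ne_top ?_ (hG.area U Subset.rfl hU.measurableSet)
    rw [hf.image_eq]
    exact ENNReal.add_ne_top.2 ⟨ENNReal.mul_ne_top ENNReal.ofReal_ne_top hΩfin,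
      ENNReal.mul_ne_top ENNReal.ofReal_ne_top hUfin⟩
  set Q : ℝ := (∫⁻ z in U, (‖D₁ z‖ₑ ^ 2 + ‖D₂ z‖ₑ ^ 2)).toReal with hQdef
  have hfz : 0 < ‖f z₁ - f z₂‖ := norm_pos_iff.2 (sub_ne_zero.2 fun e => hz (hf.injOn hz₁ hz₂ e))
  set η' : ℝ := min η (‖f z₁ - f z₂‖ / (1 + B)) with hη'
  have hη'0 : 0 < η' := lt_min hη (by positivity)
  have hfar : (1 + B) * η' ≤ ‖f z₁ - f z₂‖ := by
    rw [mul_comm, ← le_div_iff₀ (by positivity)]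
    exact min_le_right _ _
  obtain ⟨r₁, hr₁, hsmall⟩ := exists_volume_image_le hf hU hΩ.isOpen hΩfin
    (ε := ENNReal.ofReal ((1 + B) ^ 2 / 8 * η' ^ 2)) (ENNReal.ofReal_pos.2 (by positivity))
  obtain ⟨ε₁, hε₁, hb₁⟩ := Metric.isOpen_iff.1 hU z₁ hz₁
  obtain ⟨ε₂, hε₂, hb₂⟩ := Metric.isOpen_iff.1 hU z₂ hz₂
  set T : ℝ := min (min r₀ r₁) (min (min (ε₁ / 4) (ε₂ / 4)) 1) with hT
  have hT0 : 0 < T := by positivity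
  have hTr₀ : T ≤ r₀ := (min_le_left _ _).trans (min_le_left _ _)
  have hTr₁ : T ≤ r₁ := (min_le_left _ _).trans (min_le_right _ _)
  have hTε₁ : T ≤ ε₁ / 4 := (min_le_right _ _).trans ((min_le_left _ _).trans (min_le_left _ _))
  have hTε₂ : T ≤ ε₂ / 4 := (min_le_right _ _).trans ((min_le_left _ _).trans (min_le_right _ _))
  have hT1 : T ≤ 1 := (min_le_right _ _).trans (min_le_right _ _)
  set A₁ : ℝ := T ^ (-μ) * Q + 7 * K' with hA₁
  have hA₁0 : 0 ≤ A₁ := by positivity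
  set A₂ : ℝ := √(43 / 5 * (A₁ * 2)) + 1 with hA₂
  have hA₂0 : 0 < A₂ := by positivity
  set δ₀ : ℝ := min (T / 2) ((η' / A₂) ^ (1 / β)) with hδ₀
  refine ⟨(1 + B) * A₂, δ₀, by positivity, by positivity, fun a φ h δ hδ0 hδ z hzδ w hwδ => ?_⟩
  have haU := h.notMem hr₀.le
  set ψ : ℝ → ENNReal := crosscutEnergy D₁ D₂ U a with hψ
  have hψm : Measurable ψ := measurable_crosscutEnergy hG.measurable₁ hG.measurable₂
    hU.measurableSet a
  -- At almost every radius `f` is the integral of its derivatives along the crosscut.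
  have hgood : ∀ᵐ r : ℝ, r ∈ Ioo 0 T → ψ r ≠ ⊤ → ∃ l : ℝ, 0 ≤ l ∧
      ENNReal.ofReal (l ^ 2) ≤ ENNReal.ofReal (43 / 10 * r) * ψ r ∧
      volume (f '' (U ∩ openRect a r)) ≤ ENNReal.ofReal ((1 + B) ^ 2 / 8 * l ^ 2) ∧
      (l < η' → ∀ z ∈ U ∩ openRect a r, ∀ w ∈ U ∩ openRect a r,
        ‖f z - f w‖ ≤ (1 + B) * l) := by
    filter_upwards [ae_affine hG.horizontal a.im one_ne_zero,
      ae_affine hG.horizontal a.im (neg_ne_zero.2 one_ne_zero),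
      ae_affine hG.vertical a.re (show (-(11 / 10) : ℝ) ≠ 0 by norm_num)] with r g1 g2 g3 hr hfin
    simp only [one_mul, neg_mul, ← sub_eq_add_neg] at g1 g2 g3
    have far : ∀ (z : ℂ) (ε : ℝ), T ≤ ε / 4 → Metric.ball z ε ⊆ U → z ∉ closedRect a r := by
      intro z ε hTε hb hmem
      have h1 := norm_sub_le_of_mem_closedRect hr.1.le hmem
      refine haU (hb ?_)
      rw [Metric.mem_ball, dist_comm, dist_eq_norm]
      linarith [hr.1, hr.2]
    refine exists_length_of_goodRadius (by linarith) hΩ hf hU hUc hG.measurable₁ hG.measurable₂ h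
      hr.1 (hr.2.le.trans hTr₀) ?_ (fun b c hbc hseg => (g3 b c hbc hseg).2) hfin hη'0
      (min_le_left _ _) hz₁ hz₂ (far z₁ ε₁ hTε₁ hb₁) (far z₂ ε₂ hTε₂ hb₂) hfar
      (hsmall a haU r hr.1 (hr.2.le.trans hTr₁))
    rintro s (rfl | rfl) b c hbc hseg
    · exact (g1 b c hbc hseg).2
    · rw [← sub_eq_add_neg] at hseg ⊢
      exact (g2 b c hbc hseg).2
  have hΨle : ∀ t : ℝ, ∫⁻ r in Ioo 0 t, ψ r ≤
      ∫⁻ z in U ∩ openRect a t, (‖D₁ z‖ₑ ^ 2 + ‖D₂ z‖ₑ ^ 2) := fun t =>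
    lintegral_crosscutEnergy_le hG.measurable₁ hG.measurable₂ hU.measurableSet a t
  have hΨQ : ∀ t : ℝ, ∫⁻ r in Ioo 0 t, ψ r ≤ ∫⁻ z in U, (‖D₁ z‖ₑ ^ 2 + ‖D₂ z‖ₑ ^ 2) := fun t =>
    (hΨle t).trans (lintegral_mono_set inter_subset_left)
  have hΨfin : ∀ t : ℝ, ∫⁻ r in Ioo 0 t, ψ r ≠ ⊤ := fun t => ne_top_of_le_ne_top hQ (hΨQ t)
  have hψtop : ∀ᵐ r : ℝ, r ∈ Ioo 0 T → ψ r ≠ ⊤ := by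
    have := ae_lt_top hψm (hΨfin T)
    rw [ae_restrict_iff' measurableSet_Ioo] at this
    filter_upwards [this] with r hr hrT using (hr hrT).ne
  have hint : ∀ t : ℝ, IntegrableOn (fun r => (ψ r).toReal) (Ioo 0 t) := fun t =>
    integrable_toReal_of_lintegral_ne_top hψm.aemeasurable (hΨfin t)
  have hΦ : ∀ t : ℝ, 0 ≤ t → t ≤ T →
      ∫ r in (0 : ℝ)..t, (ψ r).toReal = (∫⁻ r in Ioo 0 t, ψ r).toReal := by
    intro t ht htT
    rw [intervalIntegral.integral_of_le ht, integral_Ioc_eq_integral_Ioo,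
      integral_toReal hψm.aemeasurable]
    exact ae_lt_top hψm (hΨfin t)
  have hdiff : ∀ᵐ t : ℝ, t ∈ Ioo 0 T → ∫ r in (0 : ℝ)..t, (ψ r).toReal ≤
      μ⁻¹ * t * (ψ t).toReal + 7 * K' * t ^ 2 := by
    filter_upwards [hgood, hψtop] with t ht htop htT
    obtain ⟨l, hl0, hl, hvol, -⟩ := ht htT (htop htT)
    have ht0 := htT.1
    rw [hΦ t ht0.le htT.2.le]
    refine ENNReal.toReal_le_of_le_ofReal (by positivity) ?_
    have hl' : l ^ 2 ≤ 43 / 10 * t * (ψ t).toReal := by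
      rw [← ENNReal.ofReal_toReal (htop htT), ← ENNReal.ofReal_mul (by positivity)] at hl
      exact (ENNReal.ofReal_le_ofReal_iff (by positivity)).1 hl
    calc ∫⁻ r in Ioo 0 t, ψ r
        ≤ ENNReal.ofReal (2 * K) * volume (f '' (U ∩ openRect a t)) +
            ENNReal.ofReal K' * volume (U ∩ openRect a t) :=
          (hΨle t).trans (hG.area _ inter_subset_left
            (hU.inter (isOpen_openRect a t)).measurableSet)
      _ ≤ ENNReal.ofReal (2 * K) * ENNReal.ofReal ((1 + B) ^ 2 / 8 * l ^ 2) +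
            ENNReal.ofReal K' * ENNReal.ofReal (7 * t ^ 2) := by
          gcongr
          exact (measure_mono inter_subset_right).trans (volume_openRect_le a ht0)
      _ = ENNReal.ofReal (2 * K * ((1 + B) ^ 2 / 8 * l ^ 2) + K' * (7 * t ^ 2)) := by
          rw [← ENNReal.ofReal_mul (by positivity), ← ENNReal.ofReal_mul hK',
            ← ENNReal.ofReal_add (by positivity) (by positivity)]
      _ ≤ _ := by
          refine ENNReal.ofReal_le_ofReal ?_
          have h1 : 2 * K * ((1 + B) ^ 2 / 8 * l ^ 2) ≤
              2 * K * ((1 + B) ^ 2 / 8 * (43 / 10 * t * (ψ t).toReal)) := by gcongr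
          have h2 : 2 * K * ((1 + B) ^ 2 / 8 * (43 / 10 * t * (ψ t).toReal)) =
              K / 4 * (43 / 10 * (1 + B) ^ 2) * (t * (ψ t).toReal) := by ring
          have h3 : K / 4 * (43 / 10 * (1 + B) ^ 2) * (t * (ψ t).toReal) ≤
              K / 4 * (2 * (1 + 2 * B) ^ 2) * (t * (ψ t).toReal) := by
            have := numeric_bound hB
            gcongr
          rw [hμinv]
          linarith
  have hgrowth : ∀ s : ℝ, 0 < s → s ≤ T → ∫ r in (0 : ℝ)..s, (ψ r).toReal ≤ A₁ * s ^ μ := by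
    intro s hs hsT
    refine (integral_le_rpow_of_le hT0 hT1 (by positivity) (by linarith) (by positivity)
      ((intervalIntegrable_iff_integrableOn_Ioo_of_le hT0.le).2 (hint T)) hdiff hs hsT).trans ?_
    have : ∫ r in (0 : ℝ)..T, (ψ r).toReal ≤ Q := by
      rw [hΦ T hT0.le le_rfl]
      exact ENNReal.toReal_mono hQ (hΨQ T)
    rw [hA₁]
    gcongr
  -- A good radius between `δ` and `2 δ` at which the energy is at most its average.
  have hδT : 2 * δ < T := by
    have := hδ.trans_le (min_le_left _ _); linarith
  obtain ⟨r, hrδ, hrg, hrt, hravg⟩ : ∃ r ∈ Ioo δ (2 * δ), (∃ l : ℝ, 0 ≤ l ∧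
      ENNReal.ofReal (l ^ 2) ≤ ENNReal.ofReal (43 / 10 * r) * ψ r ∧
      volume (f '' (U ∩ openRect a r)) ≤ ENNReal.ofReal ((1 + B) ^ 2 / 8 * l ^ 2) ∧
      (l < η' → ∀ z ∈ U ∩ openRect a r, ∀ w ∈ U ∩ openRect a r,
        ‖f z - f w‖ ≤ (1 + B) * l)) ∧ ψ r ≠ ⊤ ∧ δ * (ψ r).toReal ≤ A₁ * (2 * δ) ^ μ := by
    have hμ0 : volume.restrict (Ioo δ (2 * δ)) ≠ 0 := by
      rw [Ne, Measure.restrict_eq_zero, Real.volume_Ioo, ENNReal.ofReal_eq_zero]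
      linarith
    have hsub : Ioo δ (2 * δ) ⊆ Ioo 0 (2 * δ) := Ioo_subset_Ioo_left hδ0.le
    have hnull : ∀ᵐ r ∂volume.restrict (Ioo δ (2 * δ)), r ∈ Ioo δ (2 * δ) ∧
        (∃ l : ℝ, 0 ≤ l ∧
          ENNReal.ofReal (l ^ 2) ≤ ENNReal.ofReal (43 / 10 * r) * ψ r ∧
          volume (f '' (U ∩ openRect a r)) ≤ ENNReal.ofReal ((1 + B) ^ 2 / 8 * l ^ 2) ∧
          (l < η' → ∀ z ∈ U ∩ openRect a r, ∀ w ∈ U ∩ openRect a r,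
            ‖f z - f w‖ ≤ (1 + B) * l)) ∧ ψ r ≠ ⊤ := by
      rw [ae_restrict_iff' measurableSet_Ioo]
      filter_upwards [hgood, hψtop] with r h1 h2 hr
      have hrT : r ∈ Ioo 0 T := ⟨hδ0.trans hr.1, hr.2.trans hδT⟩
      exact ⟨hr, h1 hrT (h2 hrT), h2 hrT⟩
    obtain ⟨r, hrN, hr⟩ := exists_notMem_null_le_average hμ0
      ((hint (2 * δ)).mono_set hsub) (ae_iff.1 hnull)
    rw [notMem_ofPred_iff, not_not] at hrN
    refine ⟨r, hrN.1, hrN.2.1, hrN.2.2, ?_⟩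
    rw [setAverage_eq, measureReal_def, Real.volume_Ioo, show 2 * δ - δ = δ by ring,
      ENNReal.toReal_ofReal hδ0.le, smul_eq_mul, inv_mul_eq_div, le_div_iff₀ hδ0] at hr
    have h1 : ∫ r in Ioo δ (2 * δ), (ψ r).toReal ≤ ∫ r in Ioo 0 (2 * δ), (ψ r).toReal :=
      setIntegral_mono_set (hint (2 * δ))
        (Filter.Eventually.of_forall fun _ => ENNReal.toReal_nonneg) hsub.eventuallyLE
    have h2 := hgrowth (2 * δ) (by linarith) hδT.le
    rw [intervalIntegral.integral_of_le (by linarith), integral_Ioc_eq_integral_Ioo] at h2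
    linarith
  obtain ⟨l, hl0, hl, -, hdiam⟩ := hrg
  have hr0 : 0 < r := hδ0.trans hrδ.1
  have hl' : l ^ 2 ≤ 43 / 10 * r * (ψ r).toReal := by
    rw [← ENNReal.ofReal_toReal hrt, ← ENNReal.ofReal_mul (by positivity)] at hl
    exact (ENNReal.ofReal_le_ofReal_iff (by positivity)).1 hl
  have hlβ : l ≤ A₂ * δ ^ β := by
    have h2μ : (2 : ℝ) ^ μ ≤ 2 := by
      calc (2 : ℝ) ^ μ ≤ 2 ^ (1 : ℝ) := Real.rpow_le_rpow_of_exponent_le (by norm_num) (by linarith)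
        _ = 2 := Real.rpow_one 2
    have hδμ : δ ^ μ = (δ ^ β) ^ 2 := by
      rw [hμ, mul_comm, Real.rpow_mul hδ0.le, Real.rpow_ofNat]
    have h3 : l ^ 2 ≤ 43 / 5 * (A₁ * 2) * (δ ^ β) ^ 2 := by
      calc l ^ 2 ≤ 43 / 10 * r * (ψ r).toReal := hl'
        _ ≤ 43 / 10 * (2 * δ) * (ψ r).toReal := by
            have := hrδ.2.le
            gcongr
        _ = 43 / 5 * (δ * (ψ r).toReal) := by ring
        _ ≤ 43 / 5 * (A₁ * (2 * δ) ^ μ) := by gcongr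
        _ = 43 / 5 * (A₁ * 2 ^ μ) * δ ^ μ := by rw [Real.mul_rpow (by norm_num) hδ0.le]; ring
        _ ≤ 43 / 5 * (A₁ * 2) * (δ ^ β) ^ 2 := by rw [hδμ]; gcongr
    have h4 : l ^ 2 ≤ (√(43 / 5 * (A₁ * 2)) * δ ^ β) ^ 2 := by
      rw [mul_pow, Real.sq_sqrt (by positivity)]; exact h3
    have h5 := (abs_le_of_sq_le_sq' h4 (by positivity)).2
    have h6 : 0 ≤ δ ^ β := by positivity
    rw [hA₂]
    linarith [add_mul (√(43 / 5 * (A₁ * 2))) 1 (δ ^ β)]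
  have hlη : l < η' := by
    refine hlβ.trans_lt ?_
    have h1 : δ ^ β < η' / A₂ := by
      have := Real.rpow_lt_rpow hδ0.le (hδ.trans_le (min_le_right _ _)) hβ0
      rwa [← Real.rpow_mul (by positivity), one_div_mul_cancel hβ0.ne', Real.rpow_one] at this
    rwa [lt_div_iff₀' hA₂0] at h1
  have hmono : openRect a δ ⊆ openRect a r := by
    rintro z ⟨hz1, hz2⟩
    have := hrδ.1
    exact ⟨⟨by linarith [hz1.1], by linarith [hz1.2]⟩, ⟨by linarith [hz2.1], by linarith [hz2.2]⟩⟩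
  calc ‖f z - f w‖ ≤ (1 + B) * l :=
        hdiam hlη z ⟨hzδ.1, hmono hzδ.2⟩ w ⟨hwδ.1, hmono hwδ.2⟩
    _ ≤ (1 + B) * (A₂ * δ ^ β) := by gcongr
    _ = (1 + B) * A₂ * δ ^ β := by ring

/-! ### Chord-arc curves and the domain between them -/

lemma IsC1AlphaJordan.hasDerivAt {α ℓ : ℝ} {g : ℝ → ℂ} (hg : IsC1AlphaJordan α ℓ g) (s : ℝ) :
    HasDerivAt g (deriv g s) s :=
  (hg.contDiff.differentiable one_ne_zero s).hasDerivAt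

lemma IsC1AlphaJordan.isCompact_range {α ℓ : ℝ} {g : ℝ → ℂ} (hg : IsC1AlphaJordan α ℓ g) :
    IsCompact (range g) :=
  hg.periodic.compact_of_continuous hg.length_pos.ne' hg.contDiff.continuous

/-- At small scales the chord is at least half the arc. -/
lemma IsC1AlphaJordan.exists_half_le {α ℓ : ℝ} (hα : 0 < α) {g : ℝ → ℂ}
    (hg : IsC1AlphaJordan α ℓ g) :
    ∃ δ, 0 < δ ∧ ∀ s t, |s - t| ≤ δ → |s - t| ≤ 2 * ‖g s - g t‖ := by
  obtain ⟨C, hC⟩ := hg.holder_deriv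
  have hlim : Filter.Tendsto (fun x : ℝ => C * x ^ α) (nhds 0) (nhds 0) := by
    have h := ((Real.continuousAt_rpow_const 0 α (Or.inr hα.le)).tendsto).const_mul C
    rwa [Real.zero_rpow hα.ne', mul_zero] at h
  obtain ⟨δ, hδ, hb⟩ := Metric.eventually_nhds_iff.1 (hlim.eventually_le_const
    (show (0 : ℝ) < 1 / 2 by norm_num))
  refine ⟨δ / 2, by positivity, fun s t hst => ?_⟩
  have hbound : ∀ x ∈ uIcc t s, ‖deriv g x - deriv g t‖ ≤ 1 / 2 := by
    intro x hx
    have hxt : |x - t| ≤ |s - t| := abs_sub_left_of_mem_uIcc hx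
    refine (hC x t).trans (hb ?_)
    rw [Real.dist_eq, sub_zero, abs_abs]
    linarith
  have h1 : ‖(g s - s * deriv g t) - (g t - t * deriv g t)‖ ≤ 1 / 2 * ‖s - t‖ := by
    refine (convex_uIcc t s).norm_image_sub_le_of_norm_hasDerivWithin_le
      (f := fun x : ℝ => g x - x * deriv g t) (f' := fun x => deriv g x - deriv g t)
      (fun x _ => ?_) hbound left_mem_uIcc right_mem_uIcc
    have h := (hg.hasDerivAt x).sub ((Complex.ofRealCLM.hasDerivAt (x := x)).mul_const (deriv g t))
    simpa using! h.hasDerivWithinAt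
  have h2 : |s - t| = ‖((s : ℂ) - t) * deriv g t‖ := by
    rw [norm_mul, hg.unit_speed, mul_one, ← Complex.ofReal_sub, Complex.norm_real, Real.norm_eq_abs]
  have h3 : ((s : ℂ) - t) * deriv g t
      = (g s - g t) - ((g s - s * deriv g t) - (g t - t * deriv g t)) := by ring
  have h4 : ‖((s : ℂ) - t) * deriv g t‖ ≤ ‖g s - g t‖ + 1 / 2 * ‖s - t‖ := by
    rw [h3]
    exact (norm_sub_le _ _).trans (by linarith)
  rw [← h2, Real.norm_eq_abs] at h4
  linarith

lemma ChordArc.mono {b b' ℓ : ℝ} {g : ℝ → ℂ} (h : ChordArc b ℓ g) (hb : b ≤ b') :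
    ChordArc b' ℓ g := fun s hs t ht =>
  (h s hs t ht).trans (mul_le_mul_of_nonneg_right hb (norm_nonneg _))

lemma IsC1AlphaJordan.exists_chordArc {α ℓ : ℝ} (hα : 0 < α) {g : ℝ → ℂ}
    (hg : IsC1AlphaJordan α ℓ g) : ∃ B, 1 < B ∧ ChordArc B ℓ g := by
  obtain ⟨δ, hδ, hhalf⟩ := hg.exists_half_le hα
  have hℓ := hg.length_pos
  have hgc := hg.contDiff.continuous
  set S : Set (ℝ × ℝ) := (Icc 0 ℓ ×ˢ Icc 0 ℓ) ∩ {x | δ ≤ |x.1 - x.2| ∧ |x.1 - x.2| ≤ ℓ - δ} with hS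
  have hScomp : IsCompact S := by
    refine (isCompact_Icc.prod isCompact_Icc).inter_right ?_
    have hc : Continuous fun x : ℝ × ℝ => |x.1 - x.2| := by fun_prop
    exact (isClosed_le continuous_const hc).inter (isClosed_le hc continuous_const)
  have hpos : ∀ x ∈ S, 0 < ‖g x.1 - g x.2‖ := by
    have key : ∀ s t : ℝ, s ∈ Icc 0 ℓ → t ∈ Icc 0 ℓ → δ ≤ t - s → t - s ≤ ℓ - δ → g s ≠ g t := by
      intro s t hs ht h1 h2 heq
      rcases ht.2.lt_or_eq with h | h
      · have := hg.injOn ⟨hs.1, by linarith⟩ ⟨ht.1, h⟩ heq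
        linarith
      · have h0 : g t = g 0 := by rw [h, ← hg.periodic 0, zero_add]
        have := hg.injOn ⟨hs.1, by linarith⟩ ⟨le_rfl, hℓ⟩ (heq.trans h0)
        linarith
    rintro ⟨s, t⟩ ⟨⟨hs, ht⟩, h1, h2⟩
    rw [norm_pos_iff, sub_ne_zero]
    dsimp only at *
    rcases le_total s t with h | h
    · rw [abs_sub_comm, abs_of_nonneg (sub_nonneg.2 h)] at h1 h2
      exact key s t hs ht h1 h2
    · rw [abs_of_nonneg (sub_nonneg.2 h)] at h1 h2
      exact (key t s ht hs h1 h2).symm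
  obtain ⟨m, hm, hmS⟩ : ∃ m, 0 < m ∧ ∀ x ∈ S, m ≤ ‖g x.1 - g x.2‖ := by
    rcases S.eq_empty_or_nonempty with h | h
    · exact ⟨1, one_pos, by simp [h]⟩
    · obtain ⟨x, hx, hmin⟩ := hScomp.exists_isMinOn h
        (f := fun x : ℝ × ℝ => ‖g x.1 - g x.2‖) (by fun_prop)
      exact ⟨_, hpos x hx, fun y hy => hmin hy⟩
  refine ⟨2 + ℓ / m, by have := div_pos hℓ hm; linarith, fun s hs t ht => ?_⟩
  have hquot : 0 ≤ ℓ / m * ‖g s - g t‖ := by positivity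
  rw [add_mul]
  have hnn := norm_nonneg (g s - g t)
  rcases le_or_gt |s - t| δ with h1 | h1
  · exact (min_le_left _ _).trans (by linarith [hhalf s t h1])
  rcases le_or_gt (ℓ - |s - t|) δ with h2 | h2
  · refine (min_le_right _ _).trans ?_
    -- across the base point the arc is measured after a shift by one period
    have key : ∀ s t : ℝ, s ≤ t → s ∈ Icc 0 ℓ → t ∈ Icc 0 ℓ → ℓ - (t - s) ≤ δ →
        ℓ - (t - s) ≤ 2 * ‖g s - g t‖ := by
      intro s t hst hs ht h
      have e : |s - (t - ℓ)| = ℓ - (t - s) := by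
        rw [abs_of_nonneg (by linarith [hs.1, ht.2])]; ring
      have h' := hhalf s (t - ℓ) (by rw [e]; exact h)
      rwa [e, hg.periodic.sub_eq] at h'
    rcases le_total s t with h | h
    · rw [abs_sub_comm, abs_of_nonneg (sub_nonneg.2 h)] at h2 ⊢
      linarith [key s t h hs ht h2]
    · rw [abs_of_nonneg (sub_nonneg.2 h)] at h2 ⊢
      have := key t s h ht hs h2
      rw [norm_sub_rev] at this
      linarith
  · have h3 := hmS (s, t) ⟨⟨hs, ht⟩, h1.le, by linarith⟩
    have h4 : |s - t| ≤ ℓ := by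
      rw [abs_le]; constructor <;> linarith [hs.1, hs.2, ht.1, ht.2]
    have h5 : ℓ ≤ ℓ / m * ‖g s - g t‖ := by
      rw [div_mul_eq_mul_div, le_div_iff₀ hm]
      exact mul_le_mul_of_nonneg_left h3 hℓ.le
    exact (min_le_left _ _).trans (by linarith)

lemma IsC1AlphaJordan.isArcOfLength {α ℓ : ℝ} {g : ℝ → ℂ} (hg : IsC1AlphaJordan α ℓ g) {s t : ℝ}
    (hst : s ≤ t) : IsArcOfLength (g '' Icc s t) (g s) (g t) (t - s) := by
  have hint : ∀ a b, IntervalIntegrable (deriv g) volume a b := fun a b =>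
    (hg.contDiff.continuous_deriv le_rfl).intervalIntegrable a b
  have h := isArcOfLength_of_integral (F := g) hst (hint s t) fun x _ => by
    rw [intervalIntegral.integral_eq_sub_of_hasDerivAt (fun x _ => hg.hasDerivAt x) (hint s x)]
    ring
  simpa [hg.unit_speed] using h

lemma IsC1AlphaJordan.exists_arc {α ℓ B : ℝ} {g : ℝ → ℂ} (hg : IsC1AlphaJordan α ℓ g)
    (hB : ChordArc B ℓ g) {p q : ℂ} (hp : p ∈ range g) (hq : q ∈ range g) :
    ∃ (σ : Set ℂ) (l : ℝ), σ ⊆ range g ∧ IsArcOfLength σ p q l ∧ l ≤ B * ‖p - q‖ := by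
  have key : ∀ s t : ℝ, s ∈ Ico 0 ℓ → t ∈ Ico 0 ℓ → s ≤ t →
      ∃ (σ : Set ℂ) (l : ℝ), σ ⊆ range g ∧ IsArcOfLength σ (g s) (g t) l ∧
        l ≤ B * ‖g s - g t‖ := by
    intro s t hs ht hst
    have h := hB s ⟨hs.1, hs.2.le⟩ t ⟨ht.1, ht.2.le⟩
    rw [abs_sub_comm, abs_of_nonneg (sub_nonneg.2 hst), min_le_iff] at h
    rcases h with h | h
    · exact ⟨_, _, image_subset_range _ _, hg.isArcOfLength hst, h⟩
    · have h1 := (hg.isArcOfLength (s := t) (t := s + ℓ) (by linarith [hs.1, ht.2])).symm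
      rw [hg.periodic] at h1
      exact ⟨_, _, image_subset_range _ _, h1, by linarith⟩
  obtain ⟨s', rfl⟩ := hp
  obtain ⟨t', rfl⟩ := hq
  obtain ⟨s, hs, hs'⟩ := hg.periodic.exists_mem_Ico₀ hg.length_pos s'
  obtain ⟨t, ht, ht'⟩ := hg.periodic.exists_mem_Ico₀ hg.length_pos t'
  rw [hs', ht']
  rcases le_total s t with h | h
  · exact key s t hs ht h
  · obtain ⟨σ, l, h1, h2, h3⟩ := key t s ht hs h
    exact ⟨σ, l, h1, h2.symm, by rwa [norm_sub_rev]⟩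

lemma jordanInterior_iff_of_isPreconnected {Γ T : Set ℂ} (hT : IsPreconnected T)
    (hd : Disjoint T Γ) {z w : ℂ} (hz : z ∈ T) (hw : w ∈ T) :
    z ∈ jordanInterior Γ ↔ w ∈ jordanInterior Γ := by
  have hs : T ⊆ Γᶜ := hd.subset_compl_right
  have h : connectedComponentIn Γᶜ w = connectedComponentIn Γᶜ z :=
    (connectedComponentIn_eq (hT.subset_connectedComponentIn hz hs hw)).symm
  simp only [jordanInterior, mem_ofPred_eq, h, hs hz, hs hw, true_and]

lemma isBounded_jordanInterior {Γ : Set ℂ} (hΓ : Bornology.IsBounded Γ) :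
    Bornology.IsBounded (jordanInterior Γ) := by
  obtain ⟨R, hR, hΓR⟩ := hΓ.exists_pos_norm_le
  refine isBounded_iff_forall_norm_le.2 ⟨R, fun z hz => ?_⟩
  by_contra! hzR
  have hsub : {w : ℂ | R < ‖w‖} ⊆ connectedComponentIn Γᶜ z :=
    (isPreconnected_norm_gt hR).subset_connectedComponentIn hzR
      fun w hw hwΓ => (hΓR w hwΓ).not_gt hw
  obtain ⟨M, hM⟩ := isBounded_iff_forall_norm_le.1 (hz.2.subset hsub)
  have h : ‖((max R M + 1 : ℝ) : ℂ)‖ = max R M + 1 := by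
    rw [Complex.norm_real, Real.norm_of_nonneg]
    linarith [le_max_left R M]
  have h1 := hM ((max R M + 1 : ℝ) : ℂ) (by
    rw [mem_ofPred_eq, h]; linarith [le_max_left R M])
  rw [h] at h1
  linarith [le_max_right R M]

lemma isCurveDomain_domainBetween {α ℓ ℓ₁ B : ℝ} {g g₁ : ℝ → ℂ} (hg : IsC1AlphaJordan α ℓ g)
    (hg₁ : IsC1AlphaJordan α ℓ₁ g₁) (hin : range g₁ ⊆ jordanInterior (range g))
    (hB : ChordArc B ℓ g) (hB₁ : ChordArc B ℓ₁ g₁) :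
    ∃ η, 0 < η ∧ IsCurveDomain (domainBetween (range g) (range g₁)) (range g ∪ range g₁) B η := by
  have hdisj : ∀ p ∈ range g, ∀ q ∈ range g₁, p ≠ q := fun p hp q hq h => (hin hq).1 (h ▸ hp)
  obtain ⟨η, hη, hsep⟩ : ∃ η, 0 < η ∧ ∀ p ∈ range g, ∀ q ∈ range g₁, η ≤ ‖p - q‖ := by
    obtain ⟨x, hx, hmin⟩ := (hg.isCompact_range.prod hg₁.isCompact_range).exists_isMinOn
      ⟨(g 0, g₁ 0), mem_range_self _, mem_range_self _⟩
      (f := fun x : ℂ × ℂ => ‖x.1 - x.2‖) (by fun_prop)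
    exact ⟨_, norm_pos_iff.2 (sub_ne_zero.2 (hdisj _ hx.1 _ hx.2)),
      fun p hp q hq => hmin (show (p, q) ∈ range g ×ˢ range g₁ from ⟨hp, hq⟩)⟩
  have hcomp : IsCompact (range g ∪ range g₁) := hg.isCompact_range.union hg₁.isCompact_range
  have hd : Disjoint (domainBetween (range g) (range g₁)) (range g ∪ range g₁) := by
    rw [Set.disjoint_left]
    rintro z ⟨h1, h2⟩ (h | h)
    · exact h1.1 h
    · exact h2 (Or.inl h)
  have hmax : ∀ T : Set ℂ, IsPreconnected T → Disjoint T (range g ∪ range g₁) →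
      (T ∩ domainBetween (range g) (range g₁)).Nonempty →
      T ⊆ domainBetween (range g) (range g₁) := by
    rintro T hT hTd ⟨z, hzT, hz1, hz2⟩ w hw
    rw [disjoint_union_right] at hTd
    refine ⟨(jordanInterior_iff_of_isPreconnected hT hTd.1 hzT hw).1 hz1, ?_⟩
    rintro (h | h)
    · exact Set.disjoint_left.1 hTd.2 hw h
    · exact hz2 (Or.inr ((jordanInterior_iff_of_isPreconnected hT hTd.2 hzT hw).2 h))
  refine ⟨η, hη, ?_, ?_, hcomp, hd, hmax, ?_⟩
  · refine Metric.isOpen_iff.2 fun z hz => ?_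
    obtain ⟨ε, hε, hb⟩ := Metric.isOpen_iff.1 hcomp.isClosed.isOpen_compl z
      (Set.disjoint_left.1 hd hz)
    exact ⟨ε, hε, hmax _ (convex_ball z ε).isPreconnected (Set.disjoint_left.2 fun w hw => hb hw)
      ⟨z, Metric.mem_ball_self hε, hz⟩⟩
  · exact (isBounded_jordanInterior hg.isCompact_range.isBounded).subset sdiff_subset
  · rintro p (hp | hp) q (hq | hq) hpq
    · obtain ⟨σ, l, h1, h2, h3⟩ := hg.exists_arc hB hp hq
      exact ⟨σ, l, h1.trans subset_union_left, h2, h3⟩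
    · exact absurd hpq (hsep p hp q hq).not_gt
    · rw [norm_sub_rev] at hpq
      exact absurd hpq (hsep q hq p hp).not_gt
    · obtain ⟨σ, l, h1, h2, h3⟩ := hg₁.exists_arc hB₁ hp hq
      exact ⟨σ, l, h1.trans subset_union_right, h2, h3⟩

/-! ### The boundary of the annulus as a graph -/

lemma isOpen_annulus (ρ : ℝ) : IsOpen (annulus ρ) :=
  (isOpen_lt continuous_const continuous_norm).inter (isOpen_lt continuous_norm continuous_const)

lemma isPreconnected_annulus {ρ : ℝ} (hρ : 0 < ρ) : IsPreconnected (annulus ρ) := by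
  have h1 : annulus ρ = Complex.exp '' ({w : ℂ | Real.log ρ < w.re} ∩ {w : ℂ | w.re < 0}) := by
    ext z
    constructor
    · rintro ⟨hz, hz1⟩
      have h0 : 0 < ‖z‖ := hρ.trans hz
      refine ⟨Complex.log z, ⟨?_, ?_⟩, Complex.exp_log (norm_pos_iff.1 h0)⟩
      · simpa [Complex.log_re] using Real.log_lt_log hρ hz
      · simpa [Complex.log_re] using Real.log_neg h0 hz1
    · rintro ⟨w, ⟨hw, hw1⟩, rfl⟩
      refine ⟨?_, ?_⟩
      · rw [Complex.norm_exp, ← Real.log_lt_iff_lt_exp hρ]; exact hw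
      · rw [Complex.norm_exp, Real.exp_lt_one_iff]; exact hw1
  rw [h1]
  exact (((convex_halfSpace_re_gt _).inter (convex_halfSpace_re_lt _)).isPreconnected).image _
    Complex.continuous_exp.continuousOn

lemma volume_annulus_ne_top (ρ : ℝ) : volume (annulus ρ) ≠ ⊤ := by
  refine ((measure_mono ?_).trans_lt (measure_ball_lt_top (x := (0 : ℂ)) (r := 1))).ne
  rintro z ⟨-, hz⟩
  simpa using hz

lemma setOf_I_mul_mem_annulus (ρ : ℝ) : {z | Complex.I * z ∈ annulus ρ} = annulus ρ := by
  ext z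
  simp [annulus]

section Circle

variable {R c s r : ℝ}

lemma le_of_sq_add_sq_eq (h : c ^ 2 + s ^ 2 = R ^ 2) (hs : |s| ≤ c) :
    7 / 10 * R ≤ c := by
  have hc : 0 ≤ c := (abs_nonneg s).trans hs
  have h1 : s ^ 2 ≤ c ^ 2 := sq_le_sq' (abs_le.1 hs).1 (abs_le.1 hs).2
  refine abs_le_of_sq_le_sq' (a := 7 / 10 * R) ?_ hc |>.2
  nlinarith [sq_nonneg R]

lemma abs_sqrt_sub_le (h : c ^ 2 + s ^ 2 = R ^ 2) (hs : |s| ≤ c) (hr : |r| ≤ c / 100) :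
    |√(R ^ 2 - (s + r) ^ 2) - c| ≤ 21 / 20 * |r| := by
  have hc : 0 ≤ c := (abs_nonneg s).trans hs
  have h0 := abs_nonneg r
  have h1 : |s * r| ≤ c * |r| := by rw [abs_mul]; gcongr
  have h2 := abs_le.1 h1
  have h3 : r ^ 2 = |r| ^ 2 := (sq_abs r).symm
  rw [abs_le]
  constructor
  · have : c - 21 / 20 * |r| ≤ √(R ^ 2 - (s + r) ^ 2) := Real.le_sqrt_of_sq_le (by nlinarith)
    linarith
  · have : √(R ^ 2 - (s + r) ^ 2) ≤ c + 21 / 20 * |r| :=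
      (Real.sqrt_le_left (by positivity)).2 (by nlinarith)
    linarith

lemma sqrt_add_sqrt_le (h : c ^ 2 + s ^ 2 = R ^ 2) (hs : |s| ≤ c) (hr : |r| ≤ c / 100) :
    √(R ^ 2 - (s + r) ^ 2) + √(R ^ 2 - (s - r) ^ 2) ≤ 2 * c := by
  have hc : 0 ≤ c := (abs_nonneg s).trans hs
  have h1 : |s * r| ≤ c * |r| := by rw [abs_mul]; gcongr
  have h2 := abs_le.1 h1
  have h3 : r ^ 2 = |r| ^ 2 := (sq_abs r).symm
  have h0 := abs_nonneg r
  have e1 := Real.sq_sqrt (show 0 ≤ R ^ 2 - (s + r) ^ 2 by nlinarith)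
  have e2 := Real.sq_sqrt (show 0 ≤ R ^ 2 - (s - r) ^ 2 by nlinarith)
  set A := √(R ^ 2 - (s + r) ^ 2)
  set B := √(R ^ 2 - (s - r) ^ 2)
  refine abs_le_of_sq_le_sq' (a := A + B) ?_ (by positivity) |>.2
  nlinarith [sq_nonneg (A - B), sq_nonneg r]

lemma le_sqrt_add_sqrt (h : c ^ 2 + s ^ 2 = R ^ 2) (hs : |s| ≤ c) (hr0 : 0 ≤ r)
    (hr : r ≤ c / 100) (hc : 0 < c) :
    2 * c - r / 10 ≤ √(R ^ 2 - (s + r) ^ 2) + √(R ^ 2 - (s - r) ^ 2) := by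
  -- each root is compared with its tangent line, of slope `-s / c`, lowered by `r / 20`
  obtain ⟨k, rfl⟩ : ∃ k, s = k * c := ⟨s / c, by field_simp⟩
  have hk : |k| ≤ 1 := by
    rw [abs_mul, abs_of_pos hc] at hs
    exact le_of_mul_le_mul_right (by linarith) hc
  have key : ∀ k : ℝ, |k| ≤ 1 → c ^ 2 + (k * c) ^ 2 = R ^ 2 →
      c - k * r - r / 20 ≤ √(R ^ 2 - (k * c + r) ^ 2) := by
    intro k hk h
    refine Real.le_sqrt_of_sq_le ?_
    have hk' := abs_le.1 hk
    have h1 : k ^ 2 ≤ 1 := by nlinarith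
    have h2 : r * r ≤ c / 100 * r := by gcongr
    have h3 : (k ^ 2 + k / 10 + 1 / 400 + 1) * (r * r) ≤ 3 * (c / 100 * r) :=
      mul_le_mul (by linarith) h2 (by positivity) (by norm_num)
    have h4 : 0 ≤ c * r := by positivity
    nlinarith
  have h1 := key k hk h
  have h2 := key (-k) (by rwa [abs_neg]) (by rw [← h]; ring)
  rw [show (-k * c + r) ^ 2 = (k * c - r) ^ 2 by ring] at h2
  linarith

end Circle

lemma norm_mk_sub_le (x y : ℝ) (a : ℂ) : ‖(⟨x, y⟩ : ℂ) - a‖ ≤ |x - a.re| + |y - a.im| := by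
  simpa using Complex.norm_le_abs_re_add_abs_im ((⟨x, y⟩ : ℂ) - a)

lemma isLocalGraph_outer {ρ r₀ : ℝ} {a : ℂ} (hr₀ : 0 < r₀) (hr1 : r₀ ≤ (1 - ρ) / 4)
    (hr2 : r₀ ≤ 1 / 400) (ha : ‖a‖ = 1) (hs : |a.im| ≤ a.re) :
    IsLocalGraph (annulus ρ) a (fun y => √(1 - y ^ 2)) r₀ := by
  have hsq : a.re ^ 2 + a.im ^ 2 = (1 : ℝ) ^ 2 := by
    rw [← ha, Complex.sq_norm, Complex.normSq_apply]; ring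
  have hc := le_of_sq_add_sq_eq hsq hs
  refine ⟨fun x y hy hx1 hx2 => ?_, fun r hr => ?_, fun r hr0 hr => ?_⟩
  · have hx0 : 0 ≤ x := by linarith
    rw [Real.lt_sqrt hx0]
    have hρ : ρ < ‖(⟨x, y⟩ : ℂ)‖ := by
      have h1 := norm_mk_sub_le x y a
      have h2 := norm_sub_norm_le a (⟨x, y⟩ : ℂ)
      rw [norm_sub_rev, ha] at h2
      have h3 : |x - a.re| ≤ 2 * r₀ := abs_le.2 ⟨by linarith, by linarith⟩
      linarith
    have h4 : ‖(⟨x, y⟩ : ℂ)‖ < 1 ↔ x ^ 2 + y ^ 2 < 1 := by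
      rw [← sq_lt_one_iff₀ (norm_nonneg _), Complex.sq_norm, Complex.normSq_apply]
      simp only [sq]
    rw [show ((⟨x, y⟩ : ℂ) ∈ annulus ρ ↔ _) from and_iff_right hρ, h4]
    constructor <;> intro h <;> linarith
  · simpa using abs_sqrt_sub_le hsq hs (hr.trans (by linarith))
  · have h := sqrt_add_sqrt_le hsq hs (r := r) (by rw [abs_of_nonneg hr0]; linarith)
    rw [one_pow] at h
    linarith

lemma isLocalGraph_inner {ρ r₀ : ℝ} {a : ℂ} (hρ : 0 < ρ) (hr₀ : 0 < r₀) (hr1 : r₀ ≤ (1 - ρ) / 4)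
    (hr2 : r₀ ≤ ρ / 400) (ha : ‖a‖ = ρ) (hs : |a.im| ≤ -a.re) :
    IsLocalGraph (annulus ρ) a (fun y => -√(ρ ^ 2 - y ^ 2)) r₀ := by
  have hsq : (-a.re) ^ 2 + a.im ^ 2 = ρ ^ 2 := by
    rw [← ha, Complex.sq_norm, Complex.normSq_apply]; ring
  have hc := le_of_sq_add_sq_eq hsq hs
  refine ⟨fun x y hy hx1 hx2 => ?_, fun r hr => ?_, fun r hr0 hr => ?_⟩
  · have hx0 : 0 < -x := by linarith
    rw [lt_neg, Real.sqrt_lt' hx0]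
    have h1' : ‖(⟨x, y⟩ : ℂ)‖ < 1 := by
      have h1 := norm_mk_sub_le x y a
      have h2 := norm_sub_norm_le (⟨x, y⟩ : ℂ) a
      rw [ha] at h2
      have h3 : |x - a.re| ≤ 2 * r₀ := abs_le.2 ⟨by linarith, by linarith⟩
      linarith
    have h4 : ρ < ‖(⟨x, y⟩ : ℂ)‖ ↔ ρ ^ 2 < x ^ 2 + y ^ 2 := by
      rw [← sq_lt_sq₀ hρ.le (norm_nonneg _), Complex.sq_norm, Complex.normSq_apply]
      simp only [sq]
    rw [show ((⟨x, y⟩ : ℂ) ∈ annulus ρ ↔ _) from and_iff_left h1', h4, neg_sq]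
    constructor <;> intro h <;> linarith
  · have h := abs_sqrt_sub_le hsq hs (hr.trans (by linarith))
    rw [← abs_neg]
    convert h using 2
    ring
  · have h := le_sqrt_add_sqrt hsq hs hr0 (by linarith) (by linarith)
    linarith

/-! ### Hölder continuity on the boundary circles -/

lemma exists_I_pow_mul (a : ℂ) : ∃ k < 4, ∃ b : ℂ, Complex.I ^ k * b = a ∧ |b.im| ≤ b.re := by
  have hI : ∀ b : ℂ, (Complex.I * b).re = -b.im ∧ (Complex.I * b).im = b.re := fun b => by simp
  rcases le_total |a.im| |a.re| with h | h
  · rcases le_total 0 a.re with h0 | h0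
    · exact ⟨0, by norm_num, a, by simp, by rwa [abs_of_nonneg h0] at h⟩
    · exact ⟨2, by norm_num, -a, by simp, by rw [abs_of_nonpos h0] at h; simpa using h⟩
  · rcases le_total 0 a.im with h0 | h0
    · exact ⟨1, by norm_num, -(Complex.I * a), by rw [pow_one, mul_neg, ← mul_assoc]; simp,
        by rw [abs_of_nonneg h0] at h; simpa using h⟩
    · exact ⟨3, by norm_num, Complex.I * a,
        by rw [← mul_assoc, ← pow_succ, Complex.I_pow_four, one_mul],
        by rw [abs_of_nonpos h0] at h; simpa using h⟩

lemma IsHomeoOnto.comp_I_mul {f : ℂ → ℂ} {ρ : ℝ} {Ω : Set ℂ} (h : IsHomeoOnto f (annulus ρ) Ω) :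
    IsHomeoOnto (fun z => f (Complex.I * z)) (annulus ρ) Ω := by
  obtain ⟨hf, v, hv, hmf, hmv, hinv⟩ := h
  have hI : ∀ z, Complex.I * z ∈ annulus ρ ↔ z ∈ annulus ρ := fun z => by simp [annulus]
  have hI' : ∀ z, -Complex.I * z ∈ annulus ρ ↔ z ∈ annulus ρ := fun z => by simp [annulus]
  refine ⟨hf.comp (by fun_prop) fun z hz => (hI z).2 hz, fun w => -Complex.I * v w,
    continuousOn_const.mul hv, fun z hz => hmf ((hI z).2 hz), fun w hw => (hI' _).2 (hmv hw),
    fun z hz => ?_, fun w hw => ?_⟩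
  · dsimp only
    rw [hinv.1 ((hI z).2 hz), ← mul_assoc]
    simp
  · dsimp only
    rw [← mul_assoc]
    simpa using hinv.2 hw

/-- Near the boundary of the annulus the oscillation of `f` on a disk of radius `δ` is at most a
multiple of a power of `δ`. -/
lemma exists_oscillation_le {ρ K K' B η : ℝ} (hρ : 0 < ρ) (hρ1 : ρ < 1) (hB : 1 ≤ B) (hη : 0 < η)
    (hK : 1 ≤ K) (hK' : 0 ≤ K') {Ω E : Set ℂ} (hΩ : IsCurveDomain Ω E B η) {f D₁ D₂ : ℂ → ℂ}
    (hf : IsHomeoOnto f (annulus ρ) Ω) (hG : GradData f D₁ D₂ (annulus ρ) K K') :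
    ∃ A δ₀ : ℝ, 0 < A ∧ 0 < δ₀ ∧ ∀ a : ℂ, ‖a‖ = 1 ∨ ‖a‖ = ρ → ∀ δ, 0 < δ → δ < δ₀ →
      ∀ z ∈ annulus ρ ∩ Metric.ball a δ, ∀ w ∈ annulus ρ ∩ Metric.ball a δ,
        ‖f z - f w‖ ≤ A * δ ^ (1 / (K * (1 + 2 * B) ^ 2)) := by
  have hrot : ∀ k : ℕ, IsHomeoOnto (fun z => f (Complex.I ^ k * z)) (annulus ρ) Ω ∧
      ∃ D₁ D₂, GradData (fun z => f (Complex.I ^ k * z)) D₁ D₂ (annulus ρ) K K' := by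
    intro k
    induction k with
    | zero => simpa using ⟨hf, _, _, hG⟩
    | succ k ih =>
      obtain ⟨h1, D₁, D₂, h2⟩ := ih
      have h3 := h1.comp_I_mul
      have h4 := h2.rotate
      rw [setOf_I_mul_mem_annulus] at h4
      simp only [← mul_assoc, ← pow_succ] at h3 h4
      exact ⟨h3, _, _, h4⟩
  set r₀ : ℝ := min ((1 - ρ) / 4) (ρ / 400) with hr₀
  have hr₀0 : 0 < r₀ := lt_min (by linarith) (by linarith)
  have hmem : ∀ t : ℝ, ρ < t → t < 1 → (t : ℂ) ∈ annulus ρ := fun t h1 h2 => by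
    have : ‖(t : ℂ)‖ = t := by rw [Complex.norm_real, Real.norm_of_nonneg (hρ.trans h1).le]
    exact ⟨by rwa [this], by rwa [this]⟩
  have hk : ∀ k : ℕ, ∃ A δ₀ : ℝ, 0 < A ∧ 0 < δ₀ ∧ ∀ a φ, IsLocalGraph (annulus ρ) a φ r₀ →
      ∀ δ, 0 < δ → δ < δ₀ → ∀ z ∈ annulus ρ ∩ openRect a δ, ∀ w ∈ annulus ρ ∩ openRect a δ,
        ‖f (Complex.I ^ k * z) - f (Complex.I ^ k * w)‖ ≤
          A * δ ^ (1 / (K * (1 + 2 * B) ^ 2)) := by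
    intro k
    obtain ⟨h1, D₁, D₂, h2⟩ := hrot k
    exact exists_holder_of_isLocalGraph hB hη hK hK' hΩ h1 (isOpen_annulus ρ)
      (isPreconnected_annulus hρ) (volume_annulus_ne_top ρ) h2
      (hmem ((2 * ρ + 1) / 3) (by linarith) (by linarith))
      (hmem ((ρ + 2) / 3) (by linarith) (by linarith))
      (fun h => by have := Complex.ofReal_injective h; linarith) hr₀0
  choose A δ₀ hA hδ₀ hosc using hk
  obtain ⟨δ₁, hδ₁, hδ₁le⟩ : ∃ δ₁ > 0, ∀ k < 4, δ₁ ≤ δ₀ k := by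
    refine ⟨(Finset.range 4).inf' ⟨0, by simp⟩ δ₀, ?_, fun k hk =>
      Finset.inf'_le _ (Finset.mem_range.2 hk)⟩
    exact (Finset.lt_inf'_iff _).2 fun k _ => hδ₀ k
  refine ⟨∑ k ∈ Finset.range 4, A k, δ₁, Finset.sum_pos (fun k _ => hA k) ⟨0, by simp⟩, hδ₁, ?_⟩
  intro a ha δ hδ hδlt
  obtain ⟨k, hk4, b, hba, φ, hφ⟩ : ∃ k < 4, ∃ b : ℂ, Complex.I ^ k * b = a ∧
      ∃ φ, IsLocalGraph (annulus ρ) b φ r₀ := by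
    rcases ha with ha | ha
    · obtain ⟨k, hk, b, hb, hs⟩ := exists_I_pow_mul a
      refine ⟨k, hk, b, hb, _, isLocalGraph_outer hr₀0 (min_le_left _ _)
        ((min_le_right _ _).trans (by linarith)) ?_ hs⟩
      rw [← ha, ← hb]; simp
    · obtain ⟨k, hk, b, hb, hs⟩ := exists_I_pow_mul (-a)
      refine ⟨k, hk, -b, by rw [mul_neg, hb, neg_neg], _, isLocalGraph_inner hρ hr₀0
        (min_le_left _ _) (min_le_right _ _) ?_ (by simpa using hs)⟩
      rw [← ha, norm_neg, ← norm_neg a, ← hb]; simp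
  have hmove : ∀ z ∈ annulus ρ ∩ Metric.ball a δ, ∃ z' ∈ annulus ρ ∩ openRect b δ,
      Complex.I ^ k * z' = z := by
    rintro z ⟨⟨hz1, hz2⟩, hzb⟩
    have hI0 : Complex.I ^ k ≠ 0 := pow_ne_zero _ Complex.I_ne_zero
    have hz' : Complex.I ^ k * (z / Complex.I ^ k) = z := by field_simp
    have hnorm : ‖z / Complex.I ^ k‖ = ‖z‖ := by simp
    refine ⟨z / Complex.I ^ k, ⟨⟨by rwa [hnorm], by rwa [hnorm]⟩, ?_⟩, hz'⟩
    have hd : ‖z / Complex.I ^ k - b‖ < δ := by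
      rw [mem_ball_iff_norm, ← hz', ← hba, ← mul_sub, norm_mul] at hzb
      simpa using hzb
    have h1 := abs_le.1 (Complex.abs_re_le_norm (z / Complex.I ^ k - b))
    have h2 := abs_le.1 (Complex.abs_im_le_norm (z / Complex.I ^ k - b))
    rw [Complex.sub_re] at h1
    rw [Complex.sub_im] at h2
    exact ⟨⟨by linarith, by linarith⟩, ⟨by linarith, by linarith⟩⟩
  intro z hz w hw
  obtain ⟨z', hz', rfl⟩ := hmove z hz
  obtain ⟨w', hw', rfl⟩ := hmove w hw
  refine (hosc k b φ hφ δ hδ (hδlt.trans_le (hδ₁le k hk4)) z' hz' w' hw').trans ?_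
  gcongr
  exact Finset.single_le_sum (fun k _ => (hA k).le) (Finset.mem_range.2 hk4)

lemma closedAnnulus_subset_closure {ρ : ℝ} (hρ : 0 < ρ) (hρ1 : ρ < 1) :
    closedAnnulus ρ ⊆ closure (annulus ρ) := by
  rintro z ⟨hz1, hz2⟩
  have hn : ∀ t : ℝ, 0 ≤ t → ‖(t : ℂ) * z‖ = t * ‖z‖ := fun t ht => by
    rw [norm_mul, Complex.norm_real, Real.norm_of_nonneg ht]
  have hlim : Filter.Tendsto (fun t : ℝ => (t : ℂ) * z) (nhds 1) (nhds z) := by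
    have : Continuous fun t : ℝ => (t : ℂ) * z := by fun_prop
    simpa using this.tendsto 1
  rcases hz1.eq_or_lt with h | h
  · refine mem_closure_of_tendsto (hlim.mono_left (nhdsWithin_le_nhds (s := Ioi 1))) ?_
    filter_upwards [Ioo_mem_nhdsGT (show 1 < 1 / ρ from (one_lt_div hρ).2 hρ1)] with t ht
    have ht0 : 0 < t := one_pos.trans ht.1
    rw [mem_Ioo, lt_div_iff₀ hρ] at ht
    refine ⟨?_, ?_⟩ <;> rw [hn t ht0.le, ← h]
    · nlinarith [ht.1]
    · exact ht.2
  · refine mem_closure_of_tendsto (hlim.mono_left (nhdsWithin_le_nhds (s := Iio 1))) ?_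
    have h0 : 0 < ‖z‖ := hρ.trans h
    filter_upwards [Ioo_mem_nhdsLT (show ρ / ‖z‖ < 1 from (div_lt_one h0).2 h)] with t ht
    have ht0 : 0 < t := (by positivity : 0 < ρ / ‖z‖).trans ht.1
    rw [mem_Ioo, div_lt_iff₀ h0] at ht
    refine ⟨?_, ?_⟩ <;> rw [hn t ht0.le]
    · exact ht.1
    · nlinarith [ht.2]

lemma isCompact_closedAnnulus (ρ : ℝ) : IsCompact (closedAnnulus ρ) := by
  refine (isCompact_closedBall (0 : ℂ) 1).of_isClosed_subset ?_ ?_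
  · exact (isClosed_le continuous_const continuous_norm).inter
      (isClosed_le continuous_norm continuous_const)
  · rintro z ⟨-, hz⟩
    simpa using hz

/-- A continuous map whose oscillation near the boundary is controlled by a power `β` extends
continuously, with a `β`-Hölder extension to each boundary circle. -/
lemma exists_extension_of_oscillation {ρ A δ₀ β : ℝ} (hρ : 0 < ρ) (hρ1 : ρ < 1) (hβ : 0 < β)
    (hA : 0 < A) (hδ₀ : 0 < δ₀) {f : ℂ → ℂ} (hf : ContinuousOn f (annulus ρ))
    (hosc : ∀ a : ℂ, ‖a‖ = 1 ∨ ‖a‖ = ρ → ∀ δ, 0 < δ → δ < δ₀ →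
      ∀ z ∈ annulus ρ ∩ Metric.ball a δ, ∀ w ∈ annulus ρ ∩ Metric.ball a δ,
        ‖f z - f w‖ ≤ A * δ ^ β) :
    ∃ F : ℂ → ℂ, ContinuousOn F (closedAnnulus ρ) ∧ EqOn F f (annulus ρ) ∧
      ∃ L : ℝ, 0 < L ∧ ∀ z₁ z₂ : ℂ, ‖z₁‖ = 1 ∨ ‖z₁‖ = ρ → ‖z₂‖ = ‖z₁‖ →
        ‖F z₁ - F z₂‖ ≤ L * ‖z₁ - z₂‖ ^ β := by
  have hcl := closedAnnulus_subset_closure hρ hρ1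
  have hbd : ∀ a : ℂ, ‖a‖ = 1 ∨ ‖a‖ = ρ → a ∈ closedAnnulus ρ := by
    rintro a (h | h)
    · exact ⟨by linarith, h.le⟩
    · exact ⟨h.ge, by linarith⟩
  have hlim : ∀ x ∈ closedAnnulus ρ, ∃ y, Filter.Tendsto f (nhdsWithin x (annulus ρ)) (nhds y) := by
    intro x hx
    by_cases hxU : x ∈ annulus ρ
    · exact ⟨f x, hf x hxU⟩
    have hx' : ‖x‖ = 1 ∨ ‖x‖ = ρ := by
      by_contra! h
      exact hxU ⟨hx.1.lt_of_ne h.2.symm, hx.2.lt_of_ne h.1⟩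
    have hne : (nhdsWithin x (annulus ρ)).NeBot := mem_closure_iff_nhdsWithin_neBot.1 (hcl hx)
    refine cauchy_map_iff_exists_tendsto.1 (Metric.cauchy_iff.2 ⟨hne.map f, fun ε hε => ?_⟩)
    have h0 : Filter.Tendsto (fun δ : ℝ => A * δ ^ β) (nhdsWithin 0 (Ioi 0)) (nhds 0) := by
      have h := ((Real.continuousAt_rpow_const 0 β (Or.inr hβ.le)).tendsto).const_mul A
      rw [Real.zero_rpow hβ.ne', mul_zero] at h
      exact h.mono_left nhdsWithin_le_nhds
    obtain ⟨δ, h1, h2⟩ := ((h0.eventually_lt_const hε).and (Ioo_mem_nhdsGT hδ₀)).exists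
    refine ⟨f '' (annulus ρ ∩ Metric.ball x δ), Filter.image_mem_map
      (inter_mem_nhdsWithin _ (Metric.ball_mem_nhds x h2.1)), ?_⟩
    rintro _ ⟨z, hz, rfl⟩ _ ⟨w, hw, rfl⟩
    rw [dist_eq_norm]
    exact (hosc x hx' δ h2.1 h2.2 z hz w hw).trans_lt h1
  set F := extendFrom (annulus ρ) f with hF
  have hFc : ContinuousOn F (closedAnnulus ρ) := continuousOn_extendFrom hcl hlim
  obtain ⟨M, hM⟩ := (isCompact_closedAnnulus ρ).exists_bound_of_continuousOn hFc
  have hM0 : 0 ≤ M := (norm_nonneg _).trans (hM 1 (hbd 1 (Or.inl norm_one)))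
  refine ⟨F, hFc, fun z hz => extendFrom_eq (subset_closure hz) (hf z hz),
    A * 2 ^ β + 2 * M * (2 / δ₀) ^ β, by positivity, fun z₁ z₂ h1 h2 => ?_⟩
  rcases eq_or_ne z₁ z₂ with rfl | hne
  · simp only [sub_self, norm_zero]; positivity
  have hd : 0 < ‖z₁ - z₂‖ := norm_pos_iff.2 (sub_ne_zero.2 hne)
  set d := ‖z₁ - z₂‖ with hdef
  have hz₁ := hbd z₁ h1
  have hz₂ := hbd z₂ (h2.symm ▸ h1)
  rw [add_mul]
  have hp1 : 0 ≤ A * 2 ^ β * d ^ β := by positivity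
  have hp2 : 0 ≤ 2 * M * (2 / δ₀) ^ β * d ^ β := by positivity
  rcases lt_or_ge (2 * d) δ₀ with hdδ | hdδ
  · have n1 : (nhdsWithin z₁ (annulus ρ)).NeBot := mem_closure_iff_nhdsWithin_neBot.1 (hcl hz₁)
    have n2 : (nhdsWithin z₂ (annulus ρ)).NeBot := mem_closure_iff_nhdsWithin_neBot.1 (hcl hz₂)
    have hball : ∀ z, dist z z₁ < 2 * d → ∀ᶠ w in nhdsWithin z (annulus ρ),
        w ∈ annulus ρ ∩ Metric.ball z₁ (2 * d) := fun z hz =>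
      inter_mem_nhdsWithin _ (Metric.isOpen_ball.mem_nhds hz)
    have key : ‖F z₁ - F z₂‖ ≤ A * (2 * d) ^ β := by
      refine le_of_tendsto ((((tendsto_extendFrom (hlim z₂ hz₂)).const_sub (F z₁))).norm)
        ((hball z₂ (by rw [dist_comm, dist_eq_norm]; linarith)).mono fun w hw => ?_)
      refine le_of_tendsto ((((tendsto_extendFrom (hlim z₁ hz₁)).sub_const (f w))).norm)
        ((hball z₁ (by rw [dist_self]; linarith)).mono fun z hz => ?_)
      exact hosc z₁ h1 (2 * d) (by positivity) hdδ z hz w hw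
    rw [Real.mul_rpow (by norm_num) hd.le, ← mul_assoc] at key
    linarith
  · have h3 : ‖F z₁ - F z₂‖ ≤ 2 * M :=
      (norm_sub_le _ _).trans (by linarith [hM z₁ hz₁, hM z₂ hz₂])
    have h4 : (1 : ℝ) ≤ (2 / δ₀ * d) ^ β := by
      refine Real.one_le_rpow ?_ hβ.le
      rw [div_mul_eq_mul_div, one_le_div hδ₀]; exact hdδ
    rw [Real.mul_rpow (by positivity) hd.le] at h4
    nlinarith

end KKQC

theorem lemma3p2 (α : ℝ) (hα : 0 < α) (hα1 : α ≤ 1)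
    (ℓ ℓ₁ : ℝ) (g g₁ : ℝ → ℂ)
    (hg : KKQC.IsC1AlphaJordan α ℓ g) (hg₁ : KKQC.IsC1AlphaJordan α ℓ₁ g₁)
    (hin : Set.range g₁ ⊆ KKQC.jordanInterior (Set.range g)) :
    (∃ B : ℝ, 1 < B ∧ KKQC.ChordArc B ℓ g ∧ KKQC.ChordArc B ℓ₁ g₁) ∧
    ∀ B : ℝ, 1 < B → KKQC.ChordArc B ℓ g → KKQC.ChordArc B ℓ₁ g₁ →
      ∀ (ρ K K' : ℝ), 0 < ρ → ρ < 1 → 1 ≤ K → 0 ≤ K' →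
      ∀ f : ℂ → ℂ,
        KKQC.IsQC K K' f (KKQC.annulus ρ)
          (KKQC.domainBetween (Set.range g) (Set.range g₁)) →
        ∃ F : ℂ → ℂ, ContinuousOn F (KKQC.closedAnnulus ρ) ∧
          Set.EqOn F f (KKQC.annulus ρ) ∧
          ∃ L : ℝ, 0 < L ∧
            (∀ z₁ z₂ : ℂ, ‖z₁‖ = 1 → ‖z₂‖ = 1 →
              ‖F z₁ - F z₂‖ ≤ L * ‖z₁ - z₂‖ ^ (1 / (K * (1 + 2 * B) ^ 2))) ∧
            (∀ z₁ z₂ : ℂ, ‖z₁‖ = ρ → ‖z₂‖ = ρ →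
              ‖F z₁ - F z₂‖ ≤ L * ‖z₁ - z₂‖ ^ (1 / (K * (1 + 2 * B) ^ 2))) := by
  constructor
  · obtain ⟨b, hb, hgb⟩ := hg.exists_chordArc hα
    obtain ⟨b₁, hb₁, hgb₁⟩ := hg₁.exists_chordArc hα
    exact ⟨max b b₁, hb.trans_le (le_max_left _ _), hgb.mono (le_max_left _ _),
      hgb₁.mono (le_max_right _ _)⟩
  · intro B hB hgB hg₁B ρ K K' hρ hρ1 hK hK' f hf
    obtain ⟨η, hη, hΩ⟩ := KKQC.isCurveDomain_domainBetween hg hg₁ hin hgB hg₁B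
    obtain ⟨A, δ₀, hA, hδ₀, hosc⟩ := KKQC.exists_oscillation_le hρ hρ1 hB.le hη hK hK' hΩ hf.homeo
      (hf.gradData hK hK' (KKQC.isOpen_annulus ρ) hΩ.isOpen)
    obtain ⟨F, hFc, hFe, L, hL, hFL⟩ := KKQC.exists_extension_of_oscillation hρ hρ1
      (β := 1 / (K * (1 + 2 * B) ^ 2)) (by positivity) hA hδ₀ hf.homeo.1 hosc
    exact ⟨F, hFc, hFe, L, hL, fun z₁ z₂ h1 h2 => hFL z₁ z₂ (Or.inl h1) (h2.trans h1.symm),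
      fun z₁ z₂ h1 h2 => hFL z₁ z₂ (Or.inr h1) (h2.trans h1.symm)⟩
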